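/- Let $n\ge 1$ and $r\ge 0$ be integers and let $F_r$ be the free group on $x_1,\dots,x_r$. For a group $G$ put $\mathcal R_r(G)=\mathrm{Hom}(F_r,G)$, identified with $G^r$ by $\rho\mapsto(\rho(x_1),\dots,\rho(x_r))$, on which $G$ acts by conjugation. For a complex affine reductive group $G$ let $$\mathfrak X_r(G)=\mathrm{Spec}_{max}\big(\mathbb C[\mathcal R_r(G)]^{G}\big),$$ and for a compact group $K$ let $\mathfrak X_r(K)=\mathcal R_r(K)/K$ be the orbit space with the quotient topology, with its semi-algebraic structure given by embedding it in some $\mathbb R^k$ by a finite set of generators of the algebra $\mathbb R[\mathcal R_r(K)]^K$ of invariant real polynomial functions. Let $\mathrm{PSL}_n=\mathrm{SL}_n(\mathbb C)/Z(\mathrm{SL}_n(\mathbb C))$ and $\mathrm{PU}(n)=\mathrm U(n)/Z(\mathrm U(n))$, with the regular (respectively real polynomial) functions being those whose pull-backs to $\mathrm{SL}_n(\mathbb C)$ (respectively $\mathrm U(n)$) are regular (respectively real polynomial). Let $\mathbb Z_n=Z(\mathrm{SL}_n(\mathbb C))=Z(\mathrm{SU}(n))$ be the group of $n$-th roots of unity;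 the group $\mathbb Z_n^r$ acts on $\mathfrak X_r(\mathrm{SL}_n)$ and on $\mathfrak X_r(\mathrm{SU}(n))$ through $(z\cdot\rho)(x_i)=z_i\,\rho(x_i)$. For an affine variety $X$ with an action of a group $\Gamma$ write $X/\!\!/\Gamma=\mathrm{Spec}_{max}(\mathbb C[X]^\Gamma)$; similarly the quotient $\mathfrak X_r(\mathrm{SU}(n))/\mathbb Z_n^r$ is the orbit space, embedded by generators of the algebra of $\mathbb Z_n^r$-invariants in $\mathbb R[\mathcal R_r(\mathrm{SU}(n))]^{\mathrm{SU}(n)}$. Then: 1. $\mathfrak X_r(\mathrm{PSL}_n)$ and $\mathfrak X_r(\mathrm{SL}_n)/\!\!/\mathbb Z_n^r$ are affine algebraic varieties (not necessarily irreducible), and there is an isomorphism of algebraic varieties $$\mathfrak X_r(\mathrm{SL}_n)/\!\!/\mathbb Z_n^r\;\cong\;\mathfrak X_r(\mathrm{PSL}_n)$$ that sends the class of $\rho\in\mathcal R_r(\mathrm{SL}_n)$ to the class of its composition with $\mathrm{SL}_n\to\mathrm{PSL}_n$. 2. $\mathfrak X_r(\mathrm{PU}(n))$ and $\mathfrak X_r(\mathrm{SU}(n))/\mathbb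 Z_n^r$ are semi-algebraic sets (the embeddings above exist and have semi-algebraic images), and there is an isomorphism of semi-algebraic sets (a homeomorphism with semi-algebraic graph) $$\mathfrak X_r(\mathrm{SU}(n))/\mathbb Z_n^r\;\cong\;\mathfrak X_r(\mathrm{PU}(n))$$ that sends the class of $\rho\in\mathcal R_r(\mathrm{SU}(n))$ to the class of its composition with $\mathrm{SU}(n)\subseteq\mathrm U(n)\to\mathrm{PU}(n)$. -/

import Mathlib

noncomputable section

namespace CharVar

/-! ### Spaces with an algebra of regular functions -/

/-- A set `X` together with a `k`-algebra of `k`-valued functions on it, called regular. For an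
affine variety over an algebraically closed field these are the elements of the coordinate ring;
for a real algebraic set they are the polynomial functions. -/
class FunctionSpace (k : Type) [Field k] (X : Type) where
  /-- the algebra of regular functions -/
  reg : Subalgebra k (X → k)

/-- The algebra `k[X]` of regular functions on `X`. -/
def regular (k : Type) [Field k] (X : Type) [FunctionSpace k X] : Subalgebra k (X → k) :=
  FunctionSpace.reg

/-- Pull-back of functions along a map. -/
def pullback (k : Type) [Field k] {X Y : Type} (φ : X → Y) : (Y → k) →ₐ[k] (X → k) where
  toFun f := f ∘ φ
  map_one' := rfl
  map_mul' _ _ := rfl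
  map_zero' := rfl
  map_add' _ _ := rfl
  commutes' _ := rfl

/-- Evaluation of regular functions at a point, a `k`-algebra homomorphism `k[X] → k`. -/
def evalAt (k : Type) [Field k] {X : Type} [FunctionSpace k X] (x : X) : regular k X →ₐ[k] k :=
  (Pi.evalAlgHom k (fun _ : X => k) x).comp (regular k X).val

/-- `X` is an affine variety (a not necessarily irreducible affine algebraic set): its algebra of
regular functions is finitely generated, and its points are exactly the `k`-points of that
algebra. -/
def IsAffineVariety (k : Type) [Field k] (X : Type) [FunctionSpace k X] : Prop :=
  (regular k X).FG ∧ Function.Bijective (fun x : X => evalAt k x)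

/-- An isomorphism of affine varieties: a bijection such that a function on the target is regular
if and only if its pull-back to the source is regular. -/
structure VarietyIso (k : Type) [Field k] (X Y : Type) [FunctionSpace k X] [FunctionSpace k Y]
    extends X ≃ Y where
  regular_iff : ∀ f : Y → k, f ∈ regular k Y ↔ f ∘ toEquiv ∈ regular k X

/-! ### GIT quotients -/

section GIT

variable (k : Type) [Field k] (Γ : Type) [Group Γ] (X : Type) [FunctionSpace k X] [MulAction Γ X]

/-- The algebra `k[X]^Γ` of invariant regular functions. -/
def invariants : Subalgebra k (X → k) where
  carrier := {f | f ∈ regular k X ∧ ∀ (g : Γ) (x : X), f (g • x) = f x}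
  mul_mem' := fun ha hb =>
    ⟨mul_mem ha.1 hb.1, fun g x => by simp only [Pi.mul_apply, ha.2 g x, hb.2 g x]⟩
  add_mem' := fun ha hb =>
    ⟨add_mem ha.1 hb.1, fun g x => by simp only [Pi.add_apply, ha.2 g x, hb.2 g x]⟩
  algebraMap_mem' := fun c => ⟨Subalgebra.algebraMap_mem _ c, fun _ _ => rfl⟩

/-- The affine GIT quotient `X // Γ = Spec_max (k[X]^Γ)`. -/
def GITQuotient : Type := MaximalSpectrum (invariants k Γ X)

variable {k Γ X} in
/-- The maximal ideal of `k[X]^Γ` that a point of `X // Γ` is. -/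
def GITQuotient.ideal (m : GITQuotient k Γ X) : Ideal (invariants k Γ X) :=
  MaximalSpectrum.asIdeal m

/-- A function `F` on `Spec_max (k[X]^Γ)` is regular if some `b ∈ k[X]^Γ` has, at every maximal
ideal `m`, the value `F m`, that is, `b` is congruent to the constant `F m` modulo `m`. -/
instance : FunctionSpace k (GITQuotient k Γ X) where
  reg :=
    { carrier := {F | ∃ b : invariants k Γ X, ∀ m : GITQuotient k Γ X,
        b - algebraMap k (invariants k Γ X) (F m) ∈ m.ideal}
      mul_mem' := by
        rintro F G ⟨a, ha⟩ ⟨b, hb⟩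
        refine ⟨a * b, fun m => ?_⟩
        have h := m.ideal.add_mem (m.ideal.mul_mem_left a (hb m))
          (m.ideal.mul_mem_left (algebraMap k (invariants k Γ X) (G m)) (ha m))
        convert h using 1
        rw [Pi.mul_apply, map_mul]
        ring
      add_mem' := by
        rintro F G ⟨a, ha⟩ ⟨b, hb⟩
        refine ⟨a + b, fun m => ?_⟩
        have h := m.ideal.add_mem (ha m) (hb m)
        convert h using 1
        rw [Pi.add_apply, map_add]
        ring
      algebraMap_mem' := by
        intro c
        refine ⟨algebraMap k _ c, fun m => ?_⟩
        have h : algebraMap k (invariants k Γ X) c -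
            algebraMap k (invariants k Γ X) ((algebraMap k (GITQuotient k Γ X → k) c) m) = 0 :=
          sub_self _
        rw [h]
        exact m.ideal.zero_mem }

variable {X}

/-- Evaluation of invariant regular functions at a point of `X`. -/
def evalInv (x : X) : invariants k Γ X →ₐ[k] k :=
  (Pi.evalAlgHom k (fun _ : X => k) x).comp (invariants k Γ X).val

/-- The projection `X → X // Γ`, which sends `x` to the maximal ideal of the invariant regular
functions that vanish at `x`. -/
def gitProj (x : X) : GITQuotient k Γ X where
  asIdeal := RingHom.ker (evalInv k Γ x)
  isMaximal := RingHom.ker_isMaximal_of_surjective _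
    (fun c => ⟨algebraMap k _ c, (evalInv k Γ x).commutes c⟩)

end GIT

/-- A group acts on `X` by automorphisms of its algebra of regular functions. -/
class RegularAction (k : Type) [Field k] (Z : Type) [Group Z] (X : Type) [FunctionSpace k X]
    [MulAction Z X] : Prop where
  comp_mem : ∀ (z : Z) (f : X → k), f ∈ regular k X → (fun x => f (z • x)) ∈ regular k X

section InducedAction

variable (k : Type) [Field k] (Γ Z : Type) [Group Γ] [Group Z] (X : Type) [FunctionSpace k X]
  [MulAction Γ X] [MulAction Z X] [SMulCommClass Z Γ X] [RegularAction k Z X]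

/-- The pull-back `f ↦ (x ↦ f (z • x))` on `Γ`-invariant regular functions, for an action of `Z`
that commutes with the action of `Γ`. -/
def pullInv (z : Z) : invariants k Γ X →ₐ[k] invariants k Γ X where
  toFun f := ⟨fun x => f.1 (z • x), RegularAction.comp_mem z f.1 f.2.1, fun g x => by
    change f.1 (z • g • x) = f.1 (z • x)
    rw [smul_comm z g x, f.2.2 g (z • x)]⟩
  map_one' := rfl
  map_mul' _ _ := rfl
  map_zero' := rfl
  map_add' _ _ := rfl
  commutes' _ := rfl

theorem pullInv_surjective (z : Z) : Function.Surjective (pullInv k Γ Z X z) := fun f =>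
  ⟨pullInv k Γ Z X z⁻¹ f, Subtype.ext (funext fun x => congrArg f.1 (inv_smul_smul z x))⟩

/-- The action induced on `X // Γ` by an action of `Z` on `X` that commutes with that of `Γ`: the
element `z` sends a maximal ideal `m` to the ideal of all `f` with `f (z • ·) ∈ m`. -/
instance : MulAction Z (GITQuotient k Γ X) where
  smul z m :=
    { asIdeal := m.asIdeal.comap (pullInv k Γ Z X z)
      isMaximal :=
        have := m.isMaximal
        Ideal.comap_isMaximal_of_surjective _ (pullInv_surjective k Γ Z X z) }
  one_smul m := MaximalSpectrum.ext (Ideal.ext fun f => by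
    have h : pullInv k Γ Z X 1 f = f :=
      Subtype.ext (funext fun x => congrArg f.1 (one_smul Z x))
    change pullInv k Γ Z X 1 f ∈ m.asIdeal ↔ _
    rw [h])
  mul_smul z w m := MaximalSpectrum.ext (Ideal.ext fun f => by
    have h : pullInv k Γ Z X (z * w) f = pullInv k Γ Z X w (pullInv k Γ Z X z f) :=
      Subtype.ext (funext fun x => congrArg f.1 (mul_smul z w x))
    change pullInv k Γ Z X (z * w) f ∈ m.asIdeal ↔
      pullInv k Γ Z X w (pullInv k Γ Z X z f) ∈ m.asIdeal
    rw [h])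

/-- The induced action on `X // Γ` makes the projection equivariant. -/
theorem smul_gitProj (z : Z) (x : X) : z • gitProj k Γ x = gitProj k Γ (z • x) := rfl

end InducedAction

/-! ### Orbit spaces -/

section Orbit

variable (Γ : Type) [Group Γ] (X : Type) [MulAction Γ X]

/-- The orbit space `X / Γ`. -/
def OrbitSpace : Type := Quotient (MulAction.orbitRel Γ X)

variable {X}

/-- The projection `X → X / Γ`. -/
def orbitProj (x : X) : OrbitSpace Γ X := Quotient.mk (MulAction.orbitRel Γ X) x

variable (X)

/-- The quotient topology. -/
instance [TopologicalSpace X] : TopologicalSpace (OrbitSpace Γ X) :=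
  TopologicalSpace.coinduced (orbitProj Γ) inferInstance

/-- A function on `X / Γ` is regular if its pull-back to `X` is, so `k[X / Γ] = k[X]^Γ`. -/
instance (k : Type) [Field k] [FunctionSpace k X] : FunctionSpace k (OrbitSpace Γ X) where
  reg := (regular k X).comap (pullback k (orbitProj Γ))

variable (Z : Type) [Group Z] [MulAction Z X] [SMulCommClass Z Γ X]

/-- The action induced on `X / Γ` by an action of `Z` on `X` that commutes with that of `Γ`. -/
instance : MulAction Z (OrbitSpace Γ X) where
  smul z := Quotient.map (z • ·) (by
    rintro _ y ⟨g, rfl⟩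
    exact ⟨g, (smul_comm z g y).symm⟩)
  one_smul := by
    rintro ⟨x⟩
    exact congrArg (orbitProj Γ) (one_smul Z x)
  mul_smul z w := by
    rintro ⟨x⟩
    exact congrArg (orbitProj Γ) (mul_smul z w x)

end Orbit

/-! ### The groups `SL_n`, `PSL_n`, `U(n)`, `SU(n)`, `PU(n)` -/

/-- `SL_n(ℂ)`. -/
abbrev SL (n : ℕ) : Type := Matrix.SpecialLinearGroup (Fin n) ℂ

/-- `U(n)`. -/
abbrev U (n : ℕ) : Type := Matrix.unitaryGroup (Fin n) ℂ

/-- `SU(n)`. -/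
abbrev SU (n : ℕ) : Type := Matrix.specialUnitaryGroup (Fin n) ℂ

/-- `P G = G / Z(G)`, the quotient of a group by its centre. -/
abbrev Proj (G : Type) [Group G] : Type := G ⧸ Subgroup.center G

/-- The regular functions on `SL_n(ℂ)` are the complex polynomials in the matrix entries. -/
instance (n : ℕ) : FunctionSpace ℂ (SL n) where
  reg := Algebra.adjoin ℂ {f | ∃ i j, f = fun A => A.1 i j}

/-- The regular functions on `U(n)` are the real polynomials in the real and imaginary parts of the
matrix entries. -/
instance (n : ℕ) : FunctionSpace ℝ (U n) where
  reg := Algebra.adjoin ℝ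
    ({f | ∃ i j, f = fun A => (A.1 i j).re} ∪ {f | ∃ i j, f = fun A => (A.1 i j).im})

/-- The regular functions on `SU(n)` are the real polynomials in the real and imaginary parts of
the matrix entries. -/
instance (n : ℕ) : FunctionSpace ℝ (SU n) where
  reg := Algebra.adjoin ℝ
    ({f | ∃ i j, f = fun A => (A.1 i j).re} ∪ {f | ∃ i j, f = fun A => (A.1 i j).im})

/-- The algebraic structure of a quotient group `G / N`: a function is regular if its pull-back to
`G` is regular. -/
instance (k : Type) [Field k] (G : Type) [Group G] [FunctionSpace k G] (N : Subgroup G) :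
    FunctionSpace k (G ⧸ N) where
  reg := (regular k G).comap (pullback k (QuotientGroup.mk : G → G ⧸ N))

/-! ### Representation varieties of free groups -/

/-- `R_r(G) = Hom(F_r, G)`, where `F_r` is the free group on `x_1, …, x_r`. -/
def Rep (r : ℕ) (G : Type) [Group G] : Type := FreeGroup (Fin r) →* G

section Rep

variable {r : ℕ} {G H : Type} [Group G] [Group H]

/-- The value `ρ(x_i)` of a representation at the `i`-th generator. -/
def Rep.gen (ρ : Rep r G) (i : Fin r) : G :=
  (show FreeGroup (Fin r) →* G from ρ) (FreeGroup.of i)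

/-- The representation with prescribed values at the generators. -/
def Rep.ofGen (g : Fin r → G) : Rep r G := FreeGroup.lift g

/-- The representation `φ ∘ ρ`. -/
def Rep.comp (φ : G →* H) (ρ : Rep r G) : Rep r H := MonoidHom.comp φ ρ

@[simp] theorem Rep.gen_ofGen (g : Fin r → G) (i : Fin r) : (Rep.ofGen g).gen i = g i :=
  FreeGroup.lift_apply_of

theorem Rep.ext {ρ σ : Rep r G} (h : ∀ i, ρ.gen i = σ.gen i) : ρ = σ :=
  FreeGroup.ext_hom _ _ h

/-- `R_r(G)` has the product topology of `G^r` under `ρ ↦ (ρ(x_1), …, ρ(x_r))`. -/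
instance [TopologicalSpace G] : TopologicalSpace (Rep r G) :=
  TopologicalSpace.induced Rep.gen inferInstance

/-- `R_r(G)` has the product structure of `G^r` under `ρ ↦ (ρ(x_1), …, ρ(x_r))`: the regular
functions are the polynomials in regular functions of the single values `ρ(x_i)`. -/
instance (k : Type) [Field k] [FunctionSpace k G] : FunctionSpace k (Rep r G) where
  reg := Algebra.adjoin k {F | ∃ (i : Fin r), ∃ f ∈ regular k G, F = fun ρ => f (ρ.gen i)}

/-- The conjugation action `(g • ρ)(x) = g ρ(x) g⁻¹`. -/
instance : MulAction G (Rep r G) where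
  smul g ρ := Rep.comp (MulAut.conj g).toMonoidHom ρ
  one_smul ρ := Rep.ext fun i => by
    change (1 : G) * ρ.gen i * (1 : G)⁻¹ = ρ.gen i
    simp
  mul_smul g h ρ := Rep.ext fun i => by
    change (g * h) * ρ.gen i * (g * h)⁻¹ = g * (h * ρ.gen i * h⁻¹) * g⁻¹
    group

theorem Rep.gen_conj (g : G) (ρ : Rep r G) (i : Fin r) : (g • ρ).gen i = g * ρ.gen i * g⁻¹ := rfl

/-- The action of `Z(G)^r` by multiplication: `(z • ρ)(x_i) = z_i ρ(x_i)`. -/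
instance : MulAction (Fin r → Subgroup.center G) (Rep r G) where
  smul z ρ := Rep.ofGen fun i => (z i : G) * ρ.gen i
  one_smul ρ := Rep.ext fun i => by
    change (Rep.ofGen fun i => (((1 : Fin r → Subgroup.center G) i : G) * ρ.gen i)).gen i = _
    simp
  mul_smul z w ρ := Rep.ext fun i => by
    change (Rep.ofGen fun i => (((z * w) i : Subgroup.center G) : G) * ρ.gen i).gen i =
      (Rep.ofGen fun i => (z i : G) * (Rep.ofGen fun i => (w i : G) * ρ.gen i).gen i).gen i
    simp [mul_assoc]

theorem Rep.gen_central (z : Fin r → Subgroup.center G) (ρ : Rep r G) (i : Fin r) :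
    (z • ρ).gen i = (z i : G) * ρ.gen i := Rep.gen_ofGen _ i

instance : SMulCommClass (Fin r → Subgroup.center G) G (Rep r G) where
  smul_comm z g ρ := Rep.ext fun i => by
    rw [Rep.gen_central, Rep.gen_conj, Rep.gen_conj, Rep.gen_central]
    have h := Subgroup.mem_center_iff.mp (z i).2 g
    calc (z i : G) * (g * ρ.gen i * g⁻¹) = ((z i : G) * g) * ρ.gen i * g⁻¹ := by group
      _ = g * ((z i : G) * ρ.gen i) * g⁻¹ := by rw [← h]; group

end Rep

/-- Left translations of `SL_n(ℂ)` are regular. -/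
theorem SL.translate_mem {n : ℕ} (A : SL n) {f : SL n → ℂ} (hf : f ∈ regular ℂ (SL n)) :
    (fun B => f (A * B)) ∈ regular ℂ (SL n) := by
  suffices h : regular ℂ (SL n) ≤
      (regular ℂ (SL n)).comap (pullback ℂ fun B : SL n => A * B) from h hf
  refine Algebra.adjoin_le ?_
  rintro _ ⟨i, j, rfl⟩
  change (fun B : SL n => (A * B).1 i j) ∈ regular ℂ (SL n)
  have h : (fun B : SL n => (A * B).1 i j) =
      ∑ l, A.1 i l • (fun B : SL n => B.1 l j) := by
    funext B
    simp [Matrix.mul_apply]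
  rw [h]
  refine sum_mem fun l _ => Subalgebra.smul_mem _ ?_ _
  apply Algebra.subset_adjoin
  exact ⟨l, j, rfl⟩

instance (n r : ℕ) :
    RegularAction ℂ (Fin r → Subgroup.center (SL n)) (Rep r (SL n)) where
  comp_mem z f hf := by
    suffices h : regular ℂ (Rep r (SL n)) ≤
        (regular ℂ (Rep r (SL n))).comap (pullback ℂ fun ρ : Rep r (SL n) => z • ρ) from h hf
    refine Algebra.adjoin_le ?_
    rintro _ ⟨i, f, hf, rfl⟩
    exact Algebra.subset_adjoin (R := ℂ)
      (s := {F | ∃ (i : Fin r), ∃ f ∈ regular ℂ (SL n), F = fun ρ : Rep r (SL n) => f (ρ.gen i)})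
      ⟨i, _, SL.translate_mem (z i : SL n) hf,
        funext fun ρ => congrArg f (Rep.gen_central z ρ i)⟩

/-! ### Character varieties -/

/-- For a complex algebraic group `G`, `X_r(G) = Spec_max (ℂ[R_r(G)]^G)`. -/
abbrev XC (r : ℕ) (G : Type) [Group G] [FunctionSpace ℂ G] : Type := GITQuotient ℂ G (Rep r G)

/-- For a compact group `K`, `X_r(K) = R_r(K) / K`. -/
abbrev XK (r : ℕ) (K : Type) [Group K] : Type := OrbitSpace K (Rep r K)

/-- The quotient map `SL_n → PSL_n = SL_n / Z(SL_n)`. -/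
def slToPSL (n : ℕ) : SL n →* Proj (SL n) := QuotientGroup.mk' _

/-- The homomorphism `SU(n) ⊆ U(n) → PU(n) = U(n) / Z(U(n))`. -/
def suToPU (n : ℕ) : SU n →* Proj (U n) :=
  (QuotientGroup.mk' _).comp
    (Submonoid.inclusion Matrix.specialUnitaryGroup_le_unitaryGroup)

/-! ### Semi-algebraic sets -/

/-- Semi-algebraic subsets of `ℝ^ι`: the finite Boolean combinations of sets `{p > 0}` with `p` a
real polynomial. -/
inductive IsSemialgebraic {ι : Type} : Set (ι → ℝ) → Prop
  | pos (p : MvPolynomial ι ℝ) : IsSemialgebraic {x | 0 < MvPolynomial.eval x p}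
  | compl {S : Set (ι → ℝ)} : IsSemialgebraic S → IsSemialgebraic Sᶜ
  | inter {S T : Set (ι → ℝ)} : IsSemialgebraic S → IsSemialgebraic T → IsSemialgebraic (S ∩ T)

section Semialgebraic

variable (X Y : Type) [TopologicalSpace X] [TopologicalSpace Y] [FunctionSpace ℝ X]
  [FunctionSpace ℝ Y]

/-- `p : X → ℝ^k` is a system of coordinates if `p_1, …, p_k` generate the algebra `ℝ[X]`. -/
def IsCoordinates {X : Type} [FunctionSpace ℝ X] {k : ℕ} (p : X → Fin k → ℝ) : Prop :=
  Algebra.adjoin ℝ (Set.range fun (i : Fin k) (x : X) => p x i) = regular ℝ X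

/-- `X` is a semi-algebraic set: it has systems of coordinates, and each of them is a topological
embedding of `X` onto a semi-algebraic subset of `ℝ^k`. -/
def IsSemialgebraicSpace : Prop :=
  (∃ (k : ℕ) (p : X → Fin k → ℝ), IsCoordinates p) ∧
  ∀ (k : ℕ) (p : X → Fin k → ℝ), IsCoordinates p →
    Topology.IsEmbedding p ∧ IsSemialgebraic (Set.range p)

/-- An isomorphism of semi-algebraic sets: a homeomorphism whose graph, in any systems of
coordinates on the source and the target, is semi-algebraic. -/
structure SemialgebraicIso extends X ≃ₜ Y where
  graph_semialgebraic : ∀ (k l : ℕ) (p : X → Fin k → ℝ) (q : Y → Fin l → ℝ),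
    IsCoordinates p → IsCoordinates q →
    IsSemialgebraic (Set.range fun x : X => Sum.elim (p x) (q (toHomeomorph x)))

end Semialgebraic

end CharVar

end

noncomputable section

namespace CharVar

/-! ### Projections of semi-algebraic sets -/

section Projection

open Polynomial Set

/-! Everything is compared on the representation space of `SL_n` or `SU(n)`. Let `Z` be the centre.
A regular function on `R_r(SL_n)` invariant under `Z^r` equals its own average over `Z^r`. Averaging
a product of functions of the single values averages each factor separately, so the function is a
polynomial in `Z`-invariant functions of single values (`mem_adjoin_of_central_invariant`) and
descends to `R_r(PSL_n)`. Hence both sides of the complex statement are the maximal spectrum of one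
algebra: the regular functions on `R_r(SL_n)` invariant under `SL_n` and `Z^r`. It is finitely
generated by Hilbert's argument (`fg_of_reynolds`), with the Haar average over a compact group as
Reynolds operator; Weyl's unitary trick (`invariant_of_su_invariant`) passes from `SU(n)` to `SL_n`.
The Nullstellensatz then makes the spectrum an affine variety.

In the compact case both spaces are quotients of the compact space `R_r(SU(n))` by `SU(n) × Z^r`,
with the invariant polynomial functions as regular functions (`IsPolynomialQuotient`). The delicate
point is that regularity on `PU(n)` is tested on `U(n)`: a `Z`-invariant polynomial function on
`SU(n)` needs a scalar-invariant extension to `U(n)`. Monomials in the entries and their conjugates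
have a weight under scalars of norm one; a weight that is trivial on `Z` is divisible by `n` and is
cancelled by a power of the determinant or of its conjugate (`exists_scalar_invariant_extension`).
For any such quotient the invariants are finitely generated and separate points
(`exists_invariant_separating`), so generators embed it by compactness. Its image, and the graph of
the comparison map, are images of a compact real algebraic set under polynomial maps.

Such images are semi-algebraic by the bounded case of the Tarski-Seidenberg theorem, proved in the
manner of Cohen and Hörmander: derivatives and remainders reduce the sign pattern of a family of
polynomials in one variable to finitely many signs of functions of the parameters
(`signDetermined_of_finite`). These functions are piecewise rational, which permits division by
leading coefficients. Projecting along `[-1, 1]` avoids any discussion of infinity. -/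

/-- Inside an interval `(a, b)` any point can be moved to any other one by an order automorphism of
the line that is the identity outside of the interval. -/
theorem exists_orderIso_move_of_le {a b u v : ℝ} (hau : a < u) (huv : u ≤ v) (hvb : v < b) :
    ∃ τ : ℝ ≃o ℝ, (∀ x, x ≤ a ∨ b ≤ x → τ x = x) ∧ τ u = v := by
  set s := (v - a) / (u - a) with hs
  set t := (b - v) / (b - u) with ht
  have h1 : 0 < u - a := by linarith
  have h2 : 0 < b - u := by linarith
  have hs1 : 1 ≤ s := by rw [hs, le_div_iff₀ h1]; linarith
  have ht0 : 0 < t := by rw [ht]; apply div_pos <;> linarith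
  have ht1 : t ≤ 1 := by rw [ht, div_le_iff₀ h2]; linarith
  have hsu : s * (u - a) = v - a := by rw [hs]; field_simp
  have htu : t * (b - u) = b - v := by rw [ht]; field_simp
  -- The minimum is the broken line through `(a, a)`, `(u, v)` and `(b, b)`. Its slopes `s ≥ 1` and
  -- `t ≤ 1` put it below the diagonal outside `[a, b]`, where the maximum is therefore the
  -- identity.
  let f : ℝ → ℝ := fun x => max x (min (a + s * (x - a)) (b - t * (b - x)))
  have hmono : StrictMono f := by
    intro x y hxy
    have e1 : a + s * (x - a) < a + s * (y - a) := by nlinarith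
    have e2 : b - t * (b - x) < b - t * (b - y) := by nlinarith
    exact max_lt_max hxy (min_lt_min e1 e2)
  have hcont : Continuous f := by fun_prop
  have hge : ∀ x, b ≤ x → f x = x := fun x hx => by
    apply max_eq_left
    refine (min_le_right _ _).trans ?_
    nlinarith
  have hle : ∀ x, x ≤ a → f x = x := fun x hx => by
    apply max_eq_left
    refine (min_le_left _ _).trans ?_
    nlinarith
  have hsurj : Function.Surjective f := by
    apply hcont.surjective
    · refine Filter.tendsto_id.congr' ?_
      filter_upwards [Filter.eventually_ge_atTop b] with x hx using (hge x hx).symm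
    · refine Filter.tendsto_id.congr' ?_
      filter_upwards [Filter.eventually_le_atBot a] with x hx using (hle x hx).symm
  refine ⟨hmono.orderIsoOfSurjective f hsurj, ?_, ?_⟩
  · rintro x (hx | hx)
    exacts [hle x hx, hge x hx]
  · change max u (min (a + s * (u - a)) (b - t * (b - u))) = v
    rw [hsu, htu, add_sub_cancel, sub_sub_cancel, min_self, max_eq_right huv]

theorem exists_orderIso_move {a b u v : ℝ} (hau : a < u) (hub : u < b) (hav : a < v)
    (hvb : v < b) : ∃ τ : ℝ ≃o ℝ, (∀ x, x ≤ a ∨ b ≤ x → τ x = x) ∧ τ u = v := by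
  rcases le_total u v with h | h
  · exact exists_orderIso_move_of_le hau h hvb
  · obtain ⟨τ, h1, h2⟩ := exists_orderIso_move_of_le hav h hub
    refine ⟨τ.symm, fun x hx => ?_, ?_⟩
    · rw [OrderIso.symm_apply_eq, h1 x hx]
    · rw [OrderIso.symm_apply_eq, h2]

/-- Two increasing functions with the same signs at the ends of their intervals have the same signs
up to a change of the identification of the intervals. -/
theorem exists_orderIso_sign_eq_of_strictMonoOn {p q : ℝ → ℝ} {a b : ℝ} (hab : a < b)
    (e : ℝ ≃o ℝ) (hp : StrictMonoOn p (Icc a b)) (hq : StrictMonoOn q (Icc (e a) (e b)))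
    (hpc : Continuous p) (hqc : Continuous q)
    (ha : SignType.sign (p a) = SignType.sign (q (e a)))
    (hb : SignType.sign (p b) = SignType.sign (q (e b))) :
    ∃ e' : ℝ ≃o ℝ, (∀ x, x ≤ a ∨ b ≤ x → e' x = e x) ∧
      ∀ x ∈ Icc a b, SignType.sign (p x) = SignType.sign (q (e' x)) := by
  have hab' : e a < e b := e.strictMono hab
  have hmem : ∀ x ∈ Icc a b, e x ∈ Icc (e a) (e b) := fun x hx =>
    ⟨e.monotone hx.1, e.monotone hx.2⟩
  have hla : a ∈ Icc a b := left_mem_Icc.2 hab.le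
  have hlb : b ∈ Icc a b := right_mem_Icc.2 hab.le
  rcases le_or_gt 0 (p a) with h0 | h0
  -- Both functions are nonnegative at the left end, hence positive after it, and `e` needs no
  -- change.
  · refine ⟨e, fun _ _ => rfl, fun x hx => ?_⟩
    have h0' : 0 ≤ q (e a) := by rwa [← sign_nonneg_iff, ← ha, sign_nonneg_iff]
    rcases hx.1.eq_or_lt with rfl | hlt
    · exact ha
    · rw [sign_pos (h0.trans_lt (hp hla hx hlt)),
        sign_pos (h0'.trans_lt (hq (hmem a hla) (hmem x hx) (e.strictMono hlt)))]
  rcases le_or_gt (p b) 0 with h1 | h1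
  · refine ⟨e, fun _ _ => rfl, fun x hx => ?_⟩
    have h1' : q (e b) ≤ 0 := by rwa [← sign_nonpos_iff, ← hb, sign_nonpos_iff]
    rcases hx.2.eq_or_lt with rfl | hlt
    · exact hb
    · rw [sign_neg ((hp hx hlb hlt).trans_le h1),
        sign_neg ((hq (hmem x hx) (hmem b hlb) (e.strictMono hlt)).trans_le h1')]
  have h0' : q (e a) < 0 := by rwa [← sign_eq_neg_one_iff, ← ha, sign_eq_neg_one_iff]
  have h1' : 0 < q (e b) := by rwa [← sign_eq_one_iff, ← hb, sign_eq_one_iff]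
  obtain ⟨c, hc, hc0⟩ := intermediate_value_Ioo hab.le hpc.continuousOn ⟨h0, h1⟩
  obtain ⟨d, hd, hd0⟩ := intermediate_value_Ioo hab'.le hqc.continuousOn ⟨h0', h1'⟩
  -- Each function has exactly one zero, `c` and `d`; it suffices to move `e c` onto `d`.
  obtain ⟨τ, h2, h3⟩ := exists_orderIso_move (e.strictMono hc.1) (e.strictMono hc.2) hd.1 hd.2
  have hτ : ∀ x, x ≤ a ∨ b ≤ x → (e.trans τ) x = e x := fun x hx =>
    h2 _ (hx.imp (fun h => e.monotone h) fun h => e.monotone h)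
  refine ⟨e.trans τ, hτ, fun x hx => ?_⟩
  have hx' : (e.trans τ) x ∈ Icc (e a) (e b) := by
    rw [← hτ a (Or.inl le_rfl), ← hτ b (Or.inr le_rfl)]
    exact ⟨(e.trans τ).monotone hx.1, (e.trans τ).monotone hx.2⟩
  have hcd : (e.trans τ) c = d := h3
  have hc' := Ioo_subset_Icc_self hc
  have hd' := Ioo_subset_Icc_self hd
  rcases lt_trichotomy x c with h | rfl | h
  · rw [sign_neg (by rw [← hc0]; exact hp hx hc' h), sign_neg (by
      rw [← hd0]; exact hq hx' hd' (by rw [← hcd]; exact (e.trans τ).strictMono h))]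
  · rw [hcd, hc0, hd0]
  · rw [sign_pos (by rw [← hc0]; exact hp hc' hx h), sign_pos (by
      rw [← hd0]; exact hq hd' hx' (by rw [← hcd]; exact (e.trans τ).strictMono h))]

theorem strictMonoOn_eval_of_derivative_pos {p : ℝ[X]} {a b : ℝ}
    (h : ∀ x ∈ Ioo a b, 0 < p.derivative.eval x) : StrictMonoOn (fun x => p.eval x) (Icc a b) :=
  strictMonoOn_of_deriv_pos (convex_Icc a b) p.continuous.continuousOn fun x hx => by
    rw [interior_Icc] at hx
    simpa using h x hx

/-- A polynomial without roots in an interval has constant sign there. -/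
theorem sign_eval_eq_of_no_root {p : ℝ[X]} {a b : ℝ} (h : ∀ x ∈ Ioo a b, p.eval x ≠ 0) {x y : ℝ}
    (hx : x ∈ Ioo a b) (hy : y ∈ Ioo a b) :
    SignType.sign (p.eval x) = SignType.sign (p.eval y) := by
  have hc := isPreconnected_Ioo.image (fun x => p.eval x) (s := Ioo a b) p.continuous.continuousOn
  have h0 : (0 : ℝ) ∉ (fun x => p.eval x) '' Ioo a b := by
    rintro ⟨z, hz, hz0⟩
    exact h z hz hz0
  have ho := hc.ordConnected
  rcases lt_or_gt_of_ne (h x hx) with h1 | h1 <;> rcases lt_or_gt_of_ne (h y hy) with h2 | h2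
  · rw [sign_neg h1, sign_neg h2]
  · exact absurd (ho.out ⟨x, hx, rfl⟩ ⟨y, hy, rfl⟩ ⟨h1.le, h2.le⟩) h0
  · exact absurd (ho.out ⟨y, hy, rfl⟩ ⟨x, hx, rfl⟩ ⟨h2.le, h1.le⟩) h0
  · rw [sign_pos h1, sign_pos h2]

/-- Without zeros of the derivatives both polynomials are strictly monotone on the cell, in the same
direction. Two identifications occur because the derivatives are matched by the original `e₀`, while
`e` may already have been changed on other cells; only their values at the ends have to agree. -/
theorem exists_orderIso_sign_eq_on_cell {p q : ℝ[X]} {a b : ℝ} (hab : a < b) (e e₀ : ℝ ≃o ℝ)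
    (hea : e a = e₀ a) (heb : e b = e₀ b)
    (hd : ∀ x ∈ Ioo a b,
      SignType.sign (p.derivative.eval x) = SignType.sign (q.derivative.eval (e₀ x)))
    (hd0 : ∀ x ∈ Ioo a b, p.derivative.eval x ≠ 0)
    (ha : SignType.sign (p.eval a) = SignType.sign (q.eval (e a)))
    (hb : SignType.sign (p.eval b) = SignType.sign (q.eval (e b))) :
    ∃ e' : ℝ ≃o ℝ, (∀ x, x ≤ a ∨ b ≤ x → e' x = e x) ∧
      ∀ x ∈ Icc a b, SignType.sign (p.eval x) = SignType.sign (q.eval (e' x)) := by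
  wlog hpos : 0 < p.derivative.eval ((a + b) / 2) generalizing p q
  · have hm : (a + b) / 2 ∈ Ioo a b := ⟨by linarith, by linarith⟩
    have key := this (p := -p) (q := -q)
      (by simpa [Left.sign_neg] using hd) (by simpa using hd0)
      (by simpa [Left.sign_neg] using ha) (by simpa [Left.sign_neg] using hb)
      (by simpa using lt_of_le_of_ne (not_lt.1 hpos) (hd0 _ hm))
    simpa [Left.sign_neg] using key
  have hm : (a + b) / 2 ∈ Ioo a b := ⟨by linarith, by linarith⟩
  have hp : ∀ x ∈ Ioo a b, 0 < p.derivative.eval x := fun x hx => by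
    rw [← sign_eq_one_iff, sign_eval_eq_of_no_root hd0 hx hm, sign_eq_one_iff]
    exact hpos
  refine exists_orderIso_sign_eq_of_strictMonoOn hab e (strictMonoOn_eval_of_derivative_pos hp)
    (strictMonoOn_eval_of_derivative_pos fun x hx => ?_) p.continuous q.continuous ha hb
  rw [hea, heb] at hx
  have hx' : e₀.symm x ∈ Ioo a b :=
    ⟨by rw [e₀.lt_symm_apply]; exact hx.1, by rw [e₀.symm_apply_lt]; exact hx.2⟩
  have := hd _ hx'
  rw [e₀.apply_symm_apply, sign_pos (hp _ hx')] at this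
  exact sign_eq_one_iff.1 this.symm

/-- If an identification of the interval `[-1, 1]` with itself matches the signs of two families
of polynomials, then it can be changed such that it also matches the signs of `p` and `q`, provided
that the derivatives of `p` and `q` are in the families and that the signs of `p` and `q` are
matched at the ends of the interval and at the roots of the members of the families. -/
theorem exists_orderIso_sign_eq_insert {ι : Type*} [Finite ι] (f g : ι → ℝ[X]) (p q : ℝ[X])
    (e : ℝ ≃o ℝ) (he : e (-1) = -1) (he' : e 1 = 1)
    (hfg : ∀ i, ∀ x ∈ Icc (-1 : ℝ) 1,
      SignType.sign ((f i).eval x) = SignType.sign ((g i).eval (e x)))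
    (i₀ : ι) (hf : f i₀ = p.derivative) (hg : g i₀ = q.derivative)
    (hl : SignType.sign (p.eval (-1)) = SignType.sign (q.eval (-1)))
    (hr : SignType.sign (p.eval 1) = SignType.sign (q.eval 1))
    (hroot : ∀ i, ∀ x ∈ Icc (-1 : ℝ) 1, f i ≠ 0 → (f i).eval x = 0 →
      SignType.sign (p.eval x) = SignType.sign (q.eval (e x))) :
    ∃ e' : ℝ ≃o ℝ, e' (-1) = -1 ∧ e' 1 = 1 ∧
      (∀ i, ∀ x ∈ Icc (-1 : ℝ) 1,
        SignType.sign ((f i).eval x) = SignType.sign ((g i).eval (e' x))) ∧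
      ∀ x ∈ Icc (-1 : ℝ) 1, SignType.sign (p.eval x) = SignType.sign (q.eval (e' x)) := by
  set Z : Set ℝ := {x | x ∈ Icc (-1 : ℝ) 1 ∧ (x = -1 ∨ x = 1 ∨ ∃ i, f i ≠ 0 ∧ (f i).eval x = 0)}
    with hZ
  have hZl : (-1 : ℝ) ∈ Z := ⟨by simp, Or.inl rfl⟩
  have hZr : (1 : ℝ) ∈ Z := ⟨by simp, Or.inr (Or.inl rfl)⟩
  have hfin : Z.Finite := by
    have : Z ⊆ {-1, 1} ∪ ⋃ i, ((f i).roots.toFinset : Set ℝ) := by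
      rintro x ⟨-, rfl | rfl | ⟨i, hi, hx⟩⟩
      · simp
      · simp
      · refine Or.inr (mem_iUnion.2 ⟨i, ?_⟩)
        simpa [hi] using hx
    exact (((finite_singleton _).insert _).union
      (finite_iUnion fun i => Finset.finite_toSet _)).subset this
  have hpZ : ∀ x ∈ Z, SignType.sign (p.eval x) = SignType.sign (q.eval (e x)) := by
    rintro x ⟨hx, rfl | rfl | ⟨i, hi, h⟩⟩
    · rw [he, hl]
    · rw [he', hr]
    · exact hroot i x hx hi h
  have hprev : ∀ x ∈ Ioc (-1 : ℝ) 1, ∃ a ∈ Z, a < x ∧ ∀ z ∈ Z, z < x → z ≤ a := fun x hx => by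
    obtain ⟨a, ha, hmax⟩ := (hfin.subset (inter_subset_left (t := Iio x))).exists_maximal
      ⟨-1, hZl, hx.1⟩
    exact ⟨a, ha.1, ha.2, fun z hz hzx => not_lt.1 fun h => not_lt.2 (hmax ⟨hz, hzx⟩ h.le) h⟩
  have hnext : ∀ x ∈ Ico (-1 : ℝ) 1, ∃ b ∈ Z, x < b ∧ ∀ z ∈ Z, x < z → b ≤ z := fun x hx => by
    obtain ⟨a, ha, hmin⟩ := (hfin.subset (inter_subset_left (t := Ioi x))).exists_minimal
      ⟨1, hZr, hx.2⟩
    exact ⟨a, ha.1, ha.2, fun z hz hzx => not_lt.1 fun h => not_lt.2 (hmin ⟨hz, hzx⟩ h.le) h⟩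
  have hmaps : ∀ e' : ℝ ≃o ℝ, e' (-1) = -1 → e' 1 = 1 → ∀ x ∈ Icc (-1 : ℝ) 1,
      e' x ∈ Icc (-1 : ℝ) 1 := fun e' h1 h2 x hx => by
    have h3 := e'.monotone hx.1
    have h4 := e'.monotone hx.2
    rw [h1] at h3
    rw [h2] at h4
    exact ⟨h3, h4⟩
  -- Between neighbouring points of `Z` no nonzero `f i` has a root, so `g i` has none between their
  -- images. Any `e'` that agrees with `e` on `Z` therefore keeps the match.
  have hmatch : ∀ e' : ℝ ≃o ℝ, (∀ z ∈ Z, e' z = e z) → ∀ i, ∀ x ∈ Icc (-1 : ℝ) 1,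
      SignType.sign ((f i).eval x) = SignType.sign ((g i).eval (e' x)) := by
    intro e' h i x hx
    by_cases hxZ : x ∈ Z
    · rw [h x hxZ, hfg i x hx]
    have hx1 : x ≠ -1 := fun h => hxZ (h ▸ hZl)
    have hx2 : x ≠ 1 := fun h => hxZ (h ▸ hZr)
    have hlt := lt_of_le_of_ne hx.1 hx1.symm
    have hlt' := lt_of_le_of_ne hx.2 hx2
    obtain ⟨a, haZ, hax, hamax⟩ := hprev x ⟨hlt, hx.2⟩
    obtain ⟨b, hbZ, hxb, hbmin⟩ := hnext x ⟨hx.1, hlt'⟩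
    have hnot : ∀ z ∈ Ioo a b, z ∉ Z := fun z hz hzZ => by
      rcases lt_trichotomy z x with h | h | h
      · exact absurd (hamax z hzZ h) (not_le.2 hz.1)
      · exact hxZ (h ▸ hzZ)
      · exact absurd (hbmin z hzZ h) (not_le.2 hz.2)
    have hI : ∀ z ∈ Ioo a b, z ∈ Icc (-1 : ℝ) 1 := fun z hz =>
      ⟨haZ.1.1.trans hz.1.le, hz.2.le.trans hbZ.1.2⟩
    rw [hfg i x hx]
    by_cases hi : f i = 0
    · have : ∀ t ∈ Icc (-1 : ℝ) 1, (g i).eval t = 0 := fun t ht => by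
        have h2 := hfg i (e.symm t) ⟨by rw [e.le_symm_apply, he]; exact ht.1,
          by rw [e.symm_apply_le, he']; exact ht.2⟩
        rw [hi, eval_zero, sign_zero, e.apply_symm_apply] at h2
        exact sign_eq_zero_iff.1 h2.symm
      rw [this (e x), this (e' x)]
      · exact hmaps e' (by rw [h _ hZl, he]) (by rw [h _ hZr, he']) x hx
      · exact hmaps e he he' x hx
    · refine sign_eval_eq_of_no_root (a := e a) (b := e b) (fun t ht h0 => ?_)
        ⟨e.strictMono hax, e.strictMono hxb⟩ ?_
      · have ht' : e.symm t ∈ Ioo a b :=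
          ⟨by rw [e.lt_symm_apply]; exact ht.1, by rw [e.symm_apply_lt]; exact ht.2⟩
        have h2 := hfg i _ (hI _ ht')
        rw [e.apply_symm_apply, h0, sign_zero] at h2
        exact hnot _ ht' ⟨hI _ ht', Or.inr (Or.inr ⟨i, hi, sign_eq_zero_iff.1 h2⟩)⟩
      · rw [← h a haZ, ← h b hbZ]
        exact ⟨e'.strictMono hax, e'.strictMono hxb⟩
  -- A zero derivative contributes no roots to `Z`, so the cell argument does not apply to it; but
  -- then `p` and `q` are constants.
  by_cases hp0 : p.derivative = 0
  · have hq0 : q.derivative = 0 := by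
      refine Polynomial.eq_zero_of_infinite_isRoot _
        (((Icc_infinite (show (-1 : ℝ) < 1 by norm_num)).mono ?_))
      intro t ht
      have h2 := hfg i₀ (e.symm t) ⟨by rw [e.le_symm_apply, he]; exact ht.1,
          by rw [e.symm_apply_le, he']; exact ht.2⟩
      rw [hf, hg, hp0, eval_zero, sign_zero, e.apply_symm_apply] at h2
      exact sign_eq_zero_iff.1 h2.symm
    refine ⟨e, he, he', hfg, fun x hx => ?_⟩
    rw [Polynomial.eq_C_of_derivative_eq_zero hp0, Polynomial.eq_C_of_derivative_eq_zero hq0]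
      at hr ⊢
    simpa using hr
  -- The identification is corrected cell by cell from the left, with the points of `Z` kept in
  -- place.
  suffices hmain : ∀ t ∈ Z, ∃ e' : ℝ ≃o ℝ, (∀ z ∈ Z, e' z = e z) ∧
      ∀ x ∈ Icc (-1 : ℝ) t, SignType.sign (p.eval x) = SignType.sign (q.eval (e' x)) by
    obtain ⟨e', h1, h2⟩ := hmain 1 hZr
    exact ⟨e', by rw [h1 _ hZl, he], by rw [h1 _ hZr, he'], hmatch e' h1, h2⟩
  intro t htZ
  refine hfin.wellFoundedOn.induction (r := (· < ·)) (P := fun t => ∃ e' : ℝ ≃o ℝ,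
    (∀ z ∈ Z, e' z = e z) ∧ ∀ x ∈ Icc (-1 : ℝ) t,
      SignType.sign (p.eval x) = SignType.sign (q.eval (e' x))) htZ fun t htZ ih => ?_
  rcases htZ.1.1.eq_or_lt with h | h
  · refine ⟨e, fun _ _ => rfl, fun x hx => ?_⟩
    rw [← h] at hx
    obtain rfl : x = -1 := le_antisymm hx.2 hx.1
    exact hpZ _ hZl
  obtain ⟨s, hsZ, hst, hsmax⟩ := hprev t ⟨h, htZ.1.2⟩
  obtain ⟨e₁, h1, h2⟩ := ih s hsZ hst
  have hI : ∀ z ∈ Ioo s t, z ∈ Icc (-1 : ℝ) 1 := fun z hz =>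
    ⟨hsZ.1.1.trans hz.1.le, hz.2.le.trans htZ.1.2⟩
  obtain ⟨e₂, h3, h4⟩ := exists_orderIso_sign_eq_on_cell (p := p) (q := q) hst e₁ e (h1 s hsZ)
    (h1 t htZ) (fun x hx => by rw [← hf, ← hg]; exact hfg i₀ x (hI x hx))
    (fun x hx h0 => by
      have hxZ : x ∈ Z := ⟨hI x hx, Or.inr (Or.inr ⟨i₀, by rwa [hf], by rwa [hf]⟩)⟩
      exact absurd (hsmax x hxZ hx.2) (not_le.2 hx.1))
    (by rw [h1 s hsZ]; exact hpZ s hsZ) (by rw [h1 t htZ]; exact hpZ t htZ)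
  refine ⟨e₂, fun z hz => ?_, fun x hx => ?_⟩
  · rw [h3 z, h1 z hz]
    rcases lt_or_ge z t with h | h
    · exact Or.inl (hsmax z hz h)
    · exact Or.inr h
  · rcases le_total x s with h | h
    · rw [h3 x (Or.inl h)]
      exact h2 x ⟨hx.1, h⟩
    · exact h4 x ⟨h, hx.2⟩

/-! ### Sign patterns of polynomials with parameters -/

section Determined

variable {R Y : Type*} [CommRing R] (ev : Y → R →+* ℝ)

/-- The members of `G` have the same signs at the parameters `y` and `y'`. -/
def SignAgree (G : Set R) (y y' : Y) : Prop :=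
  ∀ u ∈ G, SignType.sign (ev y u) = SignType.sign (ev y' u)

/-- The sign patterns on `[-1, 1]` of a family of polynomials with parameters agree at the
parameters `y` and `y'`. -/
def SignMatched (F : Set R[X]) (y y' : Y) : Prop :=
  ∃ e : ℝ ≃o ℝ, e (-1) = -1 ∧ e 1 = 1 ∧ ∀ p ∈ F, ∀ x ∈ Icc (-1 : ℝ) 1,
    SignType.sign ((p.map (ev y)).eval x) = SignType.sign ((p.map (ev y')).eval (e x))

/-- The sign pattern of a family of polynomials with parameters is determined by the signs of
finitely many functions of the parameters. -/
def SignDetermined (F : Set R[X]) : Prop :=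
  ∃ G : Set R, G.Finite ∧ ∀ y y', SignAgree ev G y y' → SignMatched ev F y y'

variable {ev}

theorem SignDetermined.mono {F F' : Set R[X]} (h : SignDetermined ev F) (hF : F' ⊆ F) :
    SignDetermined ev F' := by
  obtain ⟨G, hG, h⟩ := h
  refine ⟨G, hG, fun y y' hy => ?_⟩
  obtain ⟨e, h1, h2, h3⟩ := h y y' hy
  exact ⟨e, h1, h2, fun p hp => h3 p (hF hp)⟩

/-- The polynomial `g`, cut off above degree `k` and divided by its `k`-th coefficient, for a given
operation of division. -/
def monicTruncation (inv : R → R) (g : R[X]) (k : ℕ) : R[X] :=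
  X ^ k + ∑ i ∈ Finset.range k, C (inv (g.coeff k) * g.coeff i) * X ^ i

theorem degree_sum_range_lt (k : ℕ) (c : ℕ → R) :
    (∑ i ∈ Finset.range k, C (c i) * X ^ i).degree < (k : WithBot ℕ) := by
  refine mem_degreeLT.1 (Submodule.sum_mem _ fun i hi => mem_degreeLT.2 ?_)
  exact (degree_C_mul_X_pow_le _ _).trans_lt (by exact_mod_cast Finset.mem_range.1 hi)

theorem monic_monicTruncation (inv : R → R) (g : R[X]) (k : ℕ) :
    (monicTruncation inv g k).Monic :=
  monic_X_pow_add (degree_sum_range_lt k _)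

theorem natDegree_monicTruncation [Nontrivial R] (inv : R → R) (g : R[X]) (k : ℕ) :
    (monicTruncation inv g k).natDegree = k := by
  refine natDegree_eq_of_degree_eq_some ?_
  rw [monicTruncation, degree_add_eq_left_of_degree_lt, degree_X_pow]
  rw [degree_X_pow]
  exact degree_sum_range_lt k _

variable {inv : R → R}

/-- The degree of `g` can drop when the parameter is specialised to `y`. Truncated at the actual
degree, the monic polynomial specialises to `g` divided by its leading coefficient, so it vanishes
at the root `x`, and division with remainder does not change the value of `p` there. -/
theorem eval_map_modByMonic_monicTruncation (hinv : ∀ y u, ev y (inv u) = (ev y u)⁻¹)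
    (p g : R[X]) (y : Y) {x : ℝ}
    (h0 : g.map (ev y) ≠ 0) (hx : (g.map (ev y)).eval x = 0) :
    ((p %ₘ monicTruncation inv g (g.map (ev y)).natDegree).map (ev y)).eval x =
      (p.map (ev y)).eval x := by
  rw [map_modByMonic _ (monic_monicTruncation _ _ _)]
  have hq : ((monicTruncation inv g (g.map (ev y)).natDegree).map (ev y)).eval x = 0 := by
    set k := (g.map (ev y)).natDegree with hk
    have hlc : (g.map (ev y)).coeff k ≠ 0 := by rwa [hk, coeff_natDegree, leadingCoeff_ne_zero]
    refine (mul_eq_zero.1 ((?_ : (g.map (ev y)).coeff k * _ = 0))).resolve_left hlc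
    rw [eval_eq_sum_range, Finset.sum_range_succ, ← hk] at hx
    rw [monicTruncation, Polynomial.map_add, Polynomial.map_sum, eval_add, eval_finsetSum,
      mul_add, Finset.mul_sum, ← hx, add_comm]
    congr 1
    · refine Finset.sum_congr rfl fun i _ => ?_
      rw [Polynomial.map_mul, map_C, Polynomial.map_pow, map_X, eval_mul, eval_C, eval_pow, eval_X,
        map_mul, hinv, ← coeff_map, ← coeff_map]
      field_simp
    · simp
  have h := congrArg (eval x) (modByMonic_add_div (p.map (ev y))
    ((monicTruncation inv g (g.map (ev y)).natDegree).map (ev y)))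
  rwa [eval_add, eval_mul, hq, zero_mul, add_zero] at h

/-- At a root of some `g ∈ F` the sign of `p` is the sign of a remainder of `p`, which the larger
family already controls; between such roots `p` is monotone, since its derivative is in `F`. All
truncation degrees must be allowed, because the degree of `g` depends on the parameter. -/
theorem SignDetermined.insert (hinv : ∀ y u, ev y (inv u) = (ev y u)⁻¹)
    {F : Set R[X]} (hF : F.Finite) (p : R[X])
    (hp : derivative p ∈ F) (d : ℕ) (hd : ∀ g ∈ F, g.natDegree ≤ d)
    (h : SignDetermined ev
      (F ∪ image2 (fun g k => p %ₘ monicTruncation inv g k) F (Icc 1 d))) :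
    SignDetermined ev (insert p F) := by
  obtain ⟨G, hG, h⟩ := h
  -- Besides `G`, the values at `±1` match `p` at the ends, and the coefficients of the members of
  -- `F` force equal degrees of their specialisations at `y` and `y'`.
  refine ⟨G ∪ {p.eval 1, p.eval (-1)} ∪ image2 (fun g k => g.coeff k) F (Iic d),
    (hG.union ((finite_singleton _).insert _)).union (hF.image2 _ (finite_Iic d)), fun y y' hy => ?_⟩
  obtain ⟨e, h1, h2, h3⟩ := h y y' fun u hu => hy u (Or.inl (Or.inl hu))
  have hdeg : ∀ g ∈ F, (g.map (ev y)).natDegree = (g.map (ev y')).natDegree := fun g hg => by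
    have hc : ∀ k, (g.map (ev y)).coeff k = 0 ↔ (g.map (ev y')).coeff k = 0 := fun k => by
      rcases le_or_gt k d with hk | hk
      · rw [coeff_map, coeff_map, ← sign_eq_zero_iff, hy _ (Or.inr ⟨g, hg, k, hk, rfl⟩),
          sign_eq_zero_iff]
      · rw [coeff_map, coeff_map, coeff_eq_zero_of_natDegree_lt ((hd g hg).trans_lt hk),
          map_zero, map_zero]
    apply le_antisymm
    · exact natDegree_le_iff_coeff_eq_zero.2 fun k hk =>
        (hc k).2 (coeff_eq_zero_of_natDegree_lt hk)
    · exact natDegree_le_iff_coeff_eq_zero.2 fun k hk =>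
        (hc k).1 (coeff_eq_zero_of_natDegree_lt hk)
  have : Finite F := hF
  have hev : ∀ (z : Y) (t : R), (p.map (ev z)).eval (ev z t) = ev z (p.eval t) := fun z t => by
    rw [eval_map, eval₂_at_apply]
  obtain ⟨e', h4, h5, h6, h7⟩ := exists_orderIso_sign_eq_insert
    (fun g : F => g.1.map (ev y)) (fun g : F => g.1.map (ev y'))
    (p.map (ev y)) (p.map (ev y')) e h1 h2 (fun g x hx => h3 g.1 (Or.inl g.2) x hx)
    ⟨_, hp⟩ (derivative_map _ _).symm (derivative_map _ _).symm
    (by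
      have h8 := hy (p.eval (-1)) (Or.inl (Or.inr (Or.inr rfl)))
      rwa [← hev, ← hev, map_neg, map_one, map_neg, map_one] at h8)
    (by
      have h8 := hy (p.eval 1) (Or.inl (Or.inr (Or.inl rfl)))
      rwa [← hev, ← hev, map_one, map_one] at h8)
    (fun g x hx hg0 hgx => by
      have hgx' : (g.1.map (ev y')).eval (e x) = 0 := by
        rw [← sign_eq_zero_iff, ← h3 g.1 (Or.inl g.2) x hx, hgx, sign_zero]
      -- A nonzero polynomial with a root is not constant, so its degree is among the `k` for which
      -- remainders are taken.
      have hpos : 1 ≤ (g.1.map (ev y)).natDegree := by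
        by_contra hlt
        rw [eq_C_of_natDegree_eq_zero (p := g.1.map (ev y)) (by omega)] at hg0 hgx
        rw [eval_C] at hgx
        exact hg0 (by rw [hgx, C_0])
      have hg0' : g.1.map (ev y') ≠ 0 := fun h0 => by
        have := hdeg g.1 g.2
        rw [h0, natDegree_zero] at this
        omega
      have h8 := h3 (p %ₘ monicTruncation inv g.1 (g.1.map (ev y)).natDegree)
        (Or.inr ⟨g.1, g.2, _, ⟨hpos, natDegree_map_le.trans (hd g.1 g.2)⟩, rfl⟩) x hx
      rw [eval_map_modByMonic_monicTruncation hinv _ _ _ hg0 hgx, hdeg g.1 g.2,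
        eval_map_modByMonic_monicTruncation hinv _ _ _ hg0' hgx'] at h8
      exact h8)
  refine ⟨e', h4, h5, ?_⟩
  rintro g (rfl | hg) x hx
  exacts [h7 x hx, h6 ⟨g, hg⟩ x hx]

/-- Sign patterns of finite families of polynomials with parameters are determined by finitely many
signs of functions of the parameters. -/
theorem signDetermined_of_finite [Nontrivial R]
    (hinv : ∀ y u, ev y (inv u) = (ev y u)⁻¹) (d : ℕ) {F : Set R[X]} (hF : F.Finite)
    (hd : ∀ p ∈ F, p.natDegree ≤ d) : SignDetermined ev F := by
  induction d generalizing F with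
  | zero =>
    refine ⟨(fun p => p.coeff 0) '' F, hF.image _, fun y y' hy =>
      ⟨OrderIso.refl ℝ, rfl, rfl, fun p hp x _ => ?_⟩⟩
    rw [eq_C_of_natDegree_eq_zero (Nat.le_zero.1 (hd p hp))]
    simpa using hy _ ⟨p, hp, rfl⟩
  | succ d ih =>
    -- Inner induction on the number of polynomials of possibly top degree, collected in `A`.
    -- Removing one of them adds only its derivative and remainders, which have degree at most `d`
    -- and go into `B`.
    suffices H : ∀ A : Set R[X], A.Finite → ∀ B : Set R[X], B.Finite →
        (∀ p ∈ A, p.natDegree ≤ d + 1) → (∀ p ∈ B, p.natDegree ≤ d) → SignDetermined ev (A ∪ B) by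
      simpa using H F hF ∅ finite_empty hd (by simp)
    intro A hA
    induction A, hA using Set.Finite.induction_on with
    | empty =>
      intro B hB _ hB'
      simpa using ih hB hB'
    | @insert p A _ hA ihA =>
      intro B hB hA' hB'
      have hp : p.natDegree ≤ d + 1 := hA' p (mem_insert _ _)
      have hp' : (derivative p).natDegree ≤ d := (natDegree_derivative_le p).trans (by omega)
      have hfin : (A ∪ B ∪ {derivative p}).Finite := (hA.union hB).union (finite_singleton _)
      refine (SignDetermined.insert hinv (F := A ∪ B ∪ {derivative p}) hfin p
        (Or.inr rfl) (d + 1) ?_ ?_).mono ?_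
      · rintro g ((hg | hg) | rfl)
        exacts [hA' g (mem_insert_of_mem _ hg), (hB' g hg).trans (by omega), hp'.trans (by omega)]
      · have := ihA (B ∪ {derivative p} ∪
          image2 (fun g k => p %ₘ monicTruncation inv g k) (A ∪ B ∪ {derivative p}) (Icc 1 (d + 1)))
          ((hB.union (finite_singleton _)).union (hfin.image2 _ (finite_Icc _ _)))
          (fun g hg => hA' g (mem_insert_of_mem _ hg)) ?_
        · simpa only [union_assoc] using this
        · rintro g ((hg | rfl) | ⟨g, -, k, hk, rfl⟩)
          · exact hB' g hg
          · exact hp'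
          · have := natDegree_modByMonic_lt p (monic_monicTruncation inv g k) (fun h => by
              have := natDegree_monicTruncation inv g k
              rw [h, natDegree_one] at this
              exact absurd hk.1 (by omega))
            rw [natDegree_monicTruncation] at this
            have := hk.2
            dsimp only
            omega
      · rintro g ((rfl | hg) | hg)
        · exact mem_insert _ _
        · exact mem_insert_of_mem _ (Or.inl (Or.inl hg))
        · exact mem_insert_of_mem _ (Or.inl (Or.inr hg))

end Determined
-- Boolean operations, preimages and sign conditions
section Boolean

variable {ι κ : Type}

theorem isSemialgebraic_univ : IsSemialgebraic (univ : Set (ι → ℝ)) := by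
  convert IsSemialgebraic.pos (1 : MvPolynomial ι ℝ)
  ext; simp

theorem isSemialgebraic_iInter {J : Type*} [Finite J] {S : J → Set (ι → ℝ)}
    (h : ∀ j, IsSemialgebraic (S j)) : IsSemialgebraic (⋂ j, S j) := by
  classical
  have := Fintype.ofFinite J
  suffices H : ∀ s : Finset J, IsSemialgebraic (⋂ j ∈ s, S j) by simpa using H Finset.univ
  intro s
  induction s using Finset.induction_on with
  | empty => simpa using isSemialgebraic_univ
  | insert a s _ ih =>
    rw [Finset.set_biInter_insert]
    exact (h a).inter ih

theorem isSemialgebraic_iUnion {J : Type*} [Finite J] {S : J → Set (ι → ℝ)}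
    (h : ∀ j, IsSemialgebraic (S j)) : IsSemialgebraic (⋃ j, S j) := by
  rw [← compl_compl (⋃ j, S j), compl_iUnion]
  exact (isSemialgebraic_iInter fun j => (h j).compl).compl

theorem isSemialgebraic_neg (p : MvPolynomial ι ℝ) :
    IsSemialgebraic {x | MvPolynomial.eval x p < 0} := by
  convert IsSemialgebraic.pos (-p) using 3
  simp

theorem isSemialgebraic_eq_zero (p : MvPolynomial ι ℝ) :
    IsSemialgebraic {x | MvPolynomial.eval x p = 0} := by
  convert (IsSemialgebraic.pos p).compl.inter (isSemialgebraic_neg p).compl using 1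
  ext x
  simp [le_antisymm_iff]

/-- The preimage of a semi-algebraic set under a polynomial map is semi-algebraic. -/
theorem IsSemialgebraic.preimage {S : Set (κ → ℝ)} (hS : IsSemialgebraic S)
    (φ : κ → MvPolynomial ι ℝ) :
    IsSemialgebraic {x : ι → ℝ | (fun j => MvPolynomial.eval x (φ j)) ∈ S} := by
  induction hS with
  | pos p =>
    convert IsSemialgebraic.pos (MvPolynomial.bind₁ φ p) using 3
    rw [MvPolynomial.eval, MvPolynomial.eval₂Hom_bind₁]
    rfl
  | compl _ h => exact h.compl
  | inter _ _ h1 h2 => exact h1.inter h2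

/-- Membership in a semi-algebraic set is determined by the signs of finitely many polynomials. -/
theorem IsSemialgebraic.exists_finite_sign {S : Set (ι → ℝ)} (hS : IsSemialgebraic S) :
    ∃ F : Set (MvPolynomial ι ℝ), F.Finite ∧ ∀ x x' : ι → ℝ,
      (∀ p ∈ F, SignType.sign (MvPolynomial.eval x p) = SignType.sign (MvPolynomial.eval x' p)) →
        (x ∈ S ↔ x' ∈ S) := by
  induction hS with
  | pos p =>
    refine ⟨{p}, finite_singleton p, fun x x' h => ?_⟩
    rw [mem_ofPred, mem_ofPred, ← sign_eq_one_iff, h p rfl, sign_eq_one_iff]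
  | compl _ h =>
    obtain ⟨F, hF, h⟩ := h
    exact ⟨F, hF, fun x x' hx => not_congr (h x x' hx)⟩
  | inter _ _ h1 h2 =>
    obtain ⟨F₁, hF₁, h1⟩ := h1
    obtain ⟨F₂, hF₂, h2⟩ := h2
    exact ⟨F₁ ∪ F₂, hF₁.union hF₂, fun x x' hx =>
      and_congr (h1 x x' fun p hp => hx p (Or.inl hp)) (h2 x x' fun p hp => hx p (Or.inr hp))⟩

end Boolean

/-! ### Piecewise rational functions and elimination of bounded variables -/

section PiecewiseRational

variable {ι : Type}

/-- A function is piecewise rational if it is a quotient of polynomials on each of the members of a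
finite semi-algebraic covering. -/
def IsPiecewiseRational (u : (ι → ℝ) → ℝ) : Prop :=
  ∃ (J : Type) (_ : Finite J) (S : J → Set (ι → ℝ)) (a b : J → MvPolynomial ι ℝ),
    (∀ j, IsSemialgebraic (S j)) ∧ (∀ y, ∃ j, y ∈ S j) ∧
      ∀ j, ∀ y ∈ S j, MvPolynomial.eval y (b j) ≠ 0 ∧
        u y = MvPolynomial.eval y (a j) / MvPolynomial.eval y (b j)

theorem isPiecewiseRational_eval (p : MvPolynomial ι ℝ) :
    IsPiecewiseRational fun y => MvPolynomial.eval y p :=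
  ⟨Unit, inferInstance, fun _ => univ, fun _ => p, fun _ => 1, fun _ => isSemialgebraic_univ,
    fun _ => ⟨(), mem_univ _⟩, fun _ y _ => by simp⟩

theorem IsPiecewiseRational.add {u v : (ι → ℝ) → ℝ} (hu : IsPiecewiseRational u)
    (hv : IsPiecewiseRational v) : IsPiecewiseRational (u + v) := by
  obtain ⟨J, _, S, a, b, h1, h2, h3⟩ := hu
  obtain ⟨J', _, S', a', b', h1', h2', h3'⟩ := hv
  refine ⟨J × J', inferInstance, fun j => S j.1 ∩ S' j.2,
    fun j => a j.1 * b' j.2 + b j.1 * a' j.2, fun j => b j.1 * b' j.2,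
    fun j => (h1 _).inter (h1' _), fun y => ?_, fun j y hy => ?_⟩
  · obtain ⟨j, hj⟩ := h2 y
    obtain ⟨j', hj'⟩ := h2' y
    exact ⟨(j, j'), hj, hj'⟩
  · obtain ⟨h4, h5⟩ := h3 j.1 y hy.1
    obtain ⟨h4', h5'⟩ := h3' j.2 y hy.2
    refine ⟨by simp [h4, h4'], ?_⟩
    rw [Pi.add_apply, h5, h5', div_add_div _ _ h4 h4']
    simp

theorem IsPiecewiseRational.mul {u v : (ι → ℝ) → ℝ} (hu : IsPiecewiseRational u)
    (hv : IsPiecewiseRational v) : IsPiecewiseRational (u * v) := by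
  obtain ⟨J, _, S, a, b, h1, h2, h3⟩ := hu
  obtain ⟨J', _, S', a', b', h1', h2', h3'⟩ := hv
  refine ⟨J × J', inferInstance, fun j => S j.1 ∩ S' j.2,
    fun j => a j.1 * a' j.2, fun j => b j.1 * b' j.2,
    fun j => (h1 _).inter (h1' _), fun y => ?_, fun j y hy => ?_⟩
  · obtain ⟨j, hj⟩ := h2 y
    obtain ⟨j', hj'⟩ := h2' y
    exact ⟨(j, j'), hj, hj'⟩
  · obtain ⟨h4, h5⟩ := h3 j.1 y hy.1
    obtain ⟨h4', h5'⟩ := h3' j.2 y hy.2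
    refine ⟨by simp [h4, h4'], ?_⟩
    rw [Pi.mul_apply, h5, h5', div_mul_div_comm]
    simp

theorem IsPiecewiseRational.inv {u : (ι → ℝ) → ℝ} (hu : IsPiecewiseRational u) :
    IsPiecewiseRational u⁻¹ := by
  obtain ⟨J, _, S, a, b, h1, h2, h3⟩ := hu
  -- Each piece is split by the vanishing of its numerator: the inverse is pointwise with `0⁻¹ = 0`,
  -- so it is zero on one half and the reciprocal quotient on the other.
  refine ⟨J ⊕ J, inferInstance,
    Sum.elim (fun j => S j ∩ {y | MvPolynomial.eval y (a j) = 0})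
      (fun j => S j ∩ {y | MvPolynomial.eval y (a j) = 0}ᶜ),
    Sum.elim (fun _ => 0) b, Sum.elim (fun _ => 1) a, ?_, fun y => ?_, ?_⟩
  · rintro (j | j)
    · exact (h1 j).inter (isSemialgebraic_eq_zero _)
    · exact (h1 j).inter (isSemialgebraic_eq_zero _).compl
  · obtain ⟨j, hj⟩ := h2 y
    by_cases h : MvPolynomial.eval y (a j) = 0
    · exact ⟨Sum.inl j, hj, h⟩
    · exact ⟨Sum.inr j, hj, h⟩
  · rintro (j | j) y ⟨hy, h⟩
    · have h0 : MvPolynomial.eval y (a j) = 0 := h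
      refine ⟨by simp, ?_⟩
      rw [Pi.inv_apply, (h3 j y hy).2, h0]
      simp
    · refine ⟨h, ?_⟩
      rw [Pi.inv_apply, (h3 j y hy).2, inv_div]
      rfl

theorem IsPiecewiseRational.isSemialgebraic_pos {u : (ι → ℝ) → ℝ} (hu : IsPiecewiseRational u) :
    IsSemialgebraic {y | 0 < u y} := by
  obtain ⟨J, _, S, a, b, h1, h2, h3⟩ := hu
  -- A quotient has the sign of the product of its numerator and denominator.
  have : {y | 0 < u y} = ⋃ j, S j ∩ {y | 0 < MvPolynomial.eval y (a j * b j)} := by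
    have key : ∀ j, ∀ y ∈ S j, 0 < u y ↔ 0 < MvPolynomial.eval y (a j * b j) := fun j y hy => by
      obtain ⟨h4, h5⟩ := h3 j y hy
      rw [h5, map_mul, div_pos_iff, mul_pos_iff]
    ext y
    simp only [mem_ofPred, mem_iUnion, mem_inter_iff]
    constructor
    · intro h
      obtain ⟨j, hj⟩ := h2 y
      exact ⟨j, hj, (key j y hj).1 h⟩
    · rintro ⟨j, hj, h⟩
      exact (key j y hj).2 h
  rw [this]
  exact isSemialgebraic_iUnion fun j => (h1 j).inter (IsSemialgebraic.pos _)

variable (ι) in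
/-- The ring of piecewise rational functions. -/
def piecewiseRational : Subring ((ι → ℝ) → ℝ) where
  carrier := {u | IsPiecewiseRational u}
  mul_mem' := IsPiecewiseRational.mul
  add_mem' := IsPiecewiseRational.add
  one_mem' := by
    change IsPiecewiseRational 1
    convert isPiecewiseRational_eval (1 : MvPolynomial ι ℝ) using 1
    ext; simp
  zero_mem' := by
    change IsPiecewiseRational 0
    convert isPiecewiseRational_eval (0 : MvPolynomial ι ℝ) using 1
    ext; simp
  neg_mem' {u} hu := by
    change IsPiecewiseRational (-u)
    convert IsPiecewiseRational.mul (isPiecewiseRational_eval (-1 : MvPolynomial ι ℝ)) hu using 1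
    ext; simp

theorem isSemialgebraic_sign_eq (u : piecewiseRational ι) (σ : SignType) :
    IsSemialgebraic {y | SignType.sign (u.1 y) = σ} := by
  have hp : IsSemialgebraic {y | 0 < u.1 y} := IsPiecewiseRational.isSemialgebraic_pos u.2
  have hn : IsSemialgebraic {y | u.1 y < 0} := by
    simpa using IsPiecewiseRational.isSemialgebraic_pos (-u).2
  cases σ with
  | zero =>
    convert hp.compl.inter hn.compl using 1
    ext y
    change SignType.sign (u.1 y) = 0 ↔ _
    simp [le_antisymm_iff]
  | neg =>
    convert hn using 3
    exact sign_eq_neg_one_iff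
  | pos =>
    convert hp using 3
    exact sign_eq_one_iff

/-- Evaluation of piecewise rational functions. -/
def piecewiseRationalEval (y : ι → ℝ) : piecewiseRational ι →+* ℝ :=
  (Pi.evalRingHom _ y).comp (piecewiseRational ι).subtype

/-- Polynomials as piecewise rational functions. -/
def piecewiseRationalOfPolynomial : MvPolynomial ι ℝ →+* piecewiseRational ι :=
  RingHom.codRestrict (RingHom.pi fun y : ι → ℝ => MvPolynomial.eval y) _ isPiecewiseRational_eval

/-- `G` has only finitely many sign vectors, and `T` is the union of the cells of those vectors that
occur on `T`. -/
theorem isSemialgebraic_of_signAgree {G : Set (piecewiseRational ι)} (hG : G.Finite)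
    {T : Set (ι → ℝ)}
    (hT : ∀ y y', SignAgree piecewiseRationalEval G y y' → y ∈ T → y' ∈ T) :
    IsSemialgebraic T := by
  have : Finite G := hG
  have h : T = ⋃ σ : {σ : G → SignType // ∃ y ∈ T, ∀ u : G, SignType.sign (u.1.1 y) = σ u},
      ⋂ u : G, {y | SignType.sign (u.1.1 y) = σ.1 u} := by
    ext y
    simp only [mem_iUnion, mem_iInter, mem_ofPred]
    constructor
    · intro hy
      exact ⟨⟨fun u => SignType.sign (u.1.1 y), y, hy, fun _ => rfl⟩, fun _ => rfl⟩
    · rintro ⟨⟨σ, y', hy', h'⟩, h⟩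
      exact hT y' y (fun u hu => (h' ⟨u, hu⟩).trans (h ⟨u, hu⟩).symm) hy'
  rw [h]
  exact isSemialgebraic_iUnion fun σ => isSemialgebraic_iInter fun u =>
    isSemialgebraic_sign_eq u.1 _

/-- The variable `none` is the one to be eliminated; the remaining ones become parameters. -/
theorem eval_map_optionEquivLeft (p : MvPolynomial (Option ι) ℝ) (x : ℝ) (y : ι → ℝ) :
    (((MvPolynomial.optionEquivLeft ℝ ι p).map piecewiseRationalOfPolynomial).map
      (piecewiseRationalEval y)).eval x = MvPolynomial.eval (fun o => o.elim x y) p := by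
  have h : (piecewiseRationalEval y).comp piecewiseRationalOfPolynomial =
      (MvPolynomial.eval y) := rfl
  rw [Polynomial.map_map, h]
  induction p using MvPolynomial.induction_on with
  | C a => simp
  | add p q hp hq => simp [hp, hq]
  | mul_X p i hp =>
    cases i <;> simp [hp]

/-- The projection of a semi-algebraic set along a compact interval is semi-algebraic. -/
theorem IsSemialgebraic.exists_mem_Icc {S : Set (Option ι → ℝ)} (hS : IsSemialgebraic S) :
    IsSemialgebraic {y : ι → ℝ | ∃ x ∈ Icc (-1 : ℝ) 1, (fun o => o.elim x y) ∈ S} := by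
  obtain ⟨F, hF, hFS⟩ := hS.exists_finite_sign
  set F' : Set (piecewiseRational ι)[X] :=
    (fun p => (MvPolynomial.optionEquivLeft ℝ ι p).map piecewiseRationalOfPolynomial) '' F with hF'
  have hF'fin : F'.Finite := hF.image _
  have : Nontrivial (piecewiseRational ι) := (piecewiseRationalEval 0).domain_nontrivial
  obtain ⟨d, hd⟩ := (hF'fin.image natDegree).bddAbove
  obtain ⟨G, hG, h⟩ := signDetermined_of_finite (ev := piecewiseRationalEval (ι := ι))
    (inv := fun u => ⟨u.1⁻¹, IsPiecewiseRational.inv u.2⟩) (fun _ _ => rfl) d hF'fin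
    (fun p hp => hd ⟨p, hp, rfl⟩)
  refine isSemialgebraic_of_signAgree hG fun y y' hy => ?_
  rintro ⟨x, hx, hxS⟩
  obtain ⟨e, h1, h2, h3⟩ := h y y' hy
  -- A witness over `y` is transported to a witness over `y'` by the matching of sign patterns.
  refine ⟨e x, ?_, (hFS _ _ fun p hp => ?_).1 hxS⟩
  · have h4 := e.monotone hx.1
    have h5 := e.monotone hx.2
    rw [h1] at h4
    rw [h2] at h5
    exact ⟨h4, h5⟩
  · rw [← eval_map_optionEquivLeft, ← eval_map_optionEquivLeft]
    exact h3 _ ⟨p, hp, rfl⟩ x hx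

/-- The projection of a semi-algebraic set along a cube is semi-algebraic. -/
theorem IsSemialgebraic.exists_mem_cube_fin {m : ℕ} {S : Set (ι ⊕ Fin m → ℝ)}
    (hS : IsSemialgebraic S) :
    IsSemialgebraic {y : ι → ℝ | ∃ x : Fin m → ℝ, (∀ i, x i ∈ Icc (-1 : ℝ) 1) ∧
      Sum.elim y x ∈ S} := by
  induction m with
  | zero =>
    have := hS.preimage (Sum.elim MvPolynomial.X (fun i => i.elim0) :
      ι ⊕ Fin 0 → MvPolynomial ι ℝ)
    convert this using 1
    ext y
    have : ∀ x : Fin 0 → ℝ, Sum.elim y x = fun j => MvPolynomial.eval y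
        ((Sum.elim MvPolynomial.X (fun i => i.elim0) : ι ⊕ Fin 0 → MvPolynomial ι ℝ) j) := by
      intro x
      ext (j | j)
      · simp
      · exact j.elim0
    simp [this]
  | succ m ih =>
    have h1 := hS.preimage (Sum.elim (fun i => MvPolynomial.X (some (Sum.inl i)))
      (Fin.cons (MvPolynomial.X none) fun i => MvPolynomial.X (some (Sum.inr i))) :
      ι ⊕ Fin (m + 1) → MvPolynomial (Option (ι ⊕ Fin m)) ℝ)
    have h2 := ih h1.exists_mem_Icc
    convert h2 using 1
    ext y
    have key : ∀ (t : ℝ) (x : Fin m → ℝ), (fun j => MvPolynomial.eval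
        (fun o : Option (ι ⊕ Fin m) => o.elim t (Sum.elim y x))
          ((Sum.elim (fun i => MvPolynomial.X (some (Sum.inl i)))
      (Fin.cons (MvPolynomial.X none) fun i => MvPolynomial.X (some (Sum.inr i))) :
      ι ⊕ Fin (m + 1) → MvPolynomial (Option (ι ⊕ Fin m)) ℝ) j)) =
        Sum.elim y (Fin.cons t x : Fin (m + 1) → ℝ) := by
      intro t x
      ext (j | j)
      · simp
      · refine Fin.cases ?_ (fun j => ?_) j <;> simp
    simp only [mem_ofPred, key]
    constructor
    · rintro ⟨x, hx, hxS⟩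
      refine ⟨Fin.tail x, fun i => hx _, x 0, hx 0, ?_⟩
      rwa [Fin.cons_self_tail]
    · rintro ⟨x, hx, t, ht, hS⟩
      exact ⟨_, Fin.cases ht hx, hS⟩

theorem IsSemialgebraic.exists_mem_cube {σ : Type} [Finite σ] {S : Set (ι ⊕ σ → ℝ)}
    (hS : IsSemialgebraic S) :
    IsSemialgebraic {y : ι → ℝ | ∃ x : σ → ℝ, (∀ i, x i ∈ Icc (-1 : ℝ) 1) ∧
      Sum.elim y x ∈ S} := by
  obtain ⟨m, ⟨e⟩⟩ := Finite.exists_equiv_fin σ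
  have h1 := (hS.preimage (Sum.elim (fun i => MvPolynomial.X (Sum.inl i))
    (fun s => MvPolynomial.X (Sum.inr (e s))) :
      ι ⊕ σ → MvPolynomial (ι ⊕ Fin m) ℝ)).exists_mem_cube_fin
  convert h1 using 1
  ext y
  have key : ∀ x : Fin m → ℝ, (fun j => MvPolynomial.eval (Sum.elim y x)
      ((Sum.elim (fun i => MvPolynomial.X (Sum.inl i))
    (fun s => MvPolynomial.X (Sum.inr (e s))) :
      ι ⊕ σ → MvPolynomial (ι ⊕ Fin m) ℝ) j)) = Sum.elim y (x ∘ e) := by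
    intro x
    ext (j | j) <;> simp
  simp only [mem_ofPred, key]
  constructor
  · rintro ⟨x, hx, h⟩
    refine ⟨x ∘ e.symm, fun i => hx _, ?_⟩
    rwa [Function.comp_assoc, Equiv.symm_comp_self]
  · rintro ⟨x, hx, h⟩
    exact ⟨_, fun i => hx _, h⟩

/-- The image of a bounded real algebraic set under a polynomial map is semi-algebraic. -/
theorem isSemialgebraic_image_of_bounded [Finite ι] {σ τ : Type} [Finite σ] [Finite τ]
    (e : τ → MvPolynomial σ ℝ) (P : ι → MvPolynomial σ ℝ)
    (hb : ∀ x : σ → ℝ, (∀ t, MvPolynomial.eval x (e t) = 0) → ∀ i, x i ∈ Icc (-1 : ℝ) 1) :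
    IsSemialgebraic ((fun x i => MvPolynomial.eval x (P i)) ''
      {x : σ → ℝ | ∀ t, MvPolynomial.eval x (e t) = 0}) := by
  -- The image is the projection of the graph, cut out by the equations `h1` and `h2`; by
  -- boundedness nothing is lost when projecting along the cube only.
  have h1 : IsSemialgebraic (⋂ t, {w : ι ⊕ σ → ℝ | MvPolynomial.eval w
      (MvPolynomial.rename Sum.inr (e t)) = 0}) :=
    isSemialgebraic_iInter fun t => isSemialgebraic_eq_zero _
  have h2 : IsSemialgebraic (⋂ i, {w : ι ⊕ σ → ℝ | MvPolynomial.eval w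
      (MvPolynomial.X (Sum.inl i) - MvPolynomial.rename Sum.inr (P i)) = 0}) :=
    isSemialgebraic_iInter fun i => isSemialgebraic_eq_zero _
  convert (h1.inter h2).exists_mem_cube using 1
  ext y
  simp only [mem_image, mem_ofPred, mem_inter_iff, mem_iInter, MvPolynomial.eval_rename, map_sub,
    MvPolynomial.eval_X, Sum.elim_comp_inr, Sum.elim_inl]
  constructor
  · rintro ⟨x, hx, rfl⟩
    exact ⟨x, hb x hx, hx, fun i => sub_self _⟩
  · rintro ⟨x, -, hx, h⟩
    exact ⟨x, hx, funext fun i => (sub_eq_zero.1 (h i)).symm⟩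

end PiecewiseRational
end Projection

/-! ### Finite generation of the invariants of compact groups -/

section Invariants

variable {k : Type} [RCLike k] {W : Type} [AddCommGroup W] [Module k W]

variable (k W) in
/-- The polynomial functions on a vector space. -/
def polyFunctions : Subalgebra k (W → k) :=
  Algebra.adjoin k (Set.range fun (l : Module.Dual k W) (w : W) => l w)

theorem dual_mem_polyFunctions (l : Module.Dual k W) : (fun w => l w) ∈ polyFunctions k W :=
  Algebra.subset_adjoin ⟨l, rfl⟩

theorem polyFunctions_fg [FiniteDimensional k W] : (polyFunctions k W).FG := by
  classical
  let b := Module.finBasis k W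
  refine ⟨Finset.univ.image fun i w => b.coord i w, le_antisymm ?_ ?_⟩
  · refine Algebra.adjoin_le fun f hf => ?_
    simp only [Finset.coe_image, Finset.coe_univ, Set.image_univ] at hf
    obtain ⟨i, rfl⟩ := hf
    exact dual_mem_polyFunctions _
  · refine Algebra.adjoin_le ?_
    rintro _ ⟨l, rfl⟩
    have : (fun w => l w) = ∑ i, l (b i) • fun w => b.coord i w := by
      funext w
      conv_lhs => rw [← b.sum_repr w, map_sum]
      simp [mul_comm]
    dsimp only
    rw [this]
    exact sum_mem fun i _ => Subalgebra.smul_mem _ (Algebra.subset_adjoin (by simp)) _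

/-- Homogeneous functions. -/
def IsHomogeneousFun (d : ℕ) (F : W → k) : Prop := ∀ (t : k) (w : W), F (t • w) = t ^ d * F w

open Polynomial in
/-- The decomposition of a polynomial function into its homogeneous components. -/
theorem exists_components {F : W → k} (hF : F ∈ polyFunctions k W) :
    ∃ c : ℕ → W → k, (∀ d, c d ∈ polyFunctions k W ∧ IsHomogeneousFun d (c d)) ∧
      (∃ N, ∀ d, N ≤ d → c d = 0) ∧ ∀ w, ∃ p : k[X], (∀ d, p.coeff d = c d w) ∧ ∀ t : k, F (t • w) = p.eval t := by
  let E (w : W) : polyFunctions k W →+* k :=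
    (Pi.evalRingHom (fun _ : W => k) w).comp (polyFunctions k W).val.toRingHom
  -- Along a line through the origin, `F (t • w)` is a polynomial in `t` whose coefficients are
  -- polynomial functions of `w`: these are the components.
  obtain ⟨c, hc⟩ : ∃ c : (polyFunctions k W)[X], ∀ w (t : k),
      F (t • w) = (c.map (E w)).eval t := by
    induction hF using Algebra.adjoin_induction with
    | mem F hF =>
      obtain ⟨l, rfl⟩ := hF
      refine ⟨C ⟨_, dual_mem_polyFunctions l⟩ * X, fun w t => ?_⟩
      rw [Polynomial.map_mul, map_C, map_X, eval_mul, eval_C, eval_X, mul_comm]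
      exact map_smul l t w
    | algebraMap a =>
      refine ⟨C (algebraMap k _ a), fun w t => ?_⟩
      simp [E]
    | add F G _ _ hF hG =>
      obtain ⟨c, hc⟩ := hF
      obtain ⟨c', hc'⟩ := hG
      exact ⟨c + c', fun w t => by simp [hc, hc']⟩
    | mul F G _ _ hF hG =>
      obtain ⟨c, hc⟩ := hF
      obtain ⟨c', hc'⟩ := hG
      exact ⟨c * c', fun w t => by simp [hc, hc']⟩
  refine ⟨fun d => (c.coeff d).1, fun d => ⟨(c.coeff d).2, fun s w => ?_⟩,
    ⟨c.natDegree + 1, fun d hd =>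
      congrArg Subtype.val (coeff_eq_zero_of_natDegree_lt hd)⟩, fun w =>
    ⟨c.map (E w), fun d => by rw [coeff_map]; rfl, hc w⟩⟩
  -- Homogeneity of the coefficients comes from computing `F ((t * s) • w)` in two ways.
  have h : c.map (E (s • w)) = (c.map (E w)).comp (C s * X) := by
    refine Polynomial.funext fun t => ?_
    rw [← hc, smul_smul, hc, eval_comp, eval_mul, eval_C, eval_X, mul_comm]
  have h2 := congrArg (fun p => p.coeff d) h
  simp only [comp_C_mul_X_coeff, coeff_map] at h2
  rw [mul_comm] at h2
  exact h2

open Polynomial in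
-- In the part of degree `d` of the relation only the component of degree `d - e j` of each `H j`
-- survives.
theorem IsHomogeneousFun.exists_homogeneous_coefficients {d : ℕ} {G : W → k}
    (hG : IsHomogeneousFun d G) {J : Type*} (s : Finset J) (F H : J → W → k) (e : J → ℕ)
    (hF : ∀ j ∈ s, IsHomogeneousFun (e j) (F j)) (hH : ∀ j, H j ∈ polyFunctions k W)
    (h : G = ∑ j ∈ s, H j * F j) :
    ∃ H' : J → W → k, (∀ j, H' j ∈ polyFunctions k W ∧ IsHomogeneousFun (d - e j) (H' j)) ∧
      G = ∑ j ∈ s, H' j * F j := by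
  choose c hc _ p hp hp' using fun j => exists_components (hH j)
  -- For `e j > d` the truncated difference is `0`, which would wrongly select the constant term;
  -- the coefficient must vanish there.
  refine ⟨fun j => if e j ≤ d then c j (d - e j) else 0, fun j => ?_, ?_⟩
  · dsimp only
    split_ifs
    · exact hc j _
    · exact ⟨zero_mem _, fun t w => by simp⟩
  · funext w
    have h1 : C (G w) * X ^ d = ∑ j ∈ s, p j w * (C (F j w) * X ^ e j) := by
      refine Polynomial.funext fun t => ?_
      have h2 := hG t w
      rw [h, Finset.sum_apply, eq_comm, ← h, mul_comm] at h2
      rw [eval_mul, eval_C, eval_pow, eval_X, h2, eval_finsetSum]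
      refine Finset.sum_congr rfl fun j hj => ?_
      rw [Pi.mul_apply, hp', hF j hj, eval_mul, eval_mul, eval_C, eval_pow, eval_X,
        mul_comm (t ^ e j)]
    have h2 := congrArg (fun q => q.coeff d) h1
    simp only [coeff_C_mul, coeff_X_pow_self, mul_one, finsetSum_coeff] at h2
    rw [h2, Finset.sum_apply]
    refine Finset.sum_congr rfl fun j _ => ?_
    rw [← mul_assoc, coeff_mul_X_pow', Pi.mul_apply]
    dsimp only
    split_ifs
    · rw [coeff_mul_C, hp]
    · rw [Pi.zero_apply, zero_mul]

/-- Hilbert's finiteness theorem: an algebra of polynomial functions with a Reynolds operator that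
preserves homogeneity is finitely generated. -/
theorem fg_of_reynolds [FiniteDimensional k W] (B : Subalgebra k (W → k))
    (hB : B ≤ polyFunctions k W) (R : (W → k) → W → k)
    (hR : ∀ F ∈ polyFunctions k W, R F ∈ B) (hRB : ∀ F ∈ B, R F = F)
    (hRh : ∀ d, ∀ F, IsHomogeneousFun d F → IsHomogeneousFun d (R F))
    (hRmul : ∀ H ∈ polyFunctions k W, ∀ F ∈ B, R (H * F) = R H * F)
    (hRsum : ∀ {J : Type} (s : Finset J) (F : J → W → k), (∀ j, F j ∈ polyFunctions k W) →
      R (∑ j ∈ s, F j) = ∑ j ∈ s, R (F j)) : B.FG := by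
  classical
  set S := polyFunctions k W with hS
  have : Algebra.FiniteType k S := S.fg_iff_finiteType.1 polyFunctions_fg
  have : IsNoetherianRing S := Algebra.FiniteType.isNoetherianRing k S
  -- Hilbert's ideal, spanned by the homogeneous members of `B` of positive degree; by noetherianity
  -- finitely many of them span it.
  set P : Set S := {F | F.1 ∈ B ∧ ∃ d, 0 < d ∧ IsHomogeneousFun d F.1} with hP
  obtain ⟨s, hsP, hs⟩ := (Submodule.fg_span_iff_fg_span_finset_subset P).1
    (IsNoetherian.noetherian (Submodule.span S P))
  refine ⟨s.image fun F => F.1, le_antisymm ?_ ?_⟩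
  · refine Algebra.adjoin_le fun f hf => ?_
    simp only [Finset.coe_image] at hf
    obtain ⟨F, hF, rfl⟩ := hf
    exact (hsP hF).1
  -- Applying `R` to an expression of `G` by the ideal generators puts its coefficients into `B`.
  -- They have lower degree because the generators have positive degree, so induction applies.
  have hom : ∀ d, ∀ G ∈ B, IsHomogeneousFun d G →
      G ∈ Algebra.adjoin k (s.image fun F => F.1 : Set (W → k)) := by
    intro d
    induction d using Nat.strong_induction_on with
    | _ d ih =>
      intro G hG hGd
      rcases Nat.eq_zero_or_pos d with rfl | hd
      · have : G = algebraMap k _ (G 0) := by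
          funext w
          simpa using (hGd 0 w).symm
        rw [this]
        exact Subalgebra.algebraMap_mem _ _
      · have hGs : (⟨G, hB hG⟩ : S) ∈ Submodule.span S (s : Set S) := by
          rw [← hs]
          exact Submodule.subset_span ⟨hG, d, hd, hGd⟩
        obtain ⟨H, -, hH⟩ := Submodule.mem_span_finset.1 hGs
        have hH' : G = ∑ F ∈ s, (H F).1 * F.1 := by
          have := congrArg Subtype.val hH
          simp only [smul_eq_mul, AddSubmonoidClass.coe_finsetSum, MulMemClass.coe_mul] at this
          exact this.symm
        choose! e he using fun F (hF : F ∈ s) => (hsP hF).2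
        obtain ⟨H', h1, h2⟩ := hGd.exists_homogeneous_coefficients s (fun F => F.1)
          (fun F => (H F).1) e (fun F hF => (he F hF).2) (fun F => (H F).2) hH'
        have h3 : G = ∑ F ∈ s, R (H' F) * F.1 := by
          rw [← hRB G hG]
          conv_lhs => rw [h2]
          rw [hRsum _ _ fun F => mul_mem (h1 F).1 F.2]
          exact Finset.sum_congr rfl fun F hF => hRmul _ (h1 F).1 _ (hsP hF).1
        rw [h3]
        refine sum_mem fun F hF => mul_mem ?_ (Algebra.subset_adjoin (by
          simp only [Finset.coe_image]
          exact ⟨F, hF, rfl⟩))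
        exact ih _ (Nat.sub_lt hd (he F hF).1) _ (hR _ (h1 F).1) (hRh _ _ (h1 F).2)
  intro F hF
  obtain ⟨c, hc, ⟨N, hN⟩, hp⟩ := exists_components (hB hF)
  have hsum : F = ∑ d ∈ Finset.range N, c d := by
    funext w
    obtain ⟨p, hp, hp'⟩ := hp w
    have hdeg : p.natDegree < N + 1 := Nat.lt_succ_of_le
      (Polynomial.natDegree_le_iff_coeff_eq_zero.2 fun d hd => by rw [hp, hN d hd.le]; rfl)
    have h1 := hp' 1
    rw [one_smul, Polynomial.eval_eq_sum_range' hdeg, Finset.sum_range_succ, hp, hN N le_rfl] at h1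
    simpa [hp] using h1
  -- The components of `F` are not known to lie in `B`, but their images under `R` do, and these
  -- still add up to `F`.
  rw [← hRB F hF, hsum, hRsum _ _ fun d => (hc d).1]
  exact sum_mem fun d _ => hom d _ (hR _ (hc d).1) (hRh _ _ (hc d).2)

variable {K : Type} [Group K] (ρ : Representation k K W)

/-- The polynomial functions that are invariant under a group of linear transformations. -/
def invariantPolyFunctions : Subalgebra k (W → k) where
  carrier := {F | F ∈ polyFunctions k W ∧ ∀ g w, F (ρ g w) = F w}
  mul_mem' := fun ha hb =>
    ⟨mul_mem ha.1 hb.1, fun g x => by simp only [Pi.mul_apply, ha.2 g x, hb.2 g x]⟩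
  add_mem' := fun ha hb =>
    ⟨add_mem ha.1 hb.1, fun g x => by simp only [Pi.add_apply, ha.2 g x, hb.2 g x]⟩
  algebraMap_mem' := fun c => ⟨Subalgebra.algebraMap_mem _ c, fun _ _ => rfl⟩

variable [TopologicalSpace K] [IsTopologicalGroup K]

variable (k K W) in
/-- The span of the products of a continuous function on `K` and a polynomial function on `W`. -/
def continuousPolySpan : Submodule k (K → W → k) :=
  Submodule.span k {Φ | ∃ φ : K → k, Continuous φ ∧ ∃ F ∈ polyFunctions k W,
    Φ = fun g w => φ g * F w}

/-- In a basis, a translated linear form has coefficients that are continuous in `g`, and this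
separated form is stable under sums and products. Integration over `K` then only affects the
coefficients, so averages remain polynomial. -/
theorem translate_mem_continuousPolySpan [FiniteDimensional k W]
    (hρ : ∀ (l : Module.Dual k W) w, Continuous fun g => l (ρ g w)) {F : W → k}
    (hF : F ∈ polyFunctions k W) :
    (fun g w => F (ρ g⁻¹ w)) ∈ continuousPolySpan k W K := by
  have hmul : ∀ Φ ∈ continuousPolySpan k W K, ∀ Ψ ∈ continuousPolySpan k W K,
      Φ * Ψ ∈ continuousPolySpan k W K := fun Φ hΦ Ψ hΨ => by
    have h := Submodule.mul_mem_mul hΦ hΨ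
    rw [continuousPolySpan, Submodule.span_mul_span] at h
    refine Submodule.span_mono ?_ h
    rintro _ ⟨_, ⟨φ, hφ, F, hF, rfl⟩, _, ⟨ψ, hψ, G, hG, rfl⟩, rfl⟩
    refine ⟨φ * ψ, hφ.mul hψ, F * G, mul_mem hF hG, ?_⟩
    funext g w
    exact mul_mul_mul_comm _ _ _ _
  induction hF using Algebra.adjoin_induction with
  | mem F hF =>
    obtain ⟨l, rfl⟩ := hF
    let b := Module.finBasis k W
    have : (fun (g : K) w => l (ρ g⁻¹ w)) =
        ∑ i, fun (g : K) w => l (ρ g⁻¹ (b i)) * b.coord i w := by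
      funext g w
      conv_lhs => rw [← b.sum_repr w, map_sum, map_sum]
      simp [mul_comm]
    dsimp only
    rw [this]
    exact sum_mem fun i _ => Submodule.subset_span
      ⟨_, (hρ l (b i)).comp continuous_inv, _, dual_mem_polyFunctions (b.coord i), rfl⟩
  | algebraMap a =>
    exact Submodule.subset_span ⟨fun _ => 1, continuous_const, _,
      Subalgebra.algebraMap_mem _ a, by funext g w; exact (one_mul _).symm⟩
  | add F G _ _ hF hG => exact add_mem hF hG
  | mul F G _ _ hF hG => exact hmul _ hF _ hG

variable [CompactSpace K] [MeasurableSpace K] [BorelSpace K]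

open MeasureTheory

theorem integral_mem_of_mem_continuousPolySpan (μ : Measure K) [IsFiniteMeasure μ]
    {Φ : K → W → k} (hΦ : Φ ∈ continuousPolySpan k W K) :
    (∀ w, Integrable (fun g => Φ g w) μ) ∧ (fun w => ∫ g, Φ g w ∂μ) ∈ polyFunctions k W := by
  induction hΦ using Submodule.span_induction with
  | mem Φ h =>
    obtain ⟨φ, hφ, F, hF, rfl⟩ := h
    have hi : Integrable φ μ :=
      hφ.integrable_of_hasCompactSupport (HasCompactSupport.of_compactSpace _)
    refine ⟨fun w => hi.mul_const _, ?_⟩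
    simp_rw [integral_mul_const]
    exact Subalgebra.smul_mem _ hF (∫ g, φ g ∂μ)
  | zero => exact ⟨fun w => integrable_zero _ _ _, by
    simp only [Pi.zero_apply, integral_zero]
    exact zero_mem (polyFunctions k W)⟩
  | add Φ Ψ _ _ h1 h2 =>
    refine ⟨fun w => (h1.1 w).add (h2.1 w), ?_⟩
    have : (fun w => ∫ g, (Φ + Ψ) g w ∂μ) = (fun w => ∫ g, Φ g w ∂μ) + fun w => ∫ g, Ψ g w ∂μ := by
      funext w
      exact integral_add (h1.1 w) (h2.1 w)
    rw [this]
    exact add_mem h1.2 h2.2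
  | smul a Φ _ h =>
    refine ⟨fun w => (h.1 w).const_mul a, ?_⟩
    have : (fun w => ∫ g, (a • Φ) g w ∂μ) = a • fun w => ∫ g, Φ g w ∂μ := by
      funext w
      exact integral_const_mul a _
    rw [this]
    exact Subalgebra.smul_mem _ h.2 a

/-- The average of a function over a group of linear transformations. -/
def average (μ : Measure K) (F : W → k) : W → k := fun w => ∫ g, F (ρ g⁻¹ w) ∂μ

variable {ρ}

theorem average_mem [FiniteDimensional k W]
    (hρ : ∀ (l : Module.Dual k W) w, Continuous fun g => l (ρ g w)) (μ : Measure K)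
    [IsFiniteMeasure μ] [μ.IsMulLeftInvariant] {F : W → k} (hF : F ∈ polyFunctions k W) :
    average ρ μ F ∈ invariantPolyFunctions ρ := by
  refine ⟨(integral_mem_of_mem_continuousPolySpan μ
    (translate_mem_continuousPolySpan ρ hρ hF)).2, fun h w => ?_⟩
  -- The substitution `g ↦ h⁻¹ * g` turns `g⁻¹` into `g⁻¹ * h`.
  have := integral_mul_left_eq_self (μ := μ) (fun g => F (ρ g⁻¹ w)) h⁻¹
  unfold average
  rw [← this]
  congr 1
  funext g
  rw [mul_inv_rev, inv_inv, map_mul]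
  rfl

theorem exists_haar_probability (K : Type) [Group K] [TopologicalSpace K] [IsTopologicalGroup K]
    [CompactSpace K] [MeasurableSpace K] [BorelSpace K] :
    ∃ μ : Measure K, IsProbabilityMeasure μ ∧ μ.IsMulLeftInvariant :=
  ⟨Measure.haarMeasure ⊤, ⟨Measure.haarMeasure_self⟩, inferInstance⟩

/-- The invariants of a compact group of linear transformations are finitely generated. -/
theorem invariantPolyFunctions_fg {K : Type} [Group K] (ρ : Representation k K W)
    [TopologicalSpace K] [IsTopologicalGroup K] [CompactSpace K] [FiniteDimensional k W]
    (hρ : ∀ (l : Module.Dual k W) w, Continuous fun g => l (ρ g w)) :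
    (invariantPolyFunctions ρ).FG := by
  borelize K
  obtain ⟨μ, _, _⟩ := exists_haar_probability K
  refine fg_of_reynolds _ (fun F hF => hF.1) (average ρ μ) (fun F hF => average_mem hρ μ hF)
    (fun F hF => ?_) (fun d F hF t w => ?_) (fun H hH F hF => ?_) (fun {J} s F hF => ?_)
  · funext w
    simp [average, hF.2]
  · simp only [average, map_smul, hF t, integral_const_mul]
  · funext w
    simp only [average, Pi.mul_apply, hF.2, integral_mul_const]
  · funext w
    simp only [average, Finset.sum_apply]
    exact integral_finsetSum _ fun j _ => (integral_mem_of_mem_continuousPolySpan μ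
      (translate_mem_continuousPolySpan ρ hρ (hF j))).1 w

/-- Invariant functions on a stable subset of a representation of a compact group that are
restrictions of polynomial functions are restrictions of invariant polynomial functions. -/
theorem exists_invariant_extension {K : Type} [Group K] (ρ : Representation k K W)
    [TopologicalSpace K] [IsTopologicalGroup K] [CompactSpace K] [FiniteDimensional k W]
    (hρ : ∀ (l : Module.Dual k W) w, Continuous fun g => l (ρ g w)) {X : Type} (i : X → W)
    (act : K → X → X) (hi : ∀ g x, i (act g x) = ρ g (i x)) {F : W → k}
    (hF : F ∈ polyFunctions k W) (hinv : ∀ g x, F (i (act g x)) = F (i x)) :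
    ∃ F' ∈ invariantPolyFunctions ρ, F' ∘ i = F ∘ i := by
  borelize K
  obtain ⟨μ, _, _⟩ := exists_haar_probability K
  refine ⟨average ρ μ F, average_mem hρ μ hF, ?_⟩
  funext x
  simp [average, ← hi, hinv]

/-- The invariants of a compact group on a stable subset of a representation are finitely
generated. -/
theorem fg_of_mem_iff {K : Type} [Group K] (ρ : Representation k K W)
    [TopologicalSpace K] [IsTopologicalGroup K] [CompactSpace K] [FiniteDimensional k W]
    (hρ : ∀ (l : Module.Dual k W) w, Continuous fun g => l (ρ g w)) {X : Type} (i : X → W)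
    (act : K → X → X) (hi : ∀ g x, i (act g x) = ρ g (i x)) (A : Subalgebra k (X → k))
    (hA : ∀ f, f ∈ A ↔ (∃ F ∈ polyFunctions k W, F ∘ i = f) ∧ ∀ g x, f (act g x) = f x) :
    A.FG := by
  have : A = (invariantPolyFunctions ρ).map (pullback k i) := by
    ext f
    rw [hA, Subalgebra.mem_map]
    constructor
    · rintro ⟨⟨F, hF, rfl⟩, hinv⟩
      exact exists_invariant_extension ρ hρ i act hi hF hinv
    · rintro ⟨F, hF, rfl⟩
      refine ⟨⟨F, hF.1, rfl⟩, fun g x => ?_⟩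
      change F (i (act g x)) = F (i x)
      rw [hi, hF.2]
  rw [this]
  exact (invariantPolyFunctions_fg ρ hρ).map _

end Invariants

/-! ### Affine GIT quotients as varieties -/

section GITVariety

variable {k : Type} [Field k] {Γ : Type} [Group Γ] {X : Type} [FunctionSpace k X] [MulAction Γ X]

theorem GITQuotient.ideal_isMaximal (m : GITQuotient k Γ X) : m.ideal.IsMaximal := m.isMaximal

theorem GITQuotient.value_unique {m : GITQuotient k Γ X} {b : invariants k Γ X} {c c' : k}
    (h : b - algebraMap k _ c ∈ m.ideal) (h' : b - algebraMap k _ c' ∈ m.ideal) : c = c' := by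
  by_contra hne
  have h1 : algebraMap k (invariants k Γ X) (c - c') ∈ m.ideal := by
    have := m.ideal.sub_mem h' h
    rwa [sub_sub_sub_cancel_left, ← map_sub] at this
  exact m.ideal_isMaximal.ne_top (Ideal.eq_top_of_isUnit_mem _ h1
    ((isUnit_iff_ne_zero.2 (sub_ne_zero.2 hne)).map _))

/-- Nullstellensatz: the residue field is of finite type over `k`, hence finite, hence equal to the
algebraically closed field `k`. -/
theorem exists_sub_algebraMap_mem_of_isMaximal [IsAlgClosed k] {A : Type} [CommRing A]
    [Algebra k A] [Algebra.FiniteType k A] (I : Ideal A) [I.IsMaximal] (b : A) :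
    ∃ c : k, b - algebraMap k A c ∈ I := by
  let := Ideal.Quotient.field I
  have : Module.Finite k (A ⧸ I) := finite_of_finite_type_of_isJacobsonRing k (A ⧸ I)
  have : Algebra.IsIntegral k (A ⧸ I) := Algebra.IsIntegral.of_finite k (A ⧸ I)
  obtain ⟨c, hc⟩ := (IsAlgClosed.algebraMap_bijective_of_isIntegral
    (k := k) (K := A ⧸ I)).2 (Ideal.Quotient.mk _ b)
  exact ⟨c, Ideal.Quotient.eq.1 hc.symm⟩

theorem GITQuotient.exists_value [IsAlgClosed k] (hfg : (invariants k Γ X).FG)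
    (m : GITQuotient k Γ X) (b : invariants k Γ X) : ∃ c : k, b - algebraMap k _ c ∈ m.ideal := by
  have := m.ideal_isMaximal
  have : Algebra.FiniteType k (invariants k Γ X) := (Subalgebra.fg_iff_finiteType _).1 hfg
  exact exists_sub_algebraMap_mem_of_isMaximal m.ideal b

/-- The function on `X // Γ` that an invariant regular function on `X` defines. -/
def gitValue [IsAlgClosed k] (hfg : (invariants k Γ X).FG) :
    invariants k Γ X →ₐ[k] (GITQuotient k Γ X → k) where
  toFun b m := (m.exists_value hfg b).choose
  map_one' := funext fun m => GITQuotient.value_unique (m.exists_value hfg 1).choose_spec (by simp)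
  map_mul' a b := funext fun m =>
    GITQuotient.value_unique (m.exists_value hfg (a * b)).choose_spec (by
      have h := m.ideal.add_mem (m.ideal.mul_mem_left a (m.exists_value hfg b).choose_spec)
        (m.ideal.mul_mem_left (algebraMap k _ (m.exists_value hfg b).choose)
          (m.exists_value hfg a).choose_spec)
      convert h using 1
      rw [Pi.mul_apply, map_mul]
      ring)
  map_zero' := funext fun m =>
    GITQuotient.value_unique (m.exists_value hfg 0).choose_spec (by simp)
  map_add' a b := funext fun m =>
    GITQuotient.value_unique (m.exists_value hfg (a + b)).choose_spec (by
      have h := m.ideal.add_mem (m.exists_value hfg a).choose_spec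
        (m.exists_value hfg b).choose_spec
      convert h using 1
      rw [Pi.add_apply, map_add]
      ring)
  commutes' c := funext fun m =>
    GITQuotient.value_unique (m.exists_value hfg (algebraMap k _ c)).choose_spec (by simp)

section

variable [IsAlgClosed k]

theorem sub_gitValue_mem (hfg : (invariants k Γ X).FG)
    (b : invariants k Γ X) (m : GITQuotient k Γ X) :
    b - algebraMap k _ (gitValue hfg b m) ∈ m.ideal :=
  (m.exists_value hfg b).choose_spec

theorem gitValue_eq (hfg : (invariants k Γ X).FG)
    {b : invariants k Γ X} {m : GITQuotient k Γ X} {c : k}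
    (h : b - algebraMap k _ c ∈ m.ideal) : gitValue hfg b m = c :=
  GITQuotient.value_unique (sub_gitValue_mem hfg b m) h

theorem gitValue_eq_zero_iff (hfg : (invariants k Γ X).FG)
    {b : invariants k Γ X} {m : GITQuotient k Γ X} :
    gitValue hfg b m = 0 ↔ b ∈ m.ideal := by
  constructor
  · intro h
    simpa [h] using sub_gitValue_mem hfg b m
  · intro h
    exact gitValue_eq hfg (by simpa using h)

theorem regular_gitQuotient_eq_range (hfg : (invariants k Γ X).FG) :
    regular k (GITQuotient k Γ X) = (gitValue hfg).range := by
  ext F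
  constructor
  · rintro ⟨b, hb⟩
    exact ⟨b, funext fun m => gitValue_eq hfg (hb m)⟩
  · rintro ⟨b, rfl⟩
    exact ⟨b, sub_gitValue_mem hfg b⟩

/-- If the algebra of invariants is finitely generated, then the GIT quotient is an affine
variety. -/
theorem isAffineVariety_gitQuotient (hfg : (invariants k Γ X).FG) :
    IsAffineVariety k (GITQuotient k Γ X) := by
  have hmem : ∀ b, gitValue hfg b ∈ regular k (GITQuotient k Γ X) := fun b =>
    ⟨b, sub_gitValue_mem hfg b⟩
  refine ⟨?_, fun m m' h => ?_, fun ψ => ?_⟩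
  · rw [regular_gitQuotient_eq_range hfg, ← Algebra.map_top]
    exact ((Subalgebra.fg_top _).2 hfg).map _
  · refine MaximalSpectrum.ext (Ideal.ext fun b => ?_)
    have h1 : gitValue hfg b m = gitValue hfg b m' :=
      DFunLike.congr_fun h (⟨_, hmem b⟩ : regular k (GITQuotient k Γ X))
    change b ∈ m.ideal ↔ b ∈ m'.ideal
    rw [← gitValue_eq_zero_iff hfg, h1, gitValue_eq_zero_iff]
  -- The point with evaluation `ψ` is the kernel of `ψ`, transported to the algebra of invariants.
  · let φ : invariants k Γ X →ₐ[k] k := ψ.comp ((gitValue hfg).codRestrict _ hmem)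
    have hφ : Function.Surjective φ := fun c => ⟨algebraMap k _ c, φ.commutes c⟩
    let m : GITQuotient k Γ X :=
      { asIdeal := RingHom.ker φ
        isMaximal := RingHom.ker_isMaximal_of_surjective φ hφ }
    refine ⟨m, AlgHom.ext fun F => ?_⟩
    obtain ⟨b, hb⟩ : F.1 ∈ (gitValue hfg).range := regular_gitQuotient_eq_range hfg ▸ F.2
    have h1 : gitValue hfg b m = φ b := gitValue_eq hfg (by
      change φ (b - algebraMap k _ (φ b)) = 0
      rw [map_sub, φ.commutes]
      exact sub_self _)
    have h2 : F = (gitValue hfg).codRestrict _ hmem b := Subtype.ext hb.symm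
    change F.1 m = ψ F
    rw [← hb]
    refine h1.trans ?_
    rw [h2]
    rfl

end

/-- The bijection of GIT quotients induced by an isomorphism of the algebras of invariants. -/
def gitQuotientEquiv {Γ' : Type} [Group Γ'] {X' : Type} [FunctionSpace k X'] [MulAction Γ' X']
    (e : invariants k Γ X ≃ₐ[k] invariants k Γ' X') :
    GITQuotient k Γ X ≃ GITQuotient k Γ' X' where
  toFun m :=
    { asIdeal := m.asIdeal.comap e.symm
      isMaximal :=
        have := m.isMaximal
        Ideal.comap_isMaximal_of_surjective e.symm e.symm.surjective }
  invFun m :=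
    { asIdeal := m.asIdeal.comap e
      isMaximal :=
        have := m.isMaximal
        Ideal.comap_isMaximal_of_surjective e e.surjective }
  left_inv m := MaximalSpectrum.ext (Ideal.ext fun b => by
    change e.symm (e b) ∈ m.asIdeal ↔ _
    rw [e.symm_apply_apply])
  right_inv m := MaximalSpectrum.ext (Ideal.ext fun b => by
    change e (e.symm b) ∈ m.asIdeal ↔ _
    rw [e.apply_symm_apply])

/-- An isomorphism between the algebras of invariants induces an isomorphism of GIT quotients. -/
def gitQuotientIso {Γ' : Type} [Group Γ'] {X' : Type} [FunctionSpace k X'] [MulAction Γ' X']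
    (e : invariants k Γ X ≃ₐ[k] invariants k Γ' X') :
    VarietyIso k (GITQuotient k Γ X) (GITQuotient k Γ' X') where
  toEquiv := gitQuotientEquiv e
  regular_iff F := by
    constructor
    · rintro ⟨b, hb⟩
      refine ⟨e.symm b, fun m => ?_⟩
      have h : e.symm (b - algebraMap k _ (F (gitQuotientEquiv e m))) ∈ m.ideal :=
        hb (gitQuotientEquiv e m)
      rwa [map_sub, e.symm.commutes] at h
    · rintro ⟨b, hb⟩
      refine ⟨e b, fun m => ?_⟩
      have h := hb ((gitQuotientEquiv e).symm m)
      rw [Function.comp_apply, Equiv.apply_symm_apply] at h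
      have h' : e (b - algebraMap k _ (F m)) ∈ m.ideal := h
      rwa [map_sub, e.commutes] at h'

theorem gitQuotientIso_gitProj {Γ' : Type} [Group Γ'] {X' : Type} [FunctionSpace k X']
    [MulAction Γ' X'] (e : invariants k Γ X ≃ₐ[k] invariants k Γ' X') {x : X} {x' : X'}
    (h : ∀ b, (e b).1 x' = b.1 x) :
    (gitQuotientIso e).toEquiv (gitProj k Γ x) = gitProj k Γ' x' := by
  refine MaximalSpectrum.ext (Ideal.ext fun b => ?_)
  change (e.symm b).1 x = 0 ↔ b.1 x' = 0
  rw [← h, e.apply_symm_apply]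

/-! ### Invariants of a further group on a GIT quotient -/

section Iterated

variable (Z : Type) [Group Z] [MulAction Z X] [SMulCommClass Z Γ X] [RegularAction k Z X]

theorem eq_comp_gitProj {F : GITQuotient k Γ X → k} {b : invariants k Γ X}
    (hb : ∀ m, b - algebraMap k _ (F m) ∈ m.ideal) : F ∘ gitProj k Γ = b.1 :=
  funext fun x => (sub_eq_zero.1 (hb (gitProj k Γ x))).symm

/-- The invariants of `Z` on `X // Γ` are the functions on `X` that are invariant under `Γ` and
under `Z`. -/
def invariantsGITQuotientEquiv [IsAlgClosed k] (hfg : (invariants k Γ X).FG) :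
    invariants k Z (GITQuotient k Γ X) ≃ₐ[k] (invariants k Γ X ⊓ invariants k Z X :
      Subalgebra k (X → k)) :=
  AlgEquiv.ofBijective
    (AlgHom.codRestrict ((pullback k (gitProj k Γ)).comp (invariants k Z (GITQuotient k Γ X)).val)
      _ (by
        rintro ⟨F, ⟨b, hb⟩, hF⟩
        have h := eq_comp_gitProj hb
        refine ⟨?_, ?_, fun z x => ?_⟩
        · change F ∘ gitProj k Γ ∈ _
          rw [h]
          exact b.2
        · change F ∘ gitProj k Γ ∈ _
          rw [h]
          exact b.2.1
        · change F (gitProj k Γ (z • x)) = F (gitProj k Γ x)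
          rw [← smul_gitProj, hF]))
    (by
      constructor
      · rw [injective_iff_map_eq_zero]
        rintro ⟨F, ⟨b, hb⟩, hF⟩ h0
        -- The pull-back sees only the maximal ideals that come from points of `X`, but it
        -- determines `b`, and `b` determines `F` at all maximal ideals.
        have h1 : F ∘ gitProj k Γ = 0 := congrArg Subtype.val h0
        rw [eq_comp_gitProj hb] at h1
        have h2 : b = 0 := Subtype.ext h1
        refine Subtype.ext (funext fun m => ?_)
        refine GITQuotient.value_unique (hb m) ?_
        rw [h2]
        simp
      · rintro ⟨f, hf, hf'⟩
        refine ⟨⟨gitValue hfg ⟨f, hf⟩, ⟨_, sub_gitValue_mem hfg _⟩, fun z m => ?_⟩, ?_⟩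
        · refine gitValue_eq hfg ?_
          change pullInv k Γ Z X z (⟨f, hf⟩ - algebraMap k _ _) ∈ m.ideal
          have h : pullInv k Γ Z X z ⟨f, hf⟩ = ⟨f, hf⟩ :=
            Subtype.ext (funext fun x => hf'.2 z x)
          rw [map_sub, AlgHom.commutes, h]
          exact sub_gitValue_mem hfg _ m
        · exact Subtype.ext (eq_comp_gitProj (sub_gitValue_mem hfg ⟨f, hf⟩)))

end Iterated

end GITVariety

/-! ### Functions on representation spaces invariant under the centre -/

section Centre

variable {k : Type} [Field k] {r : ℕ} {G H : Type} [Group G] [FunctionSpace k G] [Group H]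
  [FunctionSpace k H]

theorem comp_gen_mem_regular {f : G → k} (hf : f ∈ regular k G) (i : Fin r) :
    (fun ρ : Rep r G => f (ρ.gen i)) ∈ regular k (Rep r G) :=
  Algebra.subset_adjoin ⟨i, f, hf, rfl⟩

theorem regular_rep_eq_adjoin : regular k (Rep r G) =
    Algebra.adjoin k {F | ∃ (i : Fin r), ∃ f ∈ regular k G, F = fun ρ => f (ρ.gen i)} := rfl

/-- A regular function on `R_r(G)` that is invariant under a finite centre is a polynomial in
invariant regular functions of the single values. -/
theorem mem_adjoin_of_central_invariant [CharZero k] [Finite (Subgroup.center G)]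
    (htr : ∀ (z : Subgroup.center G), ∀ f ∈ regular k G,
      (fun g => f ((z : G) * g)) ∈ regular k G)
    {φ : Rep r G → k} (hφ : φ ∈ regular k (Rep r G))
    (hinv : ∀ (z : Fin r → Subgroup.center G) ρ, φ (z • ρ) = φ ρ) :
    φ ∈ Algebra.adjoin k {F | ∃ (i : Fin r), ∃ f ∈ regular k G,
      (∀ (z : Subgroup.center G) g, f ((z : G) * g) = f g) ∧
        F = fun ρ : Rep r G => f (ρ.gen i)} := by
  classical
  have := Fintype.ofFinite (Subgroup.center G)
  set T : Subalgebra k (Rep r G → k) := Algebra.adjoin k {F | ∃ (i : Fin r), ∃ f ∈ regular k G,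
      (∀ (z : Subgroup.center G) g, f ((z : G) * g) = f g) ∧
        F = fun ρ : Rep r G => f (ρ.gen i)} with hT
  -- A monomial is a product of one regular function for each generator, so the summation over
  -- `Z(G)^r` in `key` factors into sums over `Z(G)`.
  have hprod : ∀ m ∈ Submonoid.closure {F : Rep r G → k | ∃ (i : Fin r), ∃ f ∈ regular k G,
      F = fun ρ => f (ρ.gen i)}, ∃ F : Fin r → G → k, (∀ i, F i ∈ regular k G) ∧
        m = fun ρ => ∏ i, F i (ρ.gen i) := by
    intro m hm
    induction hm using Submonoid.closure_induction with
    | mem m h =>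
      obtain ⟨i, f, hf, rfl⟩ := h
      refine ⟨Function.update 1 i f, fun j => ?_, ?_⟩
      · by_cases hj : j = i
        · subst hj
          simpa using hf
        · rw [Function.update_of_ne hj]
          exact one_mem (regular k G)
      · funext ρ
        rw [Finset.prod_eq_single i]
        · simp
        · intro j _ hj
          rw [Function.update_of_ne hj]
          rfl
        · exact fun h => absurd (Finset.mem_univ i) h
    | one => exact ⟨1, fun _ => one_mem _, by funext ρ; simp⟩
    | mul m m' _ _ h h' =>
      obtain ⟨F, hF, rfl⟩ := h
      obtain ⟨F', hF', rfl⟩ := h'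
      refine ⟨F * F', fun i => mul_mem (hF i) (hF' i), ?_⟩
      funext ρ
      simp [Finset.prod_mul_distrib]
  have key : ∀ ψ ∈ regular k (Rep r G),
      (fun ρ => ∑ z : Fin r → Subgroup.center G, ψ (z • ρ)) ∈ T := by
    intro ψ hψ
    rw [regular_rep_eq_adjoin, ← Subalgebra.mem_toSubmodule, Algebra.adjoin_eq_span] at hψ
    induction hψ using Submodule.span_induction with
    | mem m hm =>
      obtain ⟨F, hF, rfl⟩ := hprod m hm
      have h1 : (fun ρ : Rep r G => ∑ z : Fin r → Subgroup.center G,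
          ∏ i, F i ((z • ρ).gen i)) =
            ∏ i, fun ρ : Rep r G => ∑ z : Subgroup.center G, F i (z * ρ.gen i) := by
        funext ρ
        rw [Finset.prod_apply, Finset.prod_univ_sum, Fintype.piFinset_univ]
        simp only [Rep.gen_central]
      rw [h1]
      refine prod_mem fun i _ => Algebra.subset_adjoin
        ⟨i, fun g => ∑ z : Subgroup.center G, F i (z * g), ?_, fun z g => ?_, rfl⟩
      · have : (fun g => ∑ z : Subgroup.center G, F i (z * g)) =
            ∑ z : Subgroup.center G, fun g => F i (z * g) := by
          funext g
          simp
        rw [this]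
        exact sum_mem fun z _ => htr z _ (hF i)
      · refine Fintype.sum_equiv (Equiv.mulRight z) _ _ fun w => ?_
        simp [mul_assoc]
    | zero =>
      simp only [Pi.zero_apply, Finset.sum_const_zero]
      exact zero_mem T
    | add ψ ψ' _ _ h h' =>
      have := add_mem h h'
      convert this using 1
      funext ρ
      simp [Finset.sum_add_distrib]
    | smul a ψ _ h =>
      have := T.smul_mem h a
      convert this using 1
      funext ρ
      simp [Finset.mul_sum]
  have h := T.smul_mem (key φ hφ) ((Fintype.card (Fin r → Subgroup.center G) : k)⁻¹)
  convert h using 1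
  funext ρ
  have hne : (Fintype.card (Fin r → Subgroup.center G) : k) ≠ 0 :=
    Nat.cast_ne_zero.2 Fintype.card_ne_zero
  simp only [hinv, Finset.sum_const, Finset.card_univ, Pi.smul_apply, smul_eq_mul, nsmul_eq_mul]
  rw [inv_mul_cancel_left₀ hne]

theorem Rep.gen_comp (π : G →* H) (ρ : Rep r G) (i : Fin r) :
    (Rep.comp π ρ).gen i = π (ρ.gen i) := rfl

theorem Rep.comp_smul (π : G →* H) (g : G) (ρ : Rep r G) :
    Rep.comp π (g • ρ) = π g • Rep.comp π ρ :=
  Rep.ext fun i => by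
    rw [Rep.gen_comp, Rep.gen_conj, Rep.gen_conj, Rep.gen_comp, map_mul, map_mul, map_inv]

theorem Rep.comp_central_smul {π : G →* H} (hπ : ∀ z : Subgroup.center G, π z = 1)
    (z : Fin r → Subgroup.center G) (ρ : Rep r G) : Rep.comp π (z • ρ) = Rep.comp π ρ :=
  Rep.ext fun i => by
    rw [Rep.gen_comp, Rep.gen_central, map_mul, hπ, one_mul, Rep.gen_comp]

theorem Rep.comp_surjective {π : G →* H} (hπ : Function.Surjective π) :
    Function.Surjective (Rep.comp π : Rep r G → Rep r H) := fun σ => by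
  choose g hg using fun i => hπ (σ.gen i)
  exact ⟨Rep.ofGen g, Rep.ext fun i => by rw [Rep.gen_comp, Rep.gen_ofGen, hg]⟩

theorem comp_repComp_mem_regular {π : G →* H} (hπ : ∀ f ∈ regular k H, f ∘ π ∈ regular k G)
    {F : Rep r H → k} (hF : F ∈ regular k (Rep r H)) :
    F ∘ Rep.comp π ∈ regular k (Rep r G) := by
  suffices h : regular k (Rep r H) ≤
      (regular k (Rep r G)).comap (pullback k (Rep.comp π)) from h hF
  refine Algebra.adjoin_le ?_
  rintro _ ⟨i, f, hf, rfl⟩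
  exact comp_gen_mem_regular (hπ f hf) i

/-- Regular functions on `R_r(G)` that are invariant under the centre descend to `R_r(H)`, if this
holds for `r = 1`. -/
theorem exists_regular_descend [CharZero k] [Finite (Subgroup.center G)] {π : G →* H}
    (htr : ∀ (z : Subgroup.center G), ∀ f ∈ regular k G,
      (fun g => f ((z : G) * g)) ∈ regular k G)
    (hπ : ∀ f ∈ regular k G, (∀ (z : Subgroup.center G) g, f ((z : G) * g) = f g) →
      ∃ f' ∈ regular k H, f' ∘ π = f) {φ : Rep r G → k} (hφ : φ ∈ regular k (Rep r G))
    (hinv : ∀ (z : Fin r → Subgroup.center G) ρ, φ (z • ρ) = φ ρ) :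
    ∃ F ∈ regular k (Rep r H), F ∘ Rep.comp π = φ := by
  suffices h : Algebra.adjoin k {F | ∃ (i : Fin r), ∃ f ∈ regular k G,
      (∀ (z : Subgroup.center G) g, f ((z : G) * g) = f g) ∧
        F = fun ρ : Rep r G => f (ρ.gen i)} ≤
      (regular k (Rep r H)).map (pullback k (Rep.comp π)) from
    h (mem_adjoin_of_central_invariant htr hφ hinv)
  refine Algebra.adjoin_le ?_
  rintro _ ⟨i, f, hf, hfz, rfl⟩
  obtain ⟨f', hf', rfl⟩ := hπ f hf hfz
  exact ⟨_, comp_gen_mem_regular hf' i, rfl⟩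

/-- The invariants of `R_r(H)` for a quotient `H` of `G` by its centre. -/
def invariantsRepEquiv {π : G →* H} (hsurj : Function.Surjective π)
    (hcen : ∀ z : Subgroup.center G, π z = 1)
    (hdown : ∀ f ∈ regular k H, f ∘ π ∈ regular k G)
    (hup : ∀ φ ∈ regular k (Rep r G), (∀ (z : Fin r → Subgroup.center G) ρ, φ (z • ρ) = φ ρ) →
      ∃ F ∈ regular k (Rep r H), F ∘ Rep.comp π = φ) :
    invariants k H (Rep r H) ≃ₐ[k] (invariants k G (Rep r G) ⊓
      invariants k (Fin r → Subgroup.center G) (Rep r G) : Subalgebra k (Rep r G → k)) :=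
  AlgEquiv.ofBijective
    (AlgHom.codRestrict ((pullback k (Rep.comp π)).comp (invariants k H (Rep r H)).val) _ (by
        rintro ⟨F, hF, hF'⟩
        have h := comp_repComp_mem_regular hdown hF
        refine ⟨⟨h, fun g ρ => ?_⟩, h, fun z ρ => ?_⟩
        · change F _ = F _
          rw [Rep.comp_smul, hF']
        · change F _ = F _
          rw [Rep.comp_central_smul hcen]))
    (by
      constructor
      · rw [injective_iff_map_eq_zero]
        rintro ⟨F, hF⟩ h0
        refine Subtype.ext (funext fun σ => ?_)
        obtain ⟨ρ, rfl⟩ := Rep.comp_surjective hsurj σ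
        exact congrFun (congrArg Subtype.val h0) ρ
      · rintro ⟨φ, hφ, hφ'⟩
        obtain ⟨F, hF, rfl⟩ := hup φ hφ.1 hφ'.2
        refine ⟨⟨F, hF, fun h σ => ?_⟩, rfl⟩
        obtain ⟨ρ, rfl⟩ := Rep.comp_surjective hsurj σ
        obtain ⟨g, rfl⟩ := hsurj h
        rw [← Rep.comp_smul]
        exact hφ.2 g ρ)

end Centre

/-! ### The groups `SL_n`, `U(n)` and `SU(n)` -/

section Groups

open Matrix

variable {n : ℕ}

instance : IsTopologicalGroup (SU n) where
  continuous_inv := by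
    refine Continuous.subtype_mk (f := fun A : SU n => star A.1) ?_ _
    exact continuous_star.comp continuous_subtype_val

theorem isCompact_unitaryGroup : IsCompact (unitaryGroup (Fin n) ℂ : Set (Matrix (Fin n) (Fin n) ℂ)) := by
  refine ((isCompact_closedBall (0 : ℂ) 1).matrix (m := Fin n) (n := Fin n)).of_isClosed_subset ?_
    fun A hA i j => ?_
  · have : (unitaryGroup (Fin n) ℂ : Set (Matrix (Fin n) (Fin n) ℂ)) = {A | star A * A = 1} := by
      ext A
      exact mem_unitaryGroup_iff'
    rw [this]
    exact isClosed_eq (continuous_star.matrix_mul continuous_id) continuous_const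
  · rw [mem_closedBall_zero_iff]
    exact entry_norm_bound_of_unitary hA i j

instance : CompactSpace (SU n) := by
  refine isCompact_iff_compactSpace.1 (isCompact_unitaryGroup.of_isClosed_subset ?_
    specialUnitaryGroup_le_unitaryGroup)
  have : (specialUnitaryGroup (Fin n) ℂ : Set (Matrix (Fin n) (Fin n) ℂ)) =
      (unitaryGroup (Fin n) ℂ : Set (Matrix (Fin n) (Fin n) ℂ)) ∩ {A | A.det = 1} := by
    ext A
    exact mem_specialUnitaryGroup_iff
  rw [this]
  exact isCompact_unitaryGroup.isClosed.inter
    (isClosed_eq continuous_id.matrix_det continuous_const)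

variable (n) in
/-- The inclusion of `SU(n)` in `SL_n`. -/
def suToSL : SU n →* SL n where
  toFun A := ⟨A.1, (mem_specialUnitaryGroup_iff.1 A.2).2⟩
  map_one' := rfl
  map_mul' _ _ := rfl

variable (n) in
/-- The inclusion of `SU(n)` in `U(n)`. -/
def suToU : SU n →* U n := Submonoid.inclusion specialUnitaryGroup_le_unitaryGroup

theorem smul_mem_unitaryGroup {c : ℂ} (hc : ‖c‖ = 1) {A : Matrix (Fin n) (Fin n) ℂ}
    (hA : A ∈ unitaryGroup (Fin n) ℂ) : c • A ∈ unitaryGroup (Fin n) ℂ := by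
  rw [mem_unitaryGroup_iff'] at hA ⊢
  rw [star_smul, smul_mul_smul_comm, hA, Complex.star_def, ← Complex.normSq_eq_conj_mul_self,
    Complex.normSq_eq_norm_sq, hc]
  simp

/-- A scalar of norm one as a unitary matrix. -/
def scalarU (n : ℕ) (c : ℂ) (hc : ‖c‖ = 1) : U n :=
  ⟨c • (1 : Matrix (Fin n) (Fin n) ℂ), smul_mem_unitaryGroup hc (one_mem _)⟩

theorem scalarU_mem_center (c : ℂ) (hc : ‖c‖ = 1) : scalarU n c hc ∈ Subgroup.center (U n) := by
  rw [Subgroup.mem_center_iff]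
  intro g
  refine Subtype.ext ?_
  change g.1 * (c • 1) = (c • 1) * g.1
  simp

theorem norm_det_eq_one (g : U n) : ‖g.1.det‖ = 1 := by
  have h := det_of_mem_unitary g.2
  rw [Unitary.mem_iff] at h
  have h1 := h.1
  rw [Complex.star_def, ← Complex.normSq_eq_conj_mul_self, Complex.normSq_eq_norm_sq] at h1
  have h2 : ‖g.1.det‖ ^ 2 = 1 := by exact_mod_cast h1
  exact (pow_eq_one_iff_of_nonneg (norm_nonneg _) two_ne_zero).1 h2

/-- Every unitary matrix is a scalar times a special unitary matrix. -/
theorem exists_scalarU_mul_suToU [NeZero n] (g : U n) :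
    ∃ (c : ℂ) (hc : ‖c‖ = 1) (s : SU n), g = scalarU n c hc * suToU n s ∧ c ^ n = g.1.det := by
  -- The scalar is an `n`-th root of the determinant.
  obtain ⟨c, hc⟩ := IsAlgClosed.exists_pow_nat_eq g.1.det (NeZero.pos n)
  have hc1 : ‖c‖ = 1 := by
    have := norm_det_eq_one g
    rw [← hc, norm_pow] at this
    exact (pow_eq_one_iff_of_nonneg (norm_nonneg _) (NeZero.ne n)).1 this
  have hc0 : c ≠ 0 := fun h => by simp [h] at hc1
  refine ⟨c, hc1, ⟨c⁻¹ • g.1, mem_specialUnitaryGroup_iff.2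
    ⟨smul_mem_unitaryGroup (by simp [hc1]) g.2, ?_⟩⟩, Subtype.ext ?_, hc⟩
  · rw [det_smul, Fintype.card_fin, ← hc, inv_pow, inv_mul_cancel₀ (pow_ne_zero _ hc0)]
  · change g.1 = (c • 1) * (c⁻¹ • g.1)
    rw [smul_mul_smul_comm, mul_inv_cancel₀ hc0, one_smul, one_mul]

open scoped Matrix.Norms.L2Operator in
/-- The centre of `U(n)` consists of scalar matrices. -/
theorem exists_eq_smul_one_of_mem_center {z : U n} (hz : z ∈ Subgroup.center (U n)) :
    ∃ c : ℂ, z.1 = c • (1 : Matrix (Fin n) (Fin n) ℂ) := by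
  have hall : ∀ B : Matrix (Fin n) (Fin n) ℂ, B * z.1 = z.1 * B := by
    intro B
    -- Unitary matrices span all matrices, so a central unitary matrix commutes with every matrix.
    have hB : B ∈ Submodule.span ℂ (unitary (Matrix (Fin n) (Fin n) ℂ) : Set _) := by
      rw [CStarAlgebra.span_unitary]
      trivial
    induction hB using Submodule.span_induction with
    | mem g hg => exact congrArg Subtype.val (Subgroup.mem_center_iff.1 hz ⟨g, hg⟩)
    | zero => simp
    | add x y _ _ hx hy => rw [add_mul, mul_add, hx, hy]
    | smul a x _ hx => rw [smul_mul_assoc, mul_smul_comm, hx]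
  obtain ⟨c, hc⟩ := mem_range_scalar_of_commute_single (M := z.1) fun i j _ => hall _
  refine ⟨c, hc.symm.trans ?_⟩
  rw [scalar_apply, ← smul_one_eq_diagonal]

/-- `U(n)` is generated by `SU(n)` and scalars. -/
theorem suToU_mem_center [NeZero n] {z : SU n} (hz : z ∈ Subgroup.center (SU n)) :
    suToU n z ∈ Subgroup.center (U n) := by
  rw [Subgroup.mem_center_iff]
  intro g
  obtain ⟨c, hc, s, rfl, -⟩ := exists_scalarU_mul_suToU g
  rw [mul_assoc, ← map_mul, Subgroup.mem_center_iff.1 hz s, map_mul,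
    ← mul_assoc, ← Subgroup.mem_center_iff.1 (scalarU_mem_center c hc), mul_assoc]

theorem mem_center_of_suToU_mem_center {z : SU n} (hz : suToU n z ∈ Subgroup.center (U n)) :
    z ∈ Subgroup.center (SU n) := by
  rw [Subgroup.mem_center_iff]
  intro g
  have h := congrArg Subtype.val (Subgroup.mem_center_iff.1 hz (suToU n g))
  exact Subtype.ext h

/-- The centre of `SU(n)` consists of the scalar matrices of order `n`. -/
theorem mem_center_su_iff [NeZero n] {z : SU n} : z ∈ Subgroup.center (SU n) ↔
    ∃ c : ℂ, c ^ n = 1 ∧ z.1 = c • (1 : Matrix (Fin n) (Fin n) ℂ) := by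
  constructor
  · intro hz
    obtain ⟨c, hc⟩ := exists_eq_smul_one_of_mem_center (suToU_mem_center hz)
    have hc' : z.1 = c • (1 : Matrix (Fin n) (Fin n) ℂ) := hc
    refine ⟨c, ?_, hc'⟩
    have h := (mem_specialUnitaryGroup_iff.1 z.2).2
    rw [hc', det_smul] at h
    simpa using h
  · rintro ⟨c, -, hc⟩
    rw [Subgroup.mem_center_iff]
    intro g
    refine Subtype.ext ?_
    change g.1 * z.1 = z.1 * g.1
    simp [hc]

theorem suToSL_mem_center_iff [NeZero n] {z : SU n} :
    suToSL n z ∈ Subgroup.center (SL n) ↔ z ∈ Subgroup.center (SU n) := by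
  rw [mem_center_su_iff, Matrix.SpecialLinearGroup.mem_center_iff]
  simp only [Fintype.card_fin, scalar_apply, ← smul_one_eq_diagonal]
  exact exists_congr fun c => and_congr_right fun _ => eq_comm

/-- Roots of unity have norm one, so the central scalar matrices of `SL_n` are already unitary. -/
theorem exists_suToSL_of_mem_center [NeZero n] {z : SL n} (hz : z ∈ Subgroup.center (SL n)) :
    ∃ w ∈ Subgroup.center (SU n), suToSL n w = z := by
  obtain ⟨c, hc, h⟩ := Matrix.SpecialLinearGroup.mem_center_iff.1 hz
  rw [Fintype.card_fin] at hc
  rw [scalar_apply, ← smul_one_eq_diagonal] at h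
  have hU : z.1 ∈ unitaryGroup (Fin n) ℂ := by
    rw [← h]
    exact smul_mem_unitaryGroup (Complex.norm_eq_one_of_pow_eq_one hc (NeZero.ne n)) (one_mem _)
  let w : SU n := ⟨z.1, mem_specialUnitaryGroup_iff.2 ⟨hU, z.2⟩⟩
  exact ⟨w, suToSL_mem_center_iff.1 hz, rfl⟩

instance [NeZero n] : Finite (Subgroup.center (SU n)) := by
  choose c hc hc' using fun z : Subgroup.center (SU n) => mem_center_su_iff.1 z.2
  refine Finite.of_injective (β := rootsOfUnity n ℂ)
    (fun z => rootsOfUnity.mkOfPowEq (c z) (hc z)) fun z w h => ?_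
  have h1 : c z = c w := by
    have := congrArg (fun u : rootsOfUnity n ℂ => ((u : ℂˣ) : ℂ)) h
    simpa using this
  exact Subtype.ext (Subtype.ext (by rw [hc', hc', h1]))

instance [NeZero n] : Finite (Subgroup.center (SL n)) := by
  choose w hw hw' using fun z : Subgroup.center (SL n) => exists_suToSL_of_mem_center z.2
  refine Finite.of_injective (β := Subgroup.center (SU n)) (fun z => ⟨w z, hw z⟩) fun z z' h => ?_
  have h1 : w z = w z' := congrArg Subtype.val h
  exact Subtype.ext (by rw [← hw', ← hw', h1])

end Groups

/-! ### Regular functions as restrictions of polynomial functions -/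

section Restriction

variable {k : Type} [RCLike k]

theorem comp_linearMap_mem_polyFunctions {V W : Type} [AddCommGroup V] [Module k V]
    [AddCommGroup W] [Module k W] (L : W →ₗ[k] V) {F : V → k} (hF : F ∈ polyFunctions k V) :
    F ∘ L ∈ polyFunctions k W := by
  suffices h : polyFunctions k V ≤ (polyFunctions k W).comap (pullback k L) from h hF
  refine Algebra.adjoin_le ?_
  rintro _ ⟨l, rfl⟩
  exact dual_mem_polyFunctions (l.comp L)

theorem map_polyFunctions_le {X W : Type} [AddCommGroup W] [Module k W] (i : X → W)
    {A : Subalgebra k (X → k)} (h : ∀ l : Module.Dual k W, (fun x => l (i x)) ∈ A) :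
    (polyFunctions k W).map (pullback k i) ≤ A := by
  rw [Subalgebra.map_le]
  refine Algebra.adjoin_le ?_
  rintro _ ⟨l, rfl⟩
  exact h l

variable {r : ℕ} {G : Type} [Group G] [FunctionSpace k G] {V : Type} [AddCommGroup V] [Module k V]

/-- If the regular functions on `G` are the restrictions of the polynomial functions on `V`, then
the regular functions on `R_r(G)` are the restrictions of the polynomial functions on `V^r`. -/
theorem regular_rep_eq_map {j : G → V}
    (hj : regular k G = (polyFunctions k V).map (pullback k j)) :
    regular k (Rep r G) = (polyFunctions k (Fin r → V)).map
      (pullback k fun (ρ : Rep r G) i => j (ρ.gen i)) := by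
  classical
  refine le_antisymm (Algebra.adjoin_le ?_) (map_polyFunctions_le _ fun l => ?_)
  · rintro _ ⟨i, f, hf, rfl⟩
    rw [hj] at hf
    obtain ⟨F, hF, rfl⟩ := hf
    exact ⟨F ∘ LinearMap.proj (R := k) i, comp_linearMap_mem_polyFunctions _ hF, rfl⟩
  · have : (fun ρ : Rep r G => l fun i => j (ρ.gen i)) =
        ∑ i, fun ρ : Rep r G => (l.comp (LinearMap.single k (fun _ => V) i)) (j (ρ.gen i)) := by
      funext ρ
      rw [Finset.sum_apply]
      conv_lhs => rw [← LinearMap.sum_single_apply (fun _ => V) (fun i => j (ρ.gen i)), map_sum]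
      rfl
    rw [this]
    refine sum_mem fun i _ => comp_gen_mem_regular
      (f := fun g => (l.comp (LinearMap.single k (fun _ => V) i)) (j g)) ?_ i
    rw [hj]
    exact ⟨_, dual_mem_polyFunctions (l.comp (LinearMap.single k (fun _ => V) i)), rfl⟩

theorem regular_sl_eq_map (n : ℕ) : regular ℂ (SL n) =
    (polyFunctions ℂ (Matrix (Fin n) (Fin n) ℂ)).map (pullback ℂ fun A : SL n => A.1) := by
  refine le_antisymm (Algebra.adjoin_le ?_) (map_polyFunctions_le _ fun l => ?_)
  · rintro _ ⟨i, j, rfl⟩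
    exact ⟨_, dual_mem_polyFunctions (Matrix.entryLinearMap ℂ ℂ i j), rfl⟩
  · have : (fun A : SL n => l A.1) =
        ∑ i, ∑ j, l (Matrix.single i j 1) • fun A : SL n => A.1 i j := by
      funext A
      conv_lhs => rw [Matrix.matrix_eq_sum_single A.1, map_sum]
      rw [Finset.sum_apply]
      refine Finset.sum_congr rfl fun i _ => ?_
      rw [map_sum, Finset.sum_apply]
      refine Finset.sum_congr rfl fun j _ => ?_
      rw [Pi.smul_apply, smul_eq_mul, mul_comm, ← smul_eq_mul, ← map_smul, Matrix.smul_single,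
        smul_eq_mul, mul_one]
    rw [this]
    have hg : ∀ i j, (fun A : SL n => A.1 i j) ∈ regular ℂ (SL n) := fun i j =>
      Algebra.subset_adjoin (R := ℂ) (s := {f | ∃ i j, f = fun A : SL n => A.1 i j}) ⟨i, j, rfl⟩
    exact sum_mem fun i _ => sum_mem fun j _ => Subalgebra.smul_mem _ (hg i j) _

/-- The map `e` is arbitrary so that the result serves `SU(n)`, `U(n)` and the space of all
matrices. -/
theorem adjoin_re_im_eq_map {X : Type} {n : ℕ} (e : X → Matrix (Fin n) (Fin n) ℂ) :
    Algebra.adjoin ℝ ({f | ∃ i j, f = fun A => (e A i j).re} ∪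
      {f | ∃ i j, f = fun A => (e A i j).im}) =
    (polyFunctions ℝ (Matrix (Fin n) (Fin n) ℂ)).map (pullback ℝ e) := by
  refine le_antisymm (Algebra.adjoin_le ?_) (map_polyFunctions_le _ fun l => ?_)
  · rintro _ (⟨i, j, rfl⟩ | ⟨i, j, rfl⟩)
    · exact ⟨_, dual_mem_polyFunctions (Complex.reLm.comp (Matrix.entryLinearMap ℝ ℂ i j)), rfl⟩
    · exact ⟨_, dual_mem_polyFunctions (Complex.imLm.comp (Matrix.entryLinearMap ℝ ℂ i j)), rfl⟩
  · have : (fun A : X => l (e A)) =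
        ∑ i, ∑ j, (l (Matrix.single i j 1) • (fun A : X => (e A i j).re) +
          l (Matrix.single i j Complex.I) • fun A : X => (e A i j).im) := by
      funext A
      conv_lhs => rw [Matrix.matrix_eq_sum_single (e A), map_sum]
      rw [Finset.sum_apply]
      refine Finset.sum_congr rfl fun i _ => ?_
      rw [map_sum, Finset.sum_apply]
      refine Finset.sum_congr rfl fun j _ => ?_
      have h : Matrix.single i j (e A i j) = (e A i j).re • Matrix.single i j (1 : ℂ) +
          (e A i j).im • Matrix.single i j Complex.I := by
        rw [Matrix.smul_single, Matrix.smul_single, ← Matrix.single_add]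
        congr 1
        simp only [Complex.real_smul, mul_one]
        exact (Complex.re_add_im _).symm
      rw [h, map_add, map_smul, map_smul]
      simp [mul_comm]
    rw [this]
    refine sum_mem fun i _ => sum_mem fun j _ => add_mem
      (Subalgebra.smul_mem _ (Algebra.subset_adjoin ?_) _)
      (Subalgebra.smul_mem _ (Algebra.subset_adjoin ?_) _)
    exacts [Or.inl ⟨i, j, rfl⟩, Or.inr ⟨i, j, rfl⟩]

theorem regular_su_eq_map (n : ℕ) : regular ℝ (SU n) =
    (polyFunctions ℝ (Matrix (Fin n) (Fin n) ℂ)).map (pullback ℝ fun A : SU n => A.1) :=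
  adjoin_re_im_eq_map _

theorem regular_u_eq_map (n : ℕ) : regular ℝ (U n) =
    (polyFunctions ℝ (Matrix (Fin n) (Fin n) ℂ)).map (pullback ℝ fun A : U n => A.1) :=
  adjoin_re_im_eq_map _

end Restriction

/-! ### The compact linear action on tuples of matrices -/

section Conjugation

variable (k : Type) [RCLike k] [NormedAlgebra k ℂ] (n r : ℕ)

/-- The representation of `SU(n) × Z(SU(n))^r` on `r`-tuples of matrices by conjugation and
multiplication. -/
def conjRep : Representation k (SU n × (Fin r → Subgroup.center (SU n)))
    (Fin r → Matrix (Fin n) (Fin n) ℂ) where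
  toFun g := LinearMap.pi fun i => (LinearMap.mulLeft k (((g.2 i : SU n) * g.1 : SU n).1)).comp
    ((LinearMap.mulRight k (g.1⁻¹ : SU n).1).comp (LinearMap.proj i))
  map_one' := by
    refine LinearMap.ext fun w => funext fun i => ?_
    change ((1 : SU n) * 1 : SU n).1 * (w i * ((1 : SU n)⁻¹ : SU n).1) = w i
    rw [mul_one, inv_one]
    change 1 * (w i * 1) = w i
    simp
  map_mul' g h := by
    refine LinearMap.ext fun w => funext fun i => ?_
    have h1 : (((g.2 i : SU n) * h.2 i) * (g.1 * h.1) : SU n) =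
        ((g.2 i : SU n) * g.1) * ((h.2 i : SU n) * h.1) := by
      have := Subgroup.mem_center_iff.1 (h.2 i).2 g.1
      rw [mul_assoc, ← mul_assoc (h.2 i : SU n), ← this]
      group
    have h2 : ((g.1 * h.1)⁻¹ : SU n) = h.1⁻¹ * g.1⁻¹ := mul_inv_rev _ _
    change (((g.2 i : SU n) * h.2 i) * (g.1 * h.1) : SU n).1 * (w i * ((g.1 * h.1)⁻¹ : SU n).1) =
      ((g.2 i : SU n) * g.1 : SU n).1 * ((((h.2 i : SU n) * h.1 : SU n).1 *
        (w i * (h.1⁻¹ : SU n).1)) * (g.1⁻¹ : SU n).1)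
    rw [h1, h2]
    change (((g.2 i : SU n) * g.1 : SU n).1 * ((h.2 i : SU n) * h.1 : SU n).1) *
      (w i * ((h.1⁻¹ : SU n).1 * (g.1⁻¹ : SU n).1)) = _
    simp only [mul_assoc]

theorem conjRep_apply (g : SU n × (Fin r → Subgroup.center (SU n)))
    (w : Fin r → Matrix (Fin n) (Fin n) ℂ) (i : Fin r) : conjRep k n r g w i =
      (g.2 i : SU n).1 * (g.1.1 * w i * (g.1⁻¹ : SU n).1) := by
  change ((g.2 i : SU n).1 * g.1.1) * (w i * (g.1⁻¹ : SU n).1) = _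
  simp only [mul_assoc]

theorem continuous_conjRep (w : Fin r → Matrix (Fin n) (Fin n) ℂ) :
    Continuous fun g => conjRep k n r g w := by
  refine continuous_pi fun i => ?_
  change Continuous fun g : SU n × (Fin r → Subgroup.center (SU n)) =>
    ((g.2 i : SU n) * g.1 : SU n).1 * (w i * (g.1⁻¹ : SU n).1)
  refine Continuous.matrix_mul (continuous_subtype_val.comp ?_)
    (continuous_const.matrix_mul (continuous_subtype_val.comp continuous_fst.inv))
  exact (continuous_subtype_val.comp ((continuous_apply i).comp continuous_snd)).mul continuous_fst

theorem continuous_dual_conjRep [FiniteDimensional k ℂ]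
    (l : Module.Dual k (Fin r → Matrix (Fin n) (Fin n) ℂ))
    (w : Fin r → Matrix (Fin n) (Fin n) ℂ) : Continuous fun g => l (conjRep k n r g w) :=
  l.continuous_of_finiteDimensional.comp (continuous_conjRep k n r w)

end Conjugation

/-! ### Functions invariant under `SU(n)` are invariant under `SL_n` -/

section Density

open Matrix

variable {n r : ℕ}

/-- The holomorphic one-parameter subgroup `s ↦ V exp(s a) V*` of `SL_n`, for a real diagonal matrix
`a` with trace zero. -/
def expPath (V : U n) (a : Fin n → ℝ) (ha : ∑ j, a j = 0) (s : ℂ) : SL n :=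
  ⟨V.1 * diagonal (fun j => Complex.exp (s * a j)) * star V.1, by
    rw [det_mul, det_mul, mul_right_comm, ← det_mul, mem_unitaryGroup_iff.1 V.2, det_one, one_mul,
      det_diagonal, ← Complex.exp_sum, ← Finset.mul_sum, ← Complex.ofReal_sum, ha]
    simp⟩

variable {V : U n} {a : Fin n → ℝ} {ha : ∑ j, a j = 0}

theorem coe_expPath (s : ℂ) : (expPath V a ha s).1 =
    V.1 * diagonal (fun j => Complex.exp (s * a j)) * star V.1 := rfl

theorem expPath_mul (s t : ℂ) : expPath V a ha s * expPath V a ha t = expPath V a ha (s + t) := by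
  refine Subtype.ext ?_
  change (expPath V a ha s).1 * (expPath V a ha t).1 = _
  rw [coe_expPath, coe_expPath, coe_expPath]
  have h : (fun j => Complex.exp ((s + t) * a j)) =
      fun j => Complex.exp (s * a j) * Complex.exp (t * a j) := by
    funext j
    rw [add_mul, Complex.exp_add]
  rw [h, ← diagonal_mul_diagonal]
  simp only [Matrix.mul_assoc]
  rw [← Matrix.mul_assoc (star V.1) V.1, mem_unitaryGroup_iff'.1 V.2, Matrix.one_mul]

theorem expPath_zero : expPath V a ha 0 = 1 := by
  refine Subtype.ext ?_
  rw [coe_expPath]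
  simp

theorem expPath_neg (s : ℂ) : (expPath V a ha s)⁻¹ = expPath V a ha (-s) :=
  inv_eq_of_mul_eq_one_right (by rw [expPath_mul, add_neg_cancel, expPath_zero])

theorem star_expPath (s : ℂ) : star (expPath V a ha s).1 = (expPath V a ha (star s)).1 := by
  rw [coe_expPath, coe_expPath, star_mul, star_mul, star_star, Matrix.mul_assoc, star_eq_conjTranspose (diagonal _),
    diagonal_conjTranspose]
  congr 3
  funext j
  simp [← Complex.exp_conj]

/-- For an imaginary parameter, taking the adjoint reverses the sign of the exponent. -/
theorem expPath_mem_su (t : ℝ) :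
    (expPath V a ha (t * Complex.I)).1 ∈ specialUnitaryGroup (Fin n) ℂ := by
  refine mem_specialUnitaryGroup_iff.2 ⟨mem_unitaryGroup_iff.2 ?_, (expPath V a ha _).2⟩
  rw [star_expPath]
  have h : star ((t : ℂ) * Complex.I) = -(t * Complex.I) := by simp
  rw [h, ← expPath_neg]
  exact congrArg Subtype.val (mul_inv_cancel (expPath V a ha (t * Complex.I)))

theorem differentiable_expPath (i j : Fin n) :
    Differentiable ℂ fun s => (expPath V a ha s).1 i j := by
  have : (fun s => (expPath V a ha s).1 i j) =
      fun s => ∑ l, V.1 i l * Complex.exp (s * a l) * star V.1 l j := by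
    funext s
    rw [coe_expPath, Matrix.mul_apply]
    exact Finset.sum_congr rfl fun l _ => by rw [mul_diagonal]
  rw [this]
  fun_prop

/-- A regular function on `R_r(SL_n)` is holomorphic on holomorphic curves. -/
theorem differentiable_regular_comp {σ : ℂ → Rep r (SL n)}
    (hσ : ∀ l i j, Differentiable ℂ fun s => ((σ s).gen l).1 i j) {φ : Rep r (SL n) → ℂ}
    (hφ : φ ∈ regular ℂ (Rep r (SL n))) : Differentiable ℂ fun s => φ (σ s) := by
  rw [regular_rep_eq_adjoin] at hφ
  induction hφ using Algebra.adjoin_induction with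
  | mem F hF =>
    obtain ⟨l, f, hf, rfl⟩ := hF
    change f ∈ Algebra.adjoin ℂ _ at hf
    induction hf using Algebra.adjoin_induction with
    | mem f hf =>
      obtain ⟨i, j, rfl⟩ := hf
      exact hσ l i j
    | algebraMap c => exact differentiable_const _
    | add f g _ _ hf hg => exact hf.add hg
    | mul f g _ _ hf hg => exact hf.mul hg
  | algebraMap c => exact differentiable_const _
  | add f g _ _ hf hg => exact hf.add hg
  | mul f g _ _ hf hg => exact hf.mul hg

open scoped ComplexOrder in
/-- The polar decomposition in `SL_n`. -/
theorem exists_polar (A : SL n) : ∃ (B : SU n) (V : U n) (a : Fin n → ℝ) (ha : ∑ j, a j = 0),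
    A = suToSL n B * expPath V a ha 1 := by
  have hpos : (A.1ᴴ * A.1).PosDef := by
    refine PosDef.conjTranspose_mul_self _ ?_
    rw [mulVec_injective_iff_isUnit, isUnit_iff_isUnit_det, A.2]
    exact isUnit_one
  have hev := hpos.eigenvalues_pos
  set d := hpos.isHermitian.eigenvalues with hd
  set V : U n := hpos.isHermitian.eigenvectorUnitary with hV
  have hprod : ∏ j, d j = 1 := by
    have h := hpos.isHermitian.det_eq_prod_eigenvalues
    rw [det_mul, det_conjTranspose, A.2] at h
    simp only [star_one, mul_one] at h
    have h' : ((∏ j, d j : ℝ) : ℂ) = 1 := by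
      rw [Complex.ofReal_prod]
      exact h.symm
    exact_mod_cast h'
  -- Half the logarithms of the eigenvalues of `A* A` make `P 2 = A* A`, so `P 1` is its positive
  -- square root and `A * P (-1)` is unitary.
  have ha : ∑ j, Real.log (d j) / 2 = 0 := by
    rw [← Finset.sum_div, ← Real.log_prod fun j _ => (hev j).ne', hprod]
    simp
  set P := expPath V (fun j => Real.log (d j) / 2) ha with hP
  have hPP : (P 2).1 = A.1ᴴ * A.1 := by
    rw [hpos.isHermitian.spectral_theorem, Unitary.conjStarAlgAut_apply]
    rw [hP, coe_expPath]
    congr 3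
    funext j
    have : (2 : ℂ) * ((Real.log (d j) / 2 : ℝ) : ℂ) = ((Real.log (d j) : ℝ) : ℂ) := by
      push_cast
      ring
    rw [this, ← Complex.ofReal_exp, Real.exp_log (hev j)]
    rfl
  have hB : (A * P (-1)).1 ∈ specialUnitaryGroup (Fin n) ℂ := by
    refine mem_specialUnitaryGroup_iff.2 ⟨mem_unitaryGroup_iff'.2 ?_, (A * P (-1)).2⟩
    change star (A.1 * (P (-1)).1) * (A.1 * (P (-1)).1) = 1
    rw [star_mul, star_expPath]
    have h1 : star (-1 : ℂ) = -1 := by simp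
    rw [h1, Matrix.mul_assoc, ← Matrix.mul_assoc (star A.1)]
    change (P (-1)).1 * ((A.1ᴴ * A.1) * (P (-1)).1) = 1
    rw [← hPP]
    change (P (-1) * (P 2 * P (-1))).1 = 1
    rw [hP, expPath_mul, expPath_mul]
    norm_num
    rw [expPath_zero]
    rfl
  refine ⟨⟨_, hB⟩, V, _, ha, ?_⟩
  have h2 : suToSL n ⟨_, hB⟩ = A * P (-1) := rfl
  rw [h2, mul_assoc, hP, expPath_mul, neg_add_cancel, expPath_zero, mul_one]

/-- Regular functions on `R_r(SL_n)` that are invariant under `SU(n)` are invariant under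
`SL_n`. -/
theorem invariant_of_su_invariant {φ : Rep r (SL n) → ℂ} (hφ : φ ∈ regular ℂ (Rep r (SL n)))
    (hinv : ∀ (g : SU n) ρ, φ (suToSL n g • ρ) = φ ρ) (g : SL n) (ρ : Rep r (SL n)) :
    φ (g • ρ) = φ ρ := by
  obtain ⟨B, V, a, ha, rfl⟩ := exists_polar g
  rw [mul_smul, hinv]
  have hd : Differentiable ℂ fun s => φ (expPath V a ha s • ρ) := by
    refine differentiable_regular_comp (fun l i j => ?_) hφ
    simp only [Rep.gen_conj, expPath_neg]
    have : ∀ s : ℂ, (expPath V a ha s * ρ.gen l * expPath V a ha (-s)).1 i j =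
        ∑ p, (∑ q, (expPath V a ha s).1 i q * (ρ.gen l).1 q p) * (expPath V a ha (-s)).1 p j := by
      intro s
      change (((expPath V a ha s).1 * (ρ.gen l).1) * (expPath V a ha (-s)).1) i j = _
      simp only [Matrix.mul_apply]
    simp_rw [this]
    refine Differentiable.fun_sum fun p _ => Differentiable.mul (Differentiable.fun_sum fun q _ =>
      (differentiable_expPath i q).mul (differentiable_const _)) ?_
    exact (differentiable_expPath p j).comp differentiable_neg
  -- The function is entire and constant on the imaginary axis, where the path lies in `SU(n)`; the
  -- identity theorem gives its value at `s = 1`.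
  have hconst : (fun s => φ (expPath V a ha s • ρ)) = fun _ => φ ρ := by
    refine AnalyticOnNhd.eq_of_frequently_eq (𝕜 := ℂ) (z₀ := 0)
      (fun s _ => hd.analyticAt s) (fun s _ => analyticAt_const) ?_
    have ht : Filter.Tendsto (fun t : ℝ => (t : ℂ) * Complex.I) (nhdsWithin 0 {0}ᶜ)
        (nhdsWithin 0 {0}ᶜ) := by
      refine tendsto_nhdsWithin_iff.2 ⟨?_, ?_⟩
      · have : Continuous fun t : ℝ => (t : ℂ) * Complex.I := by fun_prop
        have h := this.tendsto 0
        simp only [Complex.ofReal_zero, zero_mul] at h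
        exact h.mono_left nhdsWithin_le_nhds
      · filter_upwards [self_mem_nhdsWithin] with t ht
        simpa using ht
    refine ht.frequently (Filter.Eventually.of_forall fun t => ?_).frequently
    exact hinv ⟨_, expPath_mem_su (V := V) (a := a) (ha := ha) t⟩ ρ
  exact congrFun hconst 1

end Density

/-! ### The character varieties of `SL_n` and `PSL_n` -/

section SLVariety

variable {n r : ℕ}

theorem mem_regular_rep_sl_iff {φ : Rep r (SL n) → ℂ} : φ ∈ regular ℂ (Rep r (SL n)) ↔
    ∃ F ∈ polyFunctions ℂ (Fin r → Matrix (Fin n) (Fin n) ℂ),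
      (F ∘ fun (ρ : Rep r (SL n)) i => (ρ.gen i).1) = φ := by
  rw [regular_rep_eq_map (regular_sl_eq_map n)]
  rfl

/-- The unitary trick replaces `SL_n` by the compact group `SU(n)`, over which one can average. -/
theorem invariants_sl_fg : (invariants ℂ (SL n) (Rep r (SL n))).FG := by
  refine fg_of_mem_iff ((conjRep ℂ n r).comp (MonoidHom.inl (SU n) _))
    (fun l w => (continuous_dual_conjRep ℂ n r l w).comp (continuous_id.prodMk continuous_const))
    (fun (ρ : Rep r (SL n)) i => (ρ.gen i).1) (fun g ρ => suToSL n g • ρ) (fun g ρ => ?_) _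
    fun φ => ?_
  · funext i
    rw [Rep.gen_conj, ← map_inv]
    refine Eq.trans ?_ (conjRep_apply ℂ n r (g, 1) _ i).symm
    exact (Matrix.one_mul _).symm
  · rw [← mem_regular_rep_sl_iff]
    exact ⟨fun h => ⟨h.1, fun g => h.2 _⟩, fun h => ⟨h.1, invariant_of_su_invariant h.1 h.2⟩⟩

/-- Central elements of `SU(n)` as central elements of `SL_n`. -/
def centerSUToSL [NeZero n] (z : Fin r → Subgroup.center (SU n)) :
    Fin r → Subgroup.center (SL n) :=
  fun i => ⟨suToSL n (z i), suToSL_mem_center_iff.2 (z i).2⟩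

/-- The same trick with `SU(n) × Z(SU(n))^r`, as the centres of `SU(n)` and `SL_n` coincide. -/
theorem biinvariants_sl_fg [NeZero n] : (invariants ℂ (SL n) (Rep r (SL n)) ⊓
    invariants ℂ (Fin r → Subgroup.center (SL n)) (Rep r (SL n)) :
      Subalgebra ℂ (Rep r (SL n) → ℂ)).FG := by
  refine fg_of_mem_iff (conjRep ℂ n r) (continuous_dual_conjRep ℂ n r)
    (fun (ρ : Rep r (SL n)) i => (ρ.gen i).1)
    (fun g ρ => centerSUToSL g.2 • suToSL n g.1 • ρ) (fun g ρ => ?_) _ fun φ => ?_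
  · funext i
    rw [Rep.gen_central, Rep.gen_conj, ← map_inv, conjRep_apply]
    rfl
  · rw [← mem_regular_rep_sl_iff]
    refine ⟨fun h => ⟨h.1.1, fun g ρ => by rw [h.2.2, h.1.2]⟩, fun h =>
      ⟨⟨h.1, invariant_of_su_invariant h.1 fun g ρ => ?_⟩, h.1, fun z ρ => ?_⟩⟩
    · have h1 : centerSUToSL (1 : Fin r → Subgroup.center (SU n)) = 1 := rfl
      have h2 := h.2 (g, 1) ρ
      rwa [h1, one_smul] at h2
    · choose w hw hw' using fun i => exists_suToSL_of_mem_center (z i).2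
      have h1 : centerSUToSL (fun i => ⟨w i, hw i⟩) = z :=
        funext fun i => Subtype.ext (hw' i)
      have h2 := h.2 (1, fun i => ⟨w i, hw i⟩) ρ
      rwa [h1, map_one, one_smul] at h2

theorem slToPSL_surjective : Function.Surjective (slToPSL n) := QuotientGroup.mk'_surjective _

theorem slToPSL_center (z : Subgroup.center (SL n)) : slToPSL n z = 1 :=
  (QuotientGroup.eq_one_iff _).2 z.2

/-- Regularity on `PSL_n` is defined by pull-back, so it is enough to descend `f` as a function. -/
theorem exists_regular_psl {f : SL n → ℂ} (hf : f ∈ regular ℂ (SL n))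
    (hz : ∀ (z : Subgroup.center (SL n)) g, f ((z : SL n) * g) = f g) :
    ∃ f' ∈ regular ℂ (Proj (SL n)), f' ∘ slToPSL n = f := by
  let f' : Proj (SL n) → ℂ := Quotient.lift f fun a b hab => by
    have hab := QuotientGroup.leftRel_apply.1 hab
    have h := hz ⟨_, hab⟩ a
    rw [← Subgroup.mem_center_iff.1 hab a] at h
    rw [← h, mul_inv_cancel_left]
  have h : f' ∘ slToPSL n = f := rfl
  exact ⟨f', hf, h⟩

/-- The invariants of `PSL_n` on `R_r(PSL_n)` are the functions on `R_r(SL_n)` that are invariant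
under `SL_n` and under the action of the centre. -/
def invariantsPSLEquiv [NeZero n] : invariants ℂ (Proj (SL n)) (Rep r (Proj (SL n))) ≃ₐ[ℂ]
    (invariants ℂ (SL n) (Rep r (SL n)) ⊓
      invariants ℂ (Fin r → Subgroup.center (SL n)) (Rep r (SL n)) :
      Subalgebra ℂ (Rep r (SL n) → ℂ)) :=
  invariantsRepEquiv slToPSL_surjective slToPSL_center (fun _ hf => hf) fun _ hφ hinv =>
    exists_regular_descend (fun z _ hf => SL.translate_mem (z : SL n) hf)
      (fun _ hf hz => exists_regular_psl hf hz) hφ hinv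

theorem fg_of_algEquiv {k X Y : Type} [Field k] {A : Subalgebra k (X → k)}
    {B : Subalgebra k (Y → k)} (e : A ≃ₐ[k] B) (h : B.FG) : A.FG := by
  rw [Subalgebra.fg_iff_finiteType] at h ⊢
  exact h.equiv e.symm

/-- `X_r(PSL_n)` is the quotient of `X_r(SL_n)` by the central action, as an affine variety. -/
theorem isAffineVariety_and_exists_iso_psl [NeZero n] :
    IsAffineVariety ℂ (XC r (Proj (SL n))) ∧
      IsAffineVariety ℂ (GITQuotient ℂ (Fin r → Subgroup.center (SL n)) (XC r (SL n))) ∧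
      ∃ Φ : VarietyIso ℂ (GITQuotient ℂ (Fin r → Subgroup.center (SL n)) (XC r (SL n)))
          (XC r (Proj (SL n))),
        ∀ ρ : Rep r (SL n), Φ.toEquiv (gitProj ℂ (Fin r → Subgroup.center (SL n))
            (gitProj ℂ (SL n) ρ)) = gitProj ℂ (Proj (SL n)) (Rep.comp (slToPSL n) ρ) := by
  let e₁ := invariantsPSLEquiv (n := n) (r := r)
  let e₂ := invariantsGITQuotientEquiv (Fin r → Subgroup.center (SL n))
    (invariants_sl_fg (n := n) (r := r))
  refine ⟨isAffineVariety_gitQuotient (fg_of_algEquiv e₁ biinvariants_sl_fg),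
    isAffineVariety_gitQuotient (fg_of_algEquiv e₂ biinvariants_sl_fg),
    gitQuotientIso (e₂.trans e₁.symm), fun ρ => gitQuotientIso_gitProj _ fun b => ?_⟩
  -- Both algebras are realised by functions on `R_r(SL_n)`; the two points correspond because both
  -- evaluations are evaluation at `ρ`.
  have h : e₁ ((e₂.trans e₁.symm) b) = e₂ b := e₁.apply_symm_apply _
  exact congrFun (congrArg Subtype.val h) ρ

end SLVariety

/-! ### Real polynomial functions on `U(n)` and `SU(n)` -/

section Complexify

variable {X : Type}

/-- The complex-valued functions with real and imaginary part in a given algebra. -/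
def complexify (A : Subalgebra ℝ (X → ℝ)) : Subalgebra ℂ (X → ℂ) where
  carrier := {h | (fun x => (h x).re) ∈ A ∧ (fun x => (h x).im) ∈ A}
  mul_mem' ha hb :=
    ⟨A.sub_mem (A.mul_mem ha.1 hb.1) (A.mul_mem ha.2 hb.2),
      A.add_mem (A.mul_mem ha.1 hb.2) (A.mul_mem ha.2 hb.1)⟩
  add_mem' ha hb :=
    ⟨A.add_mem ha.1 hb.1, A.add_mem ha.2 hb.2⟩
  algebraMap_mem' c := ⟨A.algebraMap_mem c.re, A.algebraMap_mem c.im⟩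

theorem star_mem_complexify {A : Subalgebra ℝ (X → ℝ)} {h : X → ℂ} (hh : h ∈ complexify A) :
    (fun x => star (h x)) ∈ complexify A :=
  ⟨hh.1, A.neg_mem hh.2⟩

theorem det_mem_of_entry_mem {n : ℕ} {B : Subalgebra ℂ (X → ℂ)}
    {e : X → Matrix (Fin n) (Fin n) ℂ} (h : ∀ i j, (fun x => e x i j) ∈ B) :
    (fun x => (e x).det) ∈ B := by
  have : (fun x => (e x).det) = ∑ σ : Equiv.Perm (Fin n), ((Equiv.Perm.sign σ : ℤ) : ℂ) •
      ∏ i, fun x => e x (σ i) i := by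
    funext x
    rw [Matrix.det_apply', Finset.sum_apply]
    refine Finset.sum_congr rfl fun σ _ => ?_
    rw [Pi.smul_apply, Finset.prod_apply]
    rfl
  rw [this]
  exact sum_mem fun σ _ => B.smul_mem (prod_mem fun i _ => h _ _) _

end Complexify

/-! ### Weights under scalars and descent to `PU(n)` -/

section Weights

open Matrix

variable {n : ℕ}

variable (n) in
/-- The complex-valued real polynomial functions of a complex matrix: the polynomials in the entries
and their conjugates. -/
def conjPolyFunctions : Subalgebra ℂ (Matrix (Fin n) (Fin n) ℂ → ℂ) :=
  Algebra.adjoin ℂ ({f | ∃ i j, f = fun A => A i j} ∪ {f | ∃ i j, f = fun A => star (A i j)})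

theorem entry_mem_conjPolyFunctions (i j : Fin n) : (fun A => A i j) ∈ conjPolyFunctions n :=
  Algebra.subset_adjoin (Or.inl ⟨i, j, rfl⟩)

theorem star_entry_mem_conjPolyFunctions (i j : Fin n) :
    (fun A => star (A i j)) ∈ conjPolyFunctions n :=
  Algebra.subset_adjoin (Or.inr ⟨i, j, rfl⟩)

theorem det_mem_conjPolyFunctions : (fun A => A.det) ∈ conjPolyFunctions n :=
  det_mem_of_entry_mem (e := id) entry_mem_conjPolyFunctions

theorem star_det_mem_conjPolyFunctions : (fun A => star A.det) ∈ conjPolyFunctions n := by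
  simp_rw [← det_conjTranspose]
  exact det_mem_of_entry_mem fun i j => star_entry_mem_conjPolyFunctions j i

/-- Real polynomials are treated inside the complex-valued ones because only there do they decompose
by weight; this is the way back. -/
theorem conjPolyFunctions_le_complexify :
    conjPolyFunctions n ≤ complexify (polyFunctions ℝ (Matrix (Fin n) (Fin n) ℂ)) := by
  have h : ∀ i j, (fun A : Matrix (Fin n) (Fin n) ℂ => A i j) ∈
      complexify (polyFunctions ℝ (Matrix (Fin n) (Fin n) ℂ)) := fun i j =>
    ⟨dual_mem_polyFunctions (Complex.reLm.comp (Matrix.entryLinearMap ℝ ℂ i j)),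
      dual_mem_polyFunctions (Complex.imLm.comp (Matrix.entryLinearMap ℝ ℂ i j))⟩
  refine Algebra.adjoin_le ?_
  rintro _ (⟨i, j, rfl⟩ | ⟨i, j, rfl⟩)
  exacts [h i j, star_mem_complexify (h i j)]

theorem ofReal_comp_mem_conjPolyFunctions {F : Matrix (Fin n) (Fin n) ℂ → ℝ}
    (hF : F ∈ polyFunctions ℝ (Matrix (Fin n) (Fin n) ℂ)) :
    (fun A => (F A : ℂ)) ∈ conjPolyFunctions n := by
  have h : (polyFunctions ℝ (Matrix (Fin n) (Fin n) ℂ)) =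
      Algebra.adjoin ℝ ({f | ∃ i j, f = fun A => (A i j).re} ∪
        {f | ∃ i j, f = fun A => (A i j).im}) := by
    rw [adjoin_re_im_eq_map fun A => A]
    ext f
    constructor
    · intro hf
      exact ⟨f, hf, rfl⟩
    · rintro ⟨f, hf, rfl⟩
      exact hf
  rw [h] at hF
  induction hF using Algebra.adjoin_induction with
  | mem f hf =>
    rcases hf with ⟨i, j, rfl⟩ | ⟨i, j, rfl⟩
    · have h2 := (conjPolyFunctions n).smul_mem (add_mem (entry_mem_conjPolyFunctions i j)
        (star_entry_mem_conjPolyFunctions i j)) (1 / 2 : ℂ)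
      convert h2 using 1
      funext A
      simp only [Complex.re_eq_add_conj, Pi.smul_apply, Pi.add_apply, smul_eq_mul,
        Complex.star_def]
      ring
    · have h2 := (conjPolyFunctions n).smul_mem (sub_mem (entry_mem_conjPolyFunctions i j)
        (star_entry_mem_conjPolyFunctions i j)) (1 / (2 * Complex.I) : ℂ)
      convert h2 using 1
      funext A
      simp only [Complex.im_eq_sub_conj, Pi.smul_apply, Pi.sub_apply, smul_eq_mul,
        Complex.star_def]
      ring
  | algebraMap c => exact Subalgebra.algebraMap_mem _ (c : ℂ)
  | add f g _ _ hf hg =>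
    convert add_mem hf hg using 1
    exact funext fun A => Complex.ofReal_add _ _
  | mul f g _ _ hf hg =>
    convert mul_mem hf hg using 1
    exact funext fun A => Complex.ofReal_mul _ _

theorem star_eq_inv_of_norm_eq_one {c : ℂ} (hc : ‖c‖ = 1) : star c = c⁻¹ := by
  rw [Complex.star_def, Complex.inv_def, Complex.normSq_eq_norm_sq, hc]
  simp

/-- Products of entries and conjugates of entries have a weight with respect to scalars of norm
one. -/
theorem exists_weight {m : Matrix (Fin n) (Fin n) ℂ → ℂ}
    (hm : m ∈ Submonoid.closure ({f | ∃ i j, f = fun A : Matrix (Fin n) (Fin n) ℂ => A i j} ∪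
      {f | ∃ i j, f = fun A => star (A i j)})) :
    ∃ w : ℤ, ∀ c : ℂ, ‖c‖ = 1 → ∀ A, m (c • A) = c ^ w * m A := by
  induction hm using Submonoid.closure_induction with
  | mem m h =>
    rcases h with ⟨i, j, rfl⟩ | ⟨i, j, rfl⟩
    · exact ⟨1, fun c _ A => by simp⟩
    · refine ⟨-1, fun c hc A => ?_⟩
      change star (c * A i j) = c ^ (-1 : ℤ) * star (A i j)
      rw [star_mul', star_eq_inv_of_norm_eq_one hc, _root_.zpow_neg_one]
  | one => exact ⟨0, fun c _ A => by simp⟩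
  | mul m m' _ _ h h' =>
    obtain ⟨w, hw⟩ := h
    obtain ⟨w', hw'⟩ := h'
    refine ⟨w + w', fun c hc A => ?_⟩
    have hc0 : c ≠ 0 := fun h => by simp [h] at hc
    rw [Pi.mul_apply, hw c hc, hw' c hc, zpow_add₀ hc0, Pi.mul_apply]
    ring

/-- Powers of the determinant and of its conjugate have any weight divisible by `n`. -/
theorem exists_det_weight (k : ℤ) : ∃ d ∈ conjPolyFunctions n, ∀ (s : SU n) (a : ℂ), ‖a‖ = 1 →
    d (a • s.1) = a ^ ((n : ℤ) * -k) := by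
  have hdet : ∀ (s : SU n) (a : ℂ), (a • s.1).det = a ^ n := fun s a => by
    rw [det_smul, Fintype.card_fin, (mem_specialUnitaryGroup_iff.1 s.2).2, mul_one]
  -- On `a • s` the determinant is `a ^ n`, and its conjugate is `a ^ (-n)` since `‖a‖ = 1`; the
  -- sign of `k` decides which one is used.
  rcases Int.eq_nat_or_neg k with ⟨l, rfl | rfl⟩
  · refine ⟨(fun A => star A.det) ^ l, pow_mem star_det_mem_conjPolyFunctions l, fun s a ha => ?_⟩
    rw [Pi.pow_apply, hdet, star_pow, star_eq_inv_of_norm_eq_one ha, _root_.zpow_mul, zpow_natCast,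
      _root_.zpow_neg, zpow_natCast, inv_pow, inv_pow]
  · refine ⟨(fun A => A.det) ^ l, pow_mem det_mem_conjPolyFunctions l, fun s a _ => ?_⟩
    rw [Pi.pow_apply, hdet, neg_neg, _root_.zpow_mul, zpow_natCast, zpow_natCast]

theorem suToPU_eq_mk (s : SU n) : suToPU n s = QuotientGroup.mk (suToU n s) := rfl

theorem comp_suToPU_mem_regular {f : Proj (U n) → ℝ} (hf : f ∈ regular ℝ (Proj (U n))) :
    f ∘ suToPU n ∈ regular ℝ (SU n) := by
  have hf' : (f ∘ QuotientGroup.mk : U n → ℝ) ∈ regular ℝ (U n) := hf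
  rw [regular_u_eq_map] at hf'
  obtain ⟨F, hF, h⟩ := hf'
  rw [regular_su_eq_map]
  exact ⟨F, hF, funext fun s => congrFun h (suToU n s)⟩

theorem translate_mem_regular_su (z : SU n) {f : SU n → ℝ} (hf : f ∈ regular ℝ (SU n)) :
    (fun g => f (z * g)) ∈ regular ℝ (SU n) := by
  rw [regular_su_eq_map] at hf ⊢
  obtain ⟨F, hF, rfl⟩ := hf
  exact ⟨F ∘ LinearMap.mulLeft ℝ z.1, comp_linearMap_mem_polyFunctions _ hF, rfl⟩

variable [NeZero n]

/-- The sum of the translates of a polynomial function by the centre of `SU(n)` extends to a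
polynomial function on `U(n)` that is invariant under scalars. -/
theorem exists_scalar_invariant_extension [Fintype (Subgroup.center (SU n))]
    {F : Matrix (Fin n) (Fin n) ℂ → ℂ} (hF : F ∈ conjPolyFunctions n) :
    ∃ F' ∈ conjPolyFunctions n, ∀ (s : SU n) (c : ℂ), ‖c‖ = 1 →
      F' (c • s.1) = ∑ z : Subgroup.center (SU n), F ((z : SU n) * s : SU n).1 := by
  have hF₀ := hF
  rw [conjPolyFunctions, ← Subalgebra.mem_toSubmodule, Algebra.adjoin_eq_span] at hF
  induction hF using Submodule.span_induction with
  | zero => exact ⟨0, zero_mem _, fun s c _ => by simp⟩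
  | add F G hF hG h h' =>
    rw [← Algebra.adjoin_eq_span] at hF hG
    obtain ⟨F', h1, h2⟩ := h hF
    obtain ⟨G', h1', h2'⟩ := h' hG
    exact ⟨F' + G', add_mem h1 h1', fun s c hc => by
      simp [h2 s c hc, h2' s c hc, Finset.sum_add_distrib]⟩
  | smul a F hF h =>
    rw [← Algebra.adjoin_eq_span] at hF
    obtain ⟨F', h1, h2⟩ := h hF
    exact ⟨a • F', Subalgebra.smul_mem _ h1 a, fun s c hc => by
      simp [h2 s c hc, Finset.mul_sum]⟩
  | mem m hm =>
    obtain ⟨w, hw⟩ := exists_weight hm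
    choose c hc hc' using fun z : Subgroup.center (SU n) => mem_center_su_iff.1 z.2
    have hn : ∀ z, ‖c z‖ = 1 := fun z => Complex.norm_eq_one_of_pow_eq_one (hc z) (NeZero.ne n)
    have hmul : ∀ (z : Subgroup.center (SU n)) (s : SU n),
        m ((z : SU n) * s : SU n).1 = c z ^ w * m s.1 := fun z s => by
      change m ((z : SU n).1 * s.1) = _
      rw [hc', smul_mul_assoc, Matrix.one_mul, hw _ (hn z)]
    -- The centre acts on `m` through the character `z ↦ c z ^ w`. If it is trivial, a primitive
    -- root of unity shows `n ∣ w`, and a determinant factor makes `m` scalar-invariant; if not, the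
    -- sum over the centre vanishes.
    by_cases hall : ∀ z, c z ^ w = 1
    · have hdvd : (n : ℤ) ∣ w := by
        have hp := Complex.isPrimitiveRoot_exp n (NeZero.ne n)
        set ζ := Complex.exp (2 * Real.pi * Complex.I / n)
        have hζ := hp.pow_eq_one
        have hU : ζ • (1 : Matrix (Fin n) (Fin n) ℂ) ∈ specialUnitaryGroup (Fin n) ℂ := by
          refine mem_specialUnitaryGroup_iff.2 ⟨smul_mem_unitaryGroup
            (Complex.norm_eq_one_of_pow_eq_one hζ (NeZero.ne n)) (one_mem _), ?_⟩
          rw [det_smul, Fintype.card_fin, hζ, det_one, one_mul]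
        let z : Subgroup.center (SU n) := ⟨⟨_, hU⟩, mem_center_su_iff.2 ⟨ζ, hζ, rfl⟩⟩
        have hz : c z = ζ := by
          have h := congrFun (congrFun (hc' z) 0) 0
          have h' : ζ * 1 = c z * 1 := by simpa [z] using h
          simpa using h'.symm
        rw [← hp.zpow_eq_one_iff_dvd, ← hz]
        exact hall z
      obtain ⟨k, rfl⟩ := hdvd
      have hsum : ∀ s : SU n, ∑ z : Subgroup.center (SU n), m ((z : SU n) * s : SU n).1 =
          (Fintype.card (Subgroup.center (SU n)) : ℂ) * m s.1 := fun s => by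
        simp only [hmul, hall, one_mul, Finset.sum_const, Finset.card_univ, nsmul_eq_mul]
      obtain ⟨d, hd, hd'⟩ := exists_det_weight (n := n) k
      refine ⟨(Fintype.card (Subgroup.center (SU n)) : ℂ) • (m * d),
        Subalgebra.smul_mem _ (mul_mem hF₀ hd) _, fun s a ha => ?_⟩
      have ha0 : a ≠ 0 := fun h => by simp [h] at ha
      rw [hsum]
      change (Fintype.card (Subgroup.center (SU n)) : ℂ) * (m (a • s.1) * d (a • s.1)) = _
      rw [hd' s a ha, hw a ha, mul_right_comm, ← zpow_add₀ ha0, mul_neg, add_neg_cancel, zpow_zero,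
        one_mul]
    · push Not at hall
      obtain ⟨z₀, hz₀⟩ := hall
      refine ⟨0, zero_mem _, fun s a _ => ?_⟩
      have h1 : ∑ z : Subgroup.center (SU n), m ((z : SU n) * s : SU n).1 =
          c z₀ ^ w * ∑ z : Subgroup.center (SU n), m ((z : SU n) * s : SU n).1 := by
        rw [Finset.mul_sum, ← Equiv.sum_comp (Equiv.mulLeft z₀)]
        refine Finset.sum_congr rfl fun z _ => ?_
        rw [← hmul]
        simp [mul_assoc]
      have h2 : (c z₀ ^ w - 1) * ∑ z : Subgroup.center (SU n),
          m ((z : SU n) * s : SU n).1 = 0 := by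
        rw [sub_mul, ← h1, one_mul, sub_self]
      exact ((mul_eq_zero.1 h2).resolve_left (sub_ne_zero.2 hz₀)).symm

theorem suToPU_center (z : Subgroup.center (SU n)) : suToPU n z = 1 :=
  (QuotientGroup.eq_one_iff _).2 (suToU_mem_center z.2)

theorem suToPU_surjective : Function.Surjective (suToPU n) := by
  rintro ⟨g⟩
  obtain ⟨c, hc, s, rfl, -⟩ := exists_scalarU_mul_suToU g
  refine ⟨s, ?_⟩
  rw [suToPU_eq_mk]
  change (QuotientGroup.mk (suToU n s) : Proj (U n)) = QuotientGroup.mk _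
  rw [QuotientGroup.eq, ← Subgroup.mem_center_iff.1 (scalarU_mem_center c hc),
    inv_mul_cancel_left]
  exact scalarU_mem_center c hc

/-- Real polynomial functions on `SU(n)` that are invariant under the centre descend to `PU(n)`. -/
theorem exists_regular_pu {f : SU n → ℝ} (hf : f ∈ regular ℝ (SU n))
    (hz : ∀ (z : Subgroup.center (SU n)) g, f ((z : SU n) * g) = f g) :
    ∃ f' ∈ regular ℝ (Proj (U n)), f' ∘ suToPU n = f := by
  have := Fintype.ofFinite (Subgroup.center (SU n))
  have hfib : ∀ s t : SU n, suToPU n s = suToPU n t → f s = f t := fun s t h => by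
    rw [suToPU_eq_mk, suToPU_eq_mk, QuotientGroup.eq, ← map_inv, ← map_mul] at h
    have hcen := mem_center_of_suToU_mem_center h
    have h1 := hz ⟨_, hcen⟩ s
    rw [← h1]
    change f (s⁻¹ * t * s) = f t
    rw [← Subgroup.mem_center_iff.1 hcen s, mul_inv_cancel_left]
  choose s hs using suToPU_surjective (n := n)
  have hcomp : (fun p => f (s p)) ∘ suToPU n = f := funext fun t => hfib _ _ (hs _)
  refine ⟨fun p => f (s p), ?_, hcomp⟩
  change (fun g : U n => f (s (QuotientGroup.mk g))) ∈ regular ℝ (U n)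
  rw [regular_su_eq_map] at hf
  obtain ⟨F, hF, hFf⟩ := hf
  -- By invariance of `f`, the sum over the centre is `f` times the order of the centre; hence the
  -- later division by this order.
  obtain ⟨F', hF', h⟩ := exists_scalar_invariant_extension (ofReal_comp_mem_conjPolyFunctions hF)
  have hre := (conjPolyFunctions_le_complexify hF').1
  rw [regular_u_eq_map]
  refine ⟨((Fintype.card (Subgroup.center (SU n)) : ℝ)⁻¹) • fun A => (F' A).re,
    Subalgebra.smul_mem _ hre _, funext fun g => ?_⟩
  obtain ⟨c, hc, t, rfl, -⟩ := exists_scalarU_mul_suToU g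
  have hmk : (QuotientGroup.mk (scalarU n c hc * suToU n t) : Proj (U n)) = suToPU n t := by
    rw [suToPU_eq_mk, eq_comm, QuotientGroup.eq,
      ← Subgroup.mem_center_iff.1 (scalarU_mem_center c hc), inv_mul_cancel_left]
    exact scalarU_mem_center c hc
  have hval : (scalarU n c hc * suToU n t).1 = c • t.1 := by
    change (c • (1 : Matrix (Fin n) (Fin n) ℂ)) * t.1 = c • t.1
    rw [smul_mul_assoc, Matrix.one_mul]
  have hF1 : ∀ t : SU n, F t.1 = f t := fun t => congrFun hFf t
  change (Fintype.card (Subgroup.center (SU n)) : ℝ)⁻¹ * (F' (scalarU n c hc * suToU n t).1).re =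
    f (s (QuotientGroup.mk (scalarU n c hc * suToU n t)))
  rw [hmk, hval, h t c hc]
  have h3 : ∀ z : Subgroup.center (SU n), F ((z : SU n) * t : SU n).1 = f t := fun z => by
    rw [hF1, hz]
  simp only [h3]
  rw [hfib _ _ (hs (suToPU n t)), Finset.sum_const, Finset.card_univ, nsmul_eq_mul]
  have hne : (Fintype.card (Subgroup.center (SU n)) : ℝ) ≠ 0 :=
    Nat.cast_ne_zero.2 Fintype.card_ne_zero
  simp [hne]

end Weights

/-! ### Polynomial images of compact real algebraic sets -/

section PolynomialImage

open MvPolynomial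

theorem exists_mvPolynomial_of_mem_polyFunctions {d : ℕ} {F : (Fin d → ℝ) → ℝ}
    (hF : F ∈ polyFunctions ℝ (Fin d → ℝ)) :
    ∃ p : MvPolynomial (Fin d) ℝ, ∀ x, eval x p = F x := by
  induction hF using Algebra.adjoin_induction with
  | mem F hF =>
    obtain ⟨l, rfl⟩ := hF
    refine ⟨∑ i, C (l (Pi.single i 1)) * X i, fun x => ?_⟩
    rw [map_sum]
    change _ = l x
    conv_rhs => rw [← LinearMap.sum_single_apply (fun _ => ℝ) x, map_sum]
    refine Finset.sum_congr rfl fun i _ => ?_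
    have h : (Pi.single i (x i) : Fin d → ℝ) = x i • (Pi.single i 1 : Fin d → ℝ) := by
      rw [← Pi.single_smul, smul_eq_mul, mul_one]
    rw [h, map_smul]
    simp [mul_comm]
  | algebraMap c => exact ⟨C c, fun x => by simp⟩
  | add F G _ _ hF hG =>
    obtain ⟨p, hp⟩ := hF
    obtain ⟨q, hq⟩ := hG
    exact ⟨p + q, fun x => by simp [hp, hq]⟩
  | mul F G _ _ hF hG =>
    obtain ⟨p, hp⟩ := hF
    obtain ⟨q, hq⟩ := hG
    exact ⟨p * q, fun x => by simp [hp, hq]⟩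

/-- The image of a bounded real algebraic subset of a vector space under a polynomial map is
semi-algebraic. -/
theorem isSemialgebraic_image_polyFunctions {W : Type} [AddCommGroup W] [Module ℝ W]
    [FiniteDimensional ℝ W] {ι τ : Type} [Finite ι] [Finite τ] (e : τ → W → ℝ) (P : ι → W → ℝ)
    (he : ∀ t, e t ∈ polyFunctions ℝ W) (hP : ∀ i, P i ∈ polyFunctions ℝ W)
    (hb : ∀ l : Module.Dual ℝ W, ∃ c, ∀ w, (∀ t, e t w = 0) → |l w| ≤ c) :
    IsSemialgebraic ((fun w i => P i w) '' {w | ∀ t, e t w = 0}) := by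
  let b := Module.finBasis ℝ W
  choose c hc using fun i => hb (b.coord i)
  -- `M` bounds all coordinates on the zero set, so rescaling by it moves the set into the cube; the
  -- summand `1` keeps it positive.
  set M : ℝ := 1 + ∑ i, |c i| with hM
  have hM0 : 0 < M := by positivity
  have hcM : ∀ i, c i ≤ M := fun i => (le_abs_self _).trans
    ((Finset.single_le_sum (fun j _ => abs_nonneg (c j)) (Finset.mem_univ i)).trans (by linarith))
  let L : (Fin (Module.finrank ℝ W) → ℝ) ≃ₗ[ℝ] W :=
    (LinearEquiv.smulOfNeZero ℝ _ M hM0.ne').trans b.equivFun.symm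
  choose pe hpe using fun t => exists_mvPolynomial_of_mem_polyFunctions
    (comp_linearMap_mem_polyFunctions L.toLinearMap (he t))
  choose pP hpP using fun i => exists_mvPolynomial_of_mem_polyFunctions
    (comp_linearMap_mem_polyFunctions L.toLinearMap (hP i))
  have hpe' : ∀ t x, eval x (pe t) = e t (L x) := hpe
  have hpP' : ∀ i x, eval x (pP i) = P i (L x) := hpP
  convert isSemialgebraic_image_of_bounded pe pP fun x hx i => ?_ using 1
  · ext y
    simp only [hpe', hpP', Set.mem_image, Set.mem_ofPred]
    constructor
    · rintro ⟨w, hw, rfl⟩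
      exact ⟨L.symm w, by simpa using hw, by simp⟩
    · rintro ⟨x, hx, rfl⟩
      exact ⟨L x, hx, rfl⟩
  · have h1 := hc i (L x) fun t => by rw [← hpe', hx]
    have h2 : b.coord i (L x) = M * x i := by
      change b.coord i (b.equivFun.symm (M • x)) = _
      rw [Module.Basis.coord_apply, ← Module.Basis.equivFun_apply, LinearEquiv.apply_symm_apply]
      rfl
    rw [h2, abs_mul, abs_of_pos hM0] at h1
    have h3 : |x i| ≤ 1 := le_of_mul_le_mul_left (by linarith [hcM i]) hM0
    exact abs_le.1 h3

end PolynomialImage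

/-! ### Separation of orbits -/

section Separation

variable {W : Type} [AddCommGroup W] [Module ℝ W] [FiniteDimensional ℝ W] [TopologicalSpace W]
  [IsTopologicalAddGroup W] [ContinuousSMul ℝ W] [T2Space W]

theorem continuous_of_mem_polyFunctions {F : W → ℝ} (hF : F ∈ polyFunctions ℝ W) :
    Continuous F := by
  induction hF using Algebra.adjoin_induction with
  | mem F hF =>
    obtain ⟨l, rfl⟩ := hF
    exact l.continuous_of_finiteDimensional
  | algebraMap c => exact continuous_const
  | add F G _ _ hF hG => exact hF.add hG
  | mul F G _ _ hF hG => exact hF.mul hG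

open MeasureTheory in
/-- Invariant polynomial functions separate the orbits of a compact group of linear
transformations. -/
theorem exists_invariant_separating [LocallyCompactSpace W] {K : Type} [Group K]
    [TopologicalSpace K] [IsTopologicalGroup K] [CompactSpace K] (ρ : Representation ℝ K W)
    (hρ : ∀ w, Continuous fun g => ρ g w) {w w' : W} (h : ∀ g, ρ g w ≠ w') :
    ∃ F ∈ invariantPolyFunctions ρ, F w ≠ F w' := by
  have hρ' : ∀ (l : Module.Dual ℝ W) w, Continuous fun g => l (ρ g w) := fun l w =>
    l.continuous_of_finiteDimensional.comp (hρ w)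
  have hO : ∀ w, IsCompact (Set.range fun g => ρ g w) := fun w => isCompact_range (hρ w)
  have hdisj : Disjoint (Set.range fun g => ρ g w) (Set.range fun g => ρ g w') := by
    rw [Set.disjoint_left]
    rintro _ ⟨g, rfl⟩ ⟨g', hg⟩
    refine h (g'⁻¹ * g) ?_
    have hg' : ρ g' w' = ρ g w := hg
    rw [map_mul, Module.End.mul_apply, ← hg', ← Module.End.mul_apply, ← map_mul, inv_mul_cancel,
      map_one, Module.End.one_apply]
  -- A Urysohn function is `0` on one orbit and `1` on the other. A polynomial within `1/4` of it on
  -- both orbits has averages at most `1/4` and at least `3/4`.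
  obtain ⟨u, hu0, hu1, -⟩ := exists_continuous_zero_one_of_isCompact (hO w) (hO w').isClosed hdisj
  let A : Subalgebra ℝ C(W, ℝ) := (polyFunctions ℝ W).comap (ContinuousMap.coeFnAlgHom ℝ)
  have hA : A.SeparatesPoints := fun x y hxy => by
    have : ∃ l : Module.Dual ℝ W, l x ≠ l y := by
      by_contra! hall
      exact hxy (sub_eq_zero.1 ((Module.forall_dual_apply_eq_zero_iff ℝ _).1 fun l => by
        rw [map_sub, hall l, sub_self]))
    obtain ⟨l, hl⟩ := this
    exact ⟨_, ⟨⟨l, l.continuous_of_finiteDimensional⟩, dual_mem_polyFunctions l, rfl⟩, hl⟩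
  obtain ⟨P, hPA, hP⟩ := ContinuousMap.exists_mem_subalgebra_near_continuous_of_isCompact_of_separatesPoints hA u
    ((hO w).union (hO w')) (show (0 : ℝ) < 1 / 4 by norm_num)
  borelize K
  obtain ⟨μ, _, _⟩ := exists_haar_probability K
  have hPm : (P : W → ℝ) ∈ polyFunctions ℝ W := hPA
  have hint : ∀ v, Integrable (fun g => (P : W → ℝ) (ρ g⁻¹ v)) μ :=
    (integral_mem_of_mem_continuousPolySpan μ (translate_mem_continuousPolySpan ρ hρ' hPm)).1
  refine ⟨average ρ μ P, average_mem hρ' μ hPm, ne_of_lt ?_⟩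
  have h1 : average ρ μ P w ≤ ∫ _, (1 / 4 : ℝ) ∂μ :=
    integral_mono (hint w) (integrable_const _) fun g => by
      have h2 := hP (ρ g⁻¹ w) (Or.inl ⟨g⁻¹, rfl⟩)
      have h3 : u (ρ g⁻¹ w) = 0 := hu0 ⟨g⁻¹, rfl⟩
      rw [h3, Real.norm_eq_abs, abs_lt] at h2
      linarith [h2.2]
  have h1' : ∫ _, (3 / 4 : ℝ) ∂μ ≤ average ρ μ P w' :=
    integral_mono (integrable_const _) (hint w') fun g => by
      have h2 := hP (ρ g⁻¹ w') (Or.inr ⟨g⁻¹, rfl⟩)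
      have h3 : u (ρ g⁻¹ w') = 1 := hu1 ⟨g⁻¹, rfl⟩
      rw [h3, Real.norm_eq_abs, abs_lt] at h2
      linarith [h2.1]
  simp only [integral_const, probReal_univ, one_smul] at h1 h1'
  linarith

end Separation

/-! ### Topology of representation spaces -/

section Topology

variable {r : ℕ} {G : Type} [Group G]

theorem Rep.gen_bijective : Function.Bijective (Rep.gen : Rep r G → Fin r → G) :=
  ⟨fun _ _ h => Rep.ext (congrFun h), fun g => ⟨Rep.ofGen g, funext (Rep.gen_ofGen g)⟩⟩

theorem Rep.continuous_gen [TopologicalSpace G] :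
    Continuous (Rep.gen : Rep r G → Fin r → G) := continuous_induced_dom

instance [TopologicalSpace G] [CompactSpace G] : CompactSpace (Rep r G) :=
  ((Equiv.ofBijective _ Rep.gen_bijective).toHomeomorphOfIsInducing ⟨rfl⟩ :
    Rep r G ≃ₜ (Fin r → G)).symm.compactSpace

theorem Rep.continuous_comp {H : Type} [Group H] [TopologicalSpace G] [TopologicalSpace H]
    {π : G →* H} (hπ : Continuous π) : Continuous (Rep.comp π : Rep r G → Rep r H) :=
  continuous_induced_rng.2 (continuous_pi fun i =>
    hπ.comp ((continuous_apply i).comp Rep.continuous_gen))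

theorem continuous_of_mem_regular_rep [TopologicalSpace G] [FunctionSpace ℝ G]
    (h : ∀ f ∈ regular ℝ G, Continuous f) {φ : Rep r G → ℝ} (hφ : φ ∈ regular ℝ (Rep r G)) :
    Continuous φ := by
  rw [regular_rep_eq_adjoin] at hφ
  induction hφ using Algebra.adjoin_induction with
  | mem F hF =>
    obtain ⟨i, f, hf, rfl⟩ := hF
    exact (h f hf).comp ((continuous_apply i).comp Rep.continuous_gen)
  | algebraMap c => exact continuous_const
  | add F G _ _ hF hG => exact hF.add hG
  | mul F G _ _ hF hG => exact hF.mul hG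

variable {n : ℕ}

theorem continuous_of_mem_regular_su {f : SU n → ℝ} (hf : f ∈ regular ℝ (SU n)) :
    Continuous f := by
  rw [regular_su_eq_map] at hf
  obtain ⟨F, hF, rfl⟩ := hf
  exact (continuous_of_mem_polyFunctions hF).comp continuous_subtype_val

theorem continuous_of_mem_regular_pu {f : Proj (U n) → ℝ} (hf : f ∈ regular ℝ (Proj (U n))) :
    Continuous f := by
  have hf' : (f ∘ QuotientGroup.mk : U n → ℝ) ∈ regular ℝ (U n) := hf
  rw [regular_u_eq_map] at hf'
  obtain ⟨F, hF, h⟩ := hf'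
  rw [(QuotientGroup.isQuotientMap_mk _).continuous_iff, ← h]
  exact (continuous_of_mem_polyFunctions hF).comp continuous_subtype_val

theorem continuous_suToPU : Continuous (suToPU n) :=
  (QuotientGroup.isQuotientMap_mk _).continuous.comp (Continuous.subtype_mk continuous_subtype_val _)

end Topology

/-! ### Representations in `SU(n)` as tuples of matrices -/

section Matrices

open Matrix

variable {n r : ℕ}

/-- The tuple of matrices of a representation in `SU(n)`. -/
def Rep.matrices (ρ : Rep r (SU n)) : Fin r → Matrix (Fin n) (Fin n) ℂ := fun i => (ρ.gen i).1

theorem Rep.continuous_matrices : Continuous (Rep.matrices : Rep r (SU n) → _) :=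
  continuous_pi fun i => continuous_subtype_val.comp ((continuous_apply i).comp Rep.continuous_gen)

theorem Rep.matrices_injective : Function.Injective (Rep.matrices : Rep r (SU n) → _) :=
  fun _ _ h => Rep.ext fun i => Subtype.ext (congrFun h i)

theorem mem_regular_rep_su_iff {φ : Rep r (SU n) → ℝ} : φ ∈ regular ℝ (Rep r (SU n)) ↔
    ∃ F ∈ polyFunctions ℝ (Fin r → Matrix (Fin n) (Fin n) ℂ), F ∘ Rep.matrices = φ := by
  rw [regular_rep_eq_map (regular_su_eq_map n)]
  rfl

theorem Rep.matrices_smul (g : SU n × (Fin r → Subgroup.center (SU n))) (ρ : Rep r (SU n)) :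
    (g.2 • g.1 • ρ).matrices = conjRep ℝ n r g ρ.matrices := by
  funext i
  rw [conjRep_apply]
  change ((g.2 • g.1 • ρ).gen i).1 = _
  rw [Rep.gen_central, Rep.gen_conj]
  rfl

theorem mem_range_matrices_iff {w : Fin r → Matrix (Fin n) (Fin n) ℂ} :
    w ∈ Set.range (Rep.matrices : Rep r (SU n) → _) ↔
      ∀ l, star (w l) * w l = 1 ∧ (w l).det = 1 := by
  simp_rw [← mem_unitaryGroup_iff', ← mem_specialUnitaryGroup_iff]
  constructor
  · rintro ⟨ρ, rfl⟩ l
    exact (ρ.gen l).2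
  · intro h
    refine ⟨Rep.ofGen fun l => ⟨w l, h l⟩, funext fun l => ?_⟩
    change ((Rep.ofGen fun l => (⟨w l, h l⟩ : SU n)).gen l).1 = w l
    rw [Rep.gen_ofGen]

/-- The image of `R_r(SU(n))` under a polynomial map is semi-algebraic. -/
theorem isSemialgebraic_range {κ : Type} [Finite κ] {q : Rep r (SU n) → κ → ℝ}
    (hq : ∀ i, (fun ρ => q ρ i) ∈ regular ℝ (Rep r (SU n))) : IsSemialgebraic (Set.range q) := by
  choose P hP hPq using fun i => mem_regular_rep_su_iff.1 (hq i)
  let B := complexify (polyFunctions ℝ (Fin r → Matrix (Fin n) (Fin n) ℂ))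
  have hent : ∀ l i j, (fun w : Fin r → Matrix (Fin n) (Fin n) ℂ => w l i j) ∈ B := fun l i j =>
    let E : (Fin r → Matrix (Fin n) (Fin n) ℂ) →ₗ[ℝ] ℂ :=
      (Matrix.entryLinearMap ℝ ℂ i j).comp (LinearMap.proj l)
    ⟨dual_mem_polyFunctions (Complex.reLm.comp E), dual_mem_polyFunctions (Complex.imLm.comp E)⟩
  have h1 : ∀ l i j, (fun w : Fin r → Matrix (Fin n) (Fin n) ℂ =>
      (star (w l) * w l) i j - (1 : Matrix (Fin n) (Fin n) ℂ) i j) ∈ B := fun l i j => by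
    refine B.sub_mem ?_ (B.algebraMap_mem _)
    have h := sum_mem fun (m : Fin n) (_ : m ∈ Finset.univ) =>
      B.mul_mem (star_mem_complexify (hent l m i)) (hent l m j)
    convert h using 1
    funext w
    rw [Finset.sum_apply]
    exact Matrix.mul_apply
  have h2 : ∀ l, (fun w : Fin r → Matrix (Fin n) (Fin n) ℂ => (w l).det - 1) ∈ B := fun l =>
    B.sub_mem (det_mem_of_entry_mem (hent l)) B.one_mem
  -- The equations of `SU(n)^r`: the index `none` stands for the determinant, a pair for an entry of
  -- the unitarity relation. Below, `e'` splits them into real and imaginary parts.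
  let e : (Fin r × Option (Fin n × Fin n)) → (Fin r → Matrix (Fin n) (Fin n) ℂ) → ℂ :=
    fun t w => t.2.elim ((w t.1).det - 1) fun p =>
      (star (w t.1) * w t.1) p.1 p.2 - (1 : Matrix (Fin n) (Fin n) ℂ) p.1 p.2
  have he : ∀ t, e t ∈ B := by
    rintro ⟨l, _ | ⟨i, j⟩⟩
    exacts [h2 l, h1 l i j]
  have hzero : ∀ w, (∀ t, e t w = 0) ↔ w ∈ Set.range (Rep.matrices : Rep r (SU n) → _) :=
    fun w => by
    rw [mem_range_matrices_iff]
    constructor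
    · exact fun h l => ⟨Matrix.ext fun i j => sub_eq_zero.1 (h (l, some (i, j))),
        sub_eq_zero.1 (h (l, none))⟩
    · rintro h ⟨l, _ | ⟨i, j⟩⟩
      exacts [sub_eq_zero.2 (h l).2, sub_eq_zero.2 (by rw [(h l).1])]
  let e' : (Fin r × Option (Fin n × Fin n)) ⊕ (Fin r × Option (Fin n × Fin n)) →
      (Fin r → Matrix (Fin n) (Fin n) ℂ) → ℝ :=
    Sum.elim (fun t w => (e t w).re) fun t w => (e t w).im
  have hzero' : ∀ w, (∀ t, e' t w = 0) ↔ w ∈ Set.range (Rep.matrices : Rep r (SU n) → _) :=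
    fun w => by
    rw [← hzero, Sum.forall, ← forall_and]
    exact forall_congr' fun t => (@Complex.ext_iff (e t w) 0).symm
  have himage : Set.range q = (fun w i => P i w) '' {w | ∀ t, e' t w = 0} := by
    have hset : {w | ∀ t, e' t w = 0} = Set.range (Rep.matrices : Rep r (SU n) → _) :=
      Set.ext hzero'
    rw [hset, ← Set.range_comp]
    congr 1
    funext ρ i
    exact (congrFun (hPq i) ρ).symm
  rw [himage]
  refine isSemialgebraic_image_polyFunctions e' P ?_ hP fun l => ?_
  · rintro (t | t)
    exacts [(he t).1, (he t).2]
  -- Boundedness of the zero set is compactness of `R_r(SU(n))`.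
  · obtain ⟨c, hc⟩ := isCompact_univ.exists_bound_of_continuousOn
      (l.continuous_of_finiteDimensional.comp
        (Rep.continuous_matrices (r := r) (n := n))).continuousOn
    refine ⟨c, fun w hw => ?_⟩
    obtain ⟨ρ, rfl⟩ := (hzero' w).1 hw
    exact hc ρ trivial

end Matrices

/-! ### Quotients of `R_r(SU(n))` -/

section Quotients

variable {n r : ℕ}

theorem IsCoordinates.mem_regular {X : Type} [FunctionSpace ℝ X] {k : ℕ} {p : X → Fin k → ℝ} (hp : IsCoordinates p) (i : Fin k) :
    (fun x => p x i) ∈ regular ℝ X := by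
  rw [← hp]
  exact Algebra.subset_adjoin ⟨i, rfl⟩

theorem IsCoordinates.eq_of_mem_regular {X : Type} [FunctionSpace ℝ X] {k : ℕ} {p : X → Fin k → ℝ} (hp : IsCoordinates p)
    {x y : X} (h : p x = p y) {F : X → ℝ} (hF : F ∈ regular ℝ X) : F x = F y := by
  rw [← hp] at hF
  induction hF using Algebra.adjoin_induction with
  | mem F hF =>
    obtain ⟨i, rfl⟩ := hF
    exact congrFun h i
  | algebraMap c => rfl
  | add F G _ _ hF hG => rw [Pi.add_apply, Pi.add_apply, hF, hG]
  | mul F G _ _ hF hG => rw [Pi.mul_apply, Pi.mul_apply, hF, hG]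

/-- A map on `R_r(SU(n))` whose fibres are the orbits of `SU(n) × Z(SU(n))^r` and for which the
functions on the target are regular if and only if their pull-backs are. -/
structure IsPolynomialQuotient {X : Type} [TopologicalSpace X] [FunctionSpace ℝ X]
    (π : Rep r (SU n) → X) : Prop where
  surjective : Function.Surjective π
  continuous : Continuous π
  eq_iff : ∀ ρ σ, π ρ = π σ ↔
    ∃ (g : SU n) (z : Fin r → Subgroup.center (SU n)), z • g • ρ = σ
  mem_regular_iff : ∀ F : X → ℝ, F ∈ regular ℝ X ↔ F ∘ π ∈ regular ℝ (Rep r (SU n))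
  continuous_of_mem : ∀ F ∈ regular ℝ X, Continuous F

variable {X : Type} [TopologicalSpace X] [FunctionSpace ℝ X] {π : Rep r (SU n) → X}

theorem IsPolynomialQuotient.exists_comp_eq (hπ : IsPolynomialQuotient π) {T : Type}
    {f : Rep r (SU n) → T}
    (hf : ∀ (g : SU n × (Fin r → Subgroup.center (SU n))) ρ, f (g.2 • g.1 • ρ) = f ρ) :
    ∃ F : X → T, F ∘ π = f := by
  choose s hs using hπ.surjective
  refine ⟨fun x => f (s x), funext fun ρ => ?_⟩
  obtain ⟨g, z, h⟩ := (hπ.eq_iff (s (π ρ)) ρ).1 (hs _)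
  exact (hf (g, z) _).symm.trans (congrArg f h)

variable [NeZero n]

/-- Pull-back identifies the regular functions with the invariants of a compact group on
`R_r(SU(n))`. -/
theorem IsPolynomialQuotient.regular_fg (hπ : IsPolynomialQuotient π) : (regular ℝ X).FG := by
  have hinj : Function.Injective (pullback ℝ π) := fun F G h =>
    hπ.surjective.injective_comp_right h
  refine Subalgebra.fg_of_fg_map _ (pullback ℝ π) hinj ?_
  refine fg_of_mem_iff (conjRep ℝ n r) (continuous_dual_conjRep ℝ n r) Rep.matrices
    (fun g ρ => g.2 • g.1 • ρ) Rep.matrices_smul _ fun f => ?_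
  rw [← mem_regular_rep_su_iff]
  constructor
  · rintro ⟨F, hF, rfl⟩
    exact ⟨(hπ.mem_regular_iff F).1 hF, fun g ρ =>
      congrArg F ((hπ.eq_iff _ _).2 ⟨g.1, g.2, rfl⟩).symm⟩
  · rintro ⟨hf, hinv⟩
    obtain ⟨F, rfl⟩ := hπ.exists_comp_eq hinv
    exact ⟨F, (hπ.mem_regular_iff F).2 hf, rfl⟩

theorem IsPolynomialQuotient.exists_regular_separating (hπ : IsPolynomialQuotient π) {x y : X}
    (h : x ≠ y) : ∃ F ∈ regular ℝ X, F x ≠ F y := by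
  obtain ⟨ρ, rfl⟩ := hπ.surjective x
  obtain ⟨σ, rfl⟩ := hπ.surjective y
  have : LocallyCompactSpace (Fin r → Matrix (Fin n) (Fin n) ℂ) :=
    inferInstanceAs (LocallyCompactSpace (Fin r → Fin n → Fin n → ℂ))
  obtain ⟨P, hP, hne⟩ := exists_invariant_separating (conjRep ℝ n r)
    (continuous_conjRep ℝ n r) (w := ρ.matrices)
    (w' := σ.matrices) fun g hg => h ((hπ.eq_iff _ _).2 ⟨g.1, g.2, Rep.matrices_injective
      ((Rep.matrices_smul g ρ).trans hg)⟩)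
  obtain ⟨F, hF⟩ := hπ.exists_comp_eq (f := P ∘ Rep.matrices) fun g ρ => by
    rw [Function.comp_apply, Rep.matrices_smul, hP.2, Function.comp_apply]
  refine ⟨F, (hπ.mem_regular_iff F).2 (hF ▸ mem_regular_rep_su_iff.2 ⟨P, hP.1, rfl⟩), ?_⟩
  have h1 : ∀ τ, F (π τ) = P τ.matrices := congrFun hF
  rwa [h1, h1]

/-- `X` is compact, and the coordinates separate its points because they generate an algebra that
does. -/
theorem IsPolynomialQuotient.isClosedEmbedding (hπ : IsPolynomialQuotient π) {k : ℕ}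
    {p : X → Fin k → ℝ} (hp : IsCoordinates p) : Topology.IsClosedEmbedding p := by
  have : CompactSpace X := ⟨by
    rw [← hπ.surjective.range_eq]
    exact isCompact_range hπ.continuous⟩
  refine Continuous.isClosedEmbedding
    (continuous_pi fun i => hπ.continuous_of_mem _ (hp.mem_regular i)) fun x y hxy => ?_
  by_contra hne
  obtain ⟨F, hF, h⟩ := hπ.exists_regular_separating hne
  exact h (hp.eq_of_mem_regular hxy hF)

theorem IsPolynomialQuotient.exists_isCoordinates (hπ : IsPolynomialQuotient π) :
    ∃ (k : ℕ) (p : X → Fin k → ℝ), IsCoordinates p := by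
  obtain ⟨S, hS⟩ := hπ.regular_fg
  refine ⟨S.card, fun x i => (S.equivFin.symm i).1 x, ?_⟩
  rw [IsCoordinates, ← hS]
  congr 1
  ext f
  constructor
  · rintro ⟨i, rfl⟩
    exact (S.equivFin.symm i).2
  · exact fun hf => ⟨S.equivFin ⟨f, hf⟩, by simp⟩

theorem IsPolynomialQuotient.isSemialgebraicSpace (hπ : IsPolynomialQuotient π) :
    IsSemialgebraicSpace X := by
  refine ⟨hπ.exists_isCoordinates, fun k p hp => ⟨(hπ.isClosedEmbedding hp).isEmbedding, ?_⟩⟩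
  rw [← hπ.surjective.range_comp]
  exact isSemialgebraic_range fun i => (hπ.mem_regular_iff _).1 (hp.mem_regular i)

theorem IsPolynomialQuotient.isQuotientMap (hπ : IsPolynomialQuotient π) :
    Topology.IsQuotientMap π := by
  obtain ⟨k, p, hp⟩ := hπ.exists_isCoordinates
  have := (hπ.isClosedEmbedding hp).isEmbedding.t2Space
  exact hπ.continuous.isClosedMap.isQuotientMap hπ.continuous hπ.surjective

theorem IsPolynomialQuotient.exists_continuous_comp_eq {Y : Type} [TopologicalSpace Y]
    [FunctionSpace ℝ Y] {π' : Rep r (SU n) → Y} (hπ : IsPolynomialQuotient π)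
    (hπ' : IsPolynomialQuotient π') : ∃ F : X → Y, Continuous F ∧ F ∘ π = π' := by
  obtain ⟨F, hF⟩ := hπ.exists_comp_eq (f := π') fun g ρ =>
    ((hπ'.eq_iff _ _).2 ⟨g.1, g.2, rfl⟩).symm
  exact ⟨F, hπ.isQuotientMap.continuous_iff.2 (hF ▸ hπ'.continuous), hF⟩

/-- Two such quotients have the same fibres, hence determine each other. The graph is the image of
`R_r(SU(n))` under the pair of coordinate maps, which is polynomial. -/
theorem IsPolynomialQuotient.exists_semialgebraicIso {Y : Type} [TopologicalSpace Y]
    [FunctionSpace ℝ Y] {π' : Rep r (SU n) → Y} (hπ : IsPolynomialQuotient π)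
    (hπ' : IsPolynomialQuotient π') :
    ∃ Ψ : SemialgebraicIso X Y, ∀ ρ, Ψ.toHomeomorph (π ρ) = π' ρ := by
  obtain ⟨F, hF, hFπ⟩ := hπ.exists_continuous_comp_eq hπ'
  obtain ⟨G, hG, hGπ⟩ := hπ'.exists_continuous_comp_eq hπ
  have h1 : ∀ ρ, F (π ρ) = π' ρ := congrFun hFπ
  have h2 : ∀ ρ, G (π' ρ) = π ρ := congrFun hGπ
  refine ⟨{
    toFun := F
    invFun := G
    left_inv := hπ.surjective.forall.2 fun ρ => by rw [h1, h2]
    right_inv := hπ'.surjective.forall.2 fun ρ => by rw [h2, h1]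
    continuous_toFun := hF
    continuous_invFun := hG
    graph_semialgebraic := fun k l p q hp hq => ?_ }, h1⟩
  rw [← hπ.surjective.range_comp]
  refine isSemialgebraic_range ?_
  rintro (i | i)
  · exact (hπ.mem_regular_iff _).1 (hp.mem_regular i)
  · have h := (hπ'.mem_regular_iff _).1 (hq.mem_regular i)
    convert h using 1
    funext ρ
    exact congrArg (fun y => q y i) (h1 ρ)

end Quotients

/-! ### The character varieties of `SU(n)` and `PU(n)` -/

section CharacterVarieties

theorem orbitProj_eq_iff {Γ X : Type} [Group Γ] [MulAction Γ X] {x y : X} :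
    orbitProj Γ x = orbitProj Γ y ↔ ∃ g : Γ, g • x = y := by
  rw [eq_comm]
  exact Quotient.eq

theorem orbitProj_surjective {Γ X : Type} [Group Γ] [MulAction Γ X] :
    Function.Surjective (orbitProj Γ : X → OrbitSpace Γ X) := Quotient.mk_surjective

theorem continuous_orbitProj {Γ X : Type} [Group Γ] [MulAction Γ X] [TopologicalSpace X] :
    Continuous (orbitProj Γ : X → OrbitSpace Γ X) := continuous_coinduced_rng

variable (n r : ℕ)

/-- The two actions commute, so the iterated orbits are those of the product group. -/
theorem isPolynomialQuotient_su : IsPolynomialQuotient fun ρ : Rep r (SU n) =>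
    orbitProj (Fin r → Subgroup.center (SU n)) (orbitProj (SU n) ρ) where
  surjective := orbitProj_surjective.comp orbitProj_surjective
  continuous := continuous_orbitProj.comp continuous_orbitProj
  eq_iff ρ σ := by
    rw [orbitProj_eq_iff, exists_comm]
    refine exists_congr fun z => ?_
    rw [show z • orbitProj (SU n) ρ = orbitProj (SU n) (z • ρ) from rfl, orbitProj_eq_iff]
    exact exists_congr fun g => by rw [smul_comm z g ρ]
  mem_regular_iff _ := Iff.rfl
  continuous_of_mem F hF := by
    have h := continuous_of_mem_regular_rep (r := r) (fun f => continuous_of_mem_regular_su)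
      (φ := fun ρ : Rep r (SU n) =>
        F (orbitProj (Fin r → Subgroup.center (SU n)) (orbitProj (SU n) ρ))) hF
    exact continuous_coinduced_dom.2 (continuous_coinduced_dom.2 h)

/-- Two lifts of a representation to `SU(n)` differ by central factors at the generators, and
`PU(n)` is covered by `SU(n)`, so conjugation by `PU(n)` is conjugation by `SU(n)`. -/
theorem isPolynomialQuotient_pu [NeZero n] : IsPolynomialQuotient fun ρ : Rep r (SU n) =>
    orbitProj (Proj (U n)) (Rep.comp (suToPU n) ρ) where
  surjective := orbitProj_surjective.comp (Rep.comp_surjective suToPU_surjective)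
  continuous := continuous_orbitProj.comp (Rep.continuous_comp continuous_suToPU)
  eq_iff ρ σ := by
    rw [orbitProj_eq_iff, suToPU_surjective.exists]
    refine exists_congr fun g => ?_
    rw [← Rep.comp_smul]
    constructor
    · intro h
      have hz : ∀ i, σ.gen i * ((g • ρ).gen i)⁻¹ ∈ Subgroup.center (SU n) := fun i => by
        have hi : suToPU n ((g • ρ).gen i) = suToPU n (σ.gen i) :=
          congrArg (fun τ => Rep.gen τ i) h
        refine mem_center_of_suToU_mem_center ((QuotientGroup.eq_one_iff _).1 ?_)
        change suToPU n (σ.gen i * ((g • ρ).gen i)⁻¹) = 1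
        rw [map_mul, map_inv, hi, mul_inv_cancel]
      exact ⟨fun i => ⟨_, hz i⟩, Rep.ext fun i => by
        rw [Rep.gen_central, inv_mul_cancel_right]⟩
    · rintro ⟨z, rfl⟩
      rw [Rep.comp_central_smul suToPU_center]
  mem_regular_iff F := by
    constructor
    · exact fun hF => comp_repComp_mem_regular (F := F ∘ orbitProj (Proj (U n)))
        (fun f => comp_suToPU_mem_regular) hF
    · intro hF
      obtain ⟨F', hF', h⟩ := exists_regular_descend (π := suToPU n)
        (fun z f hf => translate_mem_regular_su z hf) (fun f hf hz => exists_regular_pu hf hz) hF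
        fun z ρ => by rw [Function.comp_apply, Rep.comp_central_smul suToPU_center]; rfl
      have h' : F' = F ∘ orbitProj (Proj (U n)) :=
        (Rep.comp_surjective suToPU_surjective).injective_comp_right h
      change F ∘ orbitProj (Proj (U n)) ∈ regular ℝ (Rep r (Proj (U n)))
      rwa [← h']
  continuous_of_mem F hF := continuous_coinduced_dom.2
    (continuous_of_mem_regular_rep (fun f => continuous_of_mem_regular_pu) hF)

end CharacterVarieties

end CharVar

end

theorem mainTheorem12 (n r : ℕ) (hn : 1 ≤ n) :
    (CharVar.IsAffineVariety ℂ (CharVar.XC r (CharVar.Proj (CharVar.SL n))) ∧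
      CharVar.IsAffineVariety ℂ (CharVar.GITQuotient ℂ
        (Fin r → Subgroup.center (CharVar.SL n)) (CharVar.XC r (CharVar.SL n))) ∧
      ∃ Φ : CharVar.VarietyIso ℂ
          (CharVar.GITQuotient ℂ
            (Fin r → Subgroup.center (CharVar.SL n)) (CharVar.XC r (CharVar.SL n)))
          (CharVar.XC r (CharVar.Proj (CharVar.SL n))),
        ∀ ρ : CharVar.Rep r (CharVar.SL n),
          Φ.toEquiv (CharVar.gitProj ℂ (Fin r → Subgroup.center (CharVar.SL n))
              (CharVar.gitProj ℂ (CharVar.SL n) ρ)) =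
            CharVar.gitProj ℂ (CharVar.Proj (CharVar.SL n))
              (CharVar.Rep.comp (CharVar.slToPSL n) ρ)) ∧
    (CharVar.IsSemialgebraicSpace (CharVar.XK r (CharVar.Proj (CharVar.U n))) ∧
      CharVar.IsSemialgebraicSpace (CharVar.OrbitSpace
        (Fin r → Subgroup.center (CharVar.SU n)) (CharVar.XK r (CharVar.SU n))) ∧
      ∃ Ψ : CharVar.SemialgebraicIso
          (CharVar.OrbitSpace
            (Fin r → Subgroup.center (CharVar.SU n)) (CharVar.XK r (CharVar.SU n)))
          (CharVar.XK r (CharVar.Proj (CharVar.U n))),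
        ∀ ρ : CharVar.Rep r (CharVar.SU n),
          Ψ.toHomeomorph (CharVar.orbitProj (Fin r → Subgroup.center (CharVar.SU n))
              (CharVar.orbitProj (CharVar.SU n) ρ)) =
            CharVar.orbitProj (CharVar.Proj (CharVar.U n))
              (CharVar.Rep.comp (CharVar.suToPU n) ρ)) := by
  have : NeZero n := ⟨by omega⟩
  exact ⟨CharVar.isAffineVariety_and_exists_iso_psl,
    (CharVar.isPolynomialQuotient_pu n r).isSemialgebraicSpace,
    (CharVar.isPolynomialQuotient_su n r).isSemialgebraicSpace,
    (CharVar.isPolynomialQuotient_su n r).exists_semialgebraicIso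
      (CharVar.isPolynomialQuotient_pu n r)⟩
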